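/- **Setting.** Let $b:\mathbb R^d\to\mathbb R^d$ and $\sigma:\mathbb R^d\to\mathbb R^d\otimes\mathbb R^r$ be Lipschitz, $\|\sigma(x)\|:=\mathrm{Tr}(\sigma\sigma^*(x))^{1/2}$ with $\sup_x\|\sigma(x)\|^2<\infty$, and let $\mathcal A f=b\cdot\nabla f+\frac12\mathrm{Tr}(\sigma\sigma^*D^2f)$. Assume: 1. (Lyapunov) There is $V\in\mathcal C^2(\mathbb R^d,\mathbb R)$, $V\ge v^*>0$, with $D^2V$ bounded, $V(x)\to\infty$ as $|x|\to\infty$, $|\nabla V|^2+|b|^2\le C_VV$ and $\mathcal AV\le-\alpha_VV+\beta_V$, for some $C_V,\alpha_V>0$, $\beta_V\ge0$. 2. The SDE $dY_t=b(Y_t)dt+\sigma(Y_t)dW_t$ has a unique invariant probability measure $\nu$. 3. (Steps) $(\gamma_k)_{k\ge1}$ is positive, non-increasing, $\gamma_k\asymp k^{-\theta}$, and $\gamma_k\le\min\big(\frac1{2\sqrt{C_V\bar c}},\frac{\alpha_V}{2C_V\|D^2V\|_\infty}\big)$ for all $k$, where $\bar c>0$ is such that $V(x)\le\bar c|x|^2$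 outside a ball. Put $\Gamma_n=\sum_{k=1}^n\gamma_k$. 4. (Scheme) $X_{n+1}=X_n+\gamma_{n+1}b(X_n)+\sqrt{\gamma_{n+1}}\,\sigma(X_n)U_{n+1}$, where $\mathbb E\,e^{\lambda|X_0|^2}<\infty$ for all $\lambda<\lambda_0$, for some $\lambda_0>0$; the $U_k$ are i.i.d., independent of $X_0$, with $\mathbb E[U_1^i]=0$, $\mathbb E[U_1^iU_1^j]=\delta_{ij}$, $\mathbb E[U_1^iU_1^jU_1^k]=0$ and $\mathbb E\,e^{\lambda g(U_1)}\le e^{\lambda\mathbb E g(U_1)+\lambda^2/2}$ for all $1$-Lipschitz $g$ and all $\lambda>0$. Put $\nu_n(f)=\Gamma_n^{-1}\sum_{k=1}^n\gamma_kf(X_{k-1})$. 5. $\beta\in(0,1]$ and $\varphi,\vartheta\in\mathcal C^{3,\beta}(\mathbb R^d,\mathbb R)$ (derivatives of orders $1,2,3$ bounded, third derivatives $\beta$-Hölder); for $f=\varphi$ and $f=\vartheta$, the map $x\mapsto\langle b(x),\nabla f(x)\rangle$ is Lipschitz and $|f|\le C(1+\sqrt V)$ for some constant $C$; and $\mathcal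 A\vartheta=|\sigma^*\nabla\varphi|^2-\nu(|\sigma^*\nabla\varphi|^2)$. 6. $\theta\in(\frac1{2+\beta},1]$ (that is, $\theta\in(\frac13,1]$ when $\beta=1$). Write $v=\nu(|\sigma^*\nabla\varphi|^2)$, $\|\sigma\|_\infty=\sup_x\|\sigma(x)\|$, $\|\nabla\vartheta\|_\infty=\sup_x|\nabla\vartheta(x)|$. **Theorem.** There exist sequences $c_n,C_n\ge0$, respectively non-decreasing and non-increasing for $n$ large enough, with $c_n\to1$, $C_n\to1$; sequences $q_n,\hat q_n,\bar q_n>1$ tending to $1$; and a sequence $e_n>0$ tending to $0$, none of them depending on $a$ or $\rho$, such that with $$\tilde A_n=\frac{q_nv}2+e_n,\qquad \tilde B_n=\frac{q_n^3\hat q_n}4\Big(\frac{\bar q_n\|\sigma\|_\infty^2\|\nabla\vartheta\|_\infty^2}2+e_n\Big),$$ $$\Phi_n(a,\rho)=\sum_{\pm}\Big(\frac a{\sqrt{\Gamma_n}\tilde B_n}\pm\Big(\frac{a^2}{\tilde B_n^2\Gamma_n}+(\rho-1)\Big(\frac{2\tilde A_n}{3\tilde B_n}\Big)^3\Big)^{1/2}\Big)^{1/3}\quad\text{(real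 cube roots)},$$ $$P_{\min}(a,\Gamma_n,\rho)=-\frac{(\rho-1)^{1/3}}\rho\,\frac{\sqrt{\Gamma_n}\,\Phi_n(a,\rho)}8\Big(3a-\sqrt{\Gamma_n}(\rho-1)^{1/3}\tilde A_n\Phi_n(a,\rho)\Big),$$ the following hold. (i) For all $n\ge1$, $a>0$, $\rho>1$: $\ \mathbb P\big[|\sqrt{\Gamma_n}\,\nu_n(\mathcal A\varphi)|\ge a\big]\le2C_n\exp\big(c_nP_{\min}(a,\Gamma_n,\rho)\big).$ (ii) For all $n\ge1$, $a>0$, $\rho>1$: $\ P_{\min}(a,\Gamma_n,\rho)=\min_{\lambda>0}\Big(-\frac{a\lambda}{\sqrt{\Gamma_n}}+\frac{\lambda^2}{\Gamma_n}A_n+\frac{\lambda^4}{\Gamma_n^3}B_n\Big)$ with $A_n=\rho\tilde A_n$, $B_n=\frac{\rho^3}{\rho-1}\tilde B_n$. (iii) (Gaussian deviations) Suppose $v>0$. If $a_n>0$ and $a_n/\sqrt{\Gamma_n}\to0$, then for $\rho_n-1=\frac12\frac{\tilde B_n^{1/2}a_n}{\tilde A_n^{3/2}\sqrt{\Gamma_n}}$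 one has $P_{\min}(a_n,\Gamma_n,\rho_n)\sim-\frac{a_n^2}{2v}$. Moreover, for every sequence $\varepsilon_n\to0$ there are sequences $c_n',C_n'$ with the same properties as $c_n,C_n$ such that $\mathbb P[|\sqrt{\Gamma_n}\nu_n(\mathcal A\varphi)|\ge a]\le2C_n'\exp\big(-c_n'\frac{a^2}{2v}\big)$ for all $n\ge1$ and $a>0$ with $a/\sqrt{\Gamma_n}\le\varepsilon_n$. (iv) (Super-Gaussian deviations) Suppose $\|\sigma\|_\infty\|\nabla\vartheta\|_\infty>0$. If $a_n>0$ and $a_n/\sqrt{\Gamma_n}\to\infty$, then for $\rho_n-1=\frac12$ one has $P_{\min}(a_n,\Gamma_n,\rho_n)\sim-\frac{a_n^{4/3}\Gamma_n^{1/3}}{2\|\sigma\|_\infty^{2/3}\|\nabla\vartheta\|_\infty^{2/3}}$. Moreover, for every sequence $R_n\to\infty$ there are sequences $c_n',C_n'$ with the same properties as $c_n,C_n$ such that $\mathbb P[|\sqrt{\Gamma_n}\nu_n(\mathcal A\varphi)|\ge a]\le2C_n'\exp\Big(-c_n'\frac{a^{4/3}\Gamma_n^{1/3}}{2\|\sigma\|_\infty^{2/3}\|\nabla\vartheta\|_\infty^{2/3}}\Big)$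 for all $n\ge1$ and $a>0$ with $a/\sqrt{\Gamma_n}\ge R_n$. -/

import Mathlib

open MeasureTheory ProbabilityTheory Filter Topology Set
open scoped NNReal Gradient InnerProductSpace

noncomputable section

/-! ### Coefficients, generator, function classes -/

/-- `ℝ^m` with its Euclidean norm. -/
abbrev Vec (m : ℕ) : Type := EuclideanSpace ℝ (Fin m)

/-- A `d × r` matrix is viewed as the linear map `ℝ^r → ℝ^d` it represents, so that its transpose
is the adjoint. The square of its Frobenius norm, `Tr(A A*)`, is the sum of the squared norms of
its columns. -/
def frobSq {d r : ℕ} (A : Vec r →L[ℝ] Vec d) : ℝ :=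
  ∑ j : Fin r, ‖A (EuclideanSpace.single j 1)‖ ^ 2

/-- `‖σ‖_∞ = sup_x Tr(σ σ*(x))^{1/2}`. -/
def supFrob {d r : ℕ} (σ : Vec d → Vec r →L[ℝ] Vec d) : ℝ :=
  ⨆ x, √(frobSq (σ x))

/-- `‖∇f‖_∞ = sup_x |∇f(x)|`. -/
def supGrad {d : ℕ} (f : Vec d → ℝ) : ℝ := ⨆ x, ‖∇ f x‖

/-- The generator `𝒜f = b · ∇f + ½ Tr(σσ* D²f)`; the trace is written as the sum over the columns
`σ_j` of `σ` of `D²f(σ_j, σ_j)`. -/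
def gen {d r : ℕ} (b : Vec d → Vec d) (σ : Vec d → Vec r →L[ℝ] Vec d) (f : Vec d → ℝ)
    (x : Vec d) : ℝ :=
  ⟪b x, ∇ f x⟫_ℝ + 1 / 2 * ∑ j : Fin r, iteratedFDeriv ℝ 2 f x
    ![σ x (EuclideanSpace.single j 1), σ x (EuclideanSpace.single j 1)]

/-- The carré du champ `|σ* ∇f|²`. -/
def carre {d r : ℕ} (σ : Vec d → Vec r →L[ℝ] Vec d) (f : Vec d → ℝ) (x : Vec d) : ℝ :=
  ‖ContinuousLinearMap.adjoint (σ x) (∇ f x)‖ ^ 2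

/-- The class `C^{k,β}(ℝ^d, ℝ)`: `k` times continuously differentiable, the derivatives of order
`1, …, k` bounded (`f` itself need not be), the `k`-th derivative `β`-Hölder. -/
structure HolderClass {d : ℕ} (k : ℕ) (β : ℝ) (f : Vec d → ℝ) : Prop where
  contDiff : ContDiff ℝ k f
  bounded : ∀ i ∈ Finset.Icc 1 k, ∃ K : ℝ, ∀ x, ‖iteratedFDeriv ℝ i f x‖ ≤ K
  holder : ∃ K : ℝ, ∀ x y,
    ‖iteratedFDeriv ℝ k f x - iteratedFDeriv ℝ k f y‖ ≤ K * ‖x - y‖ ^ β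

/-! ### The diffusion and its invariant measures -/

/-- `Y` has continuous paths and solves the martingale problem for `𝒜`, that is, `Y` is a weak
solution of `dY_t = b(Y_t) dt + σ(Y_t) dW_t`. -/
structure SolvesMartingaleProblem {d r : ℕ} (b : Vec d → Vec d) (σ : Vec d → Vec r →L[ℝ] Vec d)
    {Ω : Type*} [MeasurableSpace Ω] (P : Measure Ω) (Y : ℝ≥0 → Ω → Vec d) : Prop where
  meas : ∀ t, StronglyMeasurable (Y t)
  cont : ∀ ω, Continuous fun t => Y t ω
  mart : ∀ f : Vec d → ℝ, ContDiff ℝ (⊤ : ℕ∞) f → HasCompactSupport f →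
    Martingale (fun (t : ℝ≥0) ω => f (Y t ω) - f (Y 0 ω)
      - ∫ s in (0 : ℝ)..t, gen b σ f (Y s.toNNReal ω)) (Filtration.natural Y meas) P

/-- `ν` is an invariant probability measure: the diffusion, started from `ν`, has law `ν` at every
time. (For Lipschitz coefficients the law of the solution is determined by the initial law.) -/
def IsInvariantMeasure {d r : ℕ} (b : Vec d → Vec d) (σ : Vec d → Vec r →L[ℝ] Vec d)
    (ν : Measure (Vec d)) : Prop :=
  IsProbabilityMeasure ν ∧
    ∃ (Ω : Type) (_ : MeasurableSpace Ω) (P : Measure Ω) (Y : ℝ≥0 → Ω → Vec d),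
      IsProbabilityMeasure P ∧ SolvesMartingaleProblem b σ P Y ∧ ∀ t, P.map (Y t) = ν

/-! ### The scheme and its empirical measure

Sequences `(γ_k)_{k ≥ 1}`, `(U_k)_{k ≥ 1}` are functions on `ℕ` whose value at `0` is not used. -/

/-- The Euler scheme `X_{n+1} = X_n + γ_{n+1} b(X_n) + √γ_{n+1} σ(X_n) U_{n+1}`. -/
def scheme {d r : ℕ} (b : Vec d → Vec d) (σ : Vec d → Vec r →L[ℝ] Vec d) (γ : ℕ → ℝ)
    {Ω : Type*} (X₀ : Ω → Vec d) (U : ℕ → Ω → Vec r) : ℕ → Ω → Vec d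
  | 0, ω => X₀ ω
  | n + 1, ω => scheme b σ γ X₀ U n ω + γ (n + 1) • b (scheme b σ γ X₀ U n ω)
      + √(γ (n + 1)) • σ (scheme b σ γ X₀ U n ω) (U (n + 1) ω)

/-- `Γ_n = γ_1 + ⋯ + γ_n`. -/
def Gam (γ : ℕ → ℝ) (n : ℕ) : ℝ := ∑ k ∈ Finset.Icc 1 n, γ k

/-- `ν_n(f) = Γ_n⁻¹ ∑_{k=1}^n γ_k f(X_{k-1})`. -/
def empirical {d : ℕ} (γ : ℕ → ℝ) {Ω : Type*} (X : ℕ → Ω → Vec d) (n : ℕ) (f : Vec d → ℝ)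
    (ω : Ω) : ℝ :=
  (∑ k ∈ Finset.Icc 1 n, γ k * f (X (k - 1) ω)) / Gam γ n

/-! ### Assumptions -/

/-- The initial condition is sub-Gaussian. -/
def SubGaussianStart {d : ℕ} {Ω : Type*} [MeasurableSpace Ω] (P : Measure Ω)
    (X₀ : Ω → Vec d) : Prop :=
  ∃ l₀ > 0, ∀ l < l₀, Integrable (fun ω => Real.exp (l * ‖X₀ ω‖ ^ 2)) P

/-- The innovations `(U_k)_{k ≥ 1}` are i.i.d., independent of `X₀`, have the Gaussian moments up
to order three, and satisfy the Gaussian concentration property. -/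
structure GaussianConcentration {d r : ℕ} {Ω : Type*} [MeasurableSpace Ω] (P : Measure Ω)
    (X₀ : Ω → Vec d) (U : ℕ → Ω → Vec r) : Prop where
  meas : ∀ k, Measurable (U (k + 1))
  indep : iIndepFun (fun k => U (k + 1)) P
  ident : ∀ k, IdentDistrib (U (k + 1)) (U 1) P P
  indep_start : IndepFun X₀ (fun ω k => U (k + 1) ω) P
  moment_one : ∀ i, ∫ ω, U 1 ω i ∂P = 0
  moment_two : ∀ i j, ∫ ω, U 1 ω i * U 1 ω j ∂P = if i = j then 1 else 0
  moment_three : ∀ i j k, ∫ ω, U 1 ω i * U 1 ω j * U 1 ω k ∂P = 0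
  concentration : ∀ g : Vec r → ℝ, LipschitzWith 1 g → ∀ l > 0,
    Integrable (fun ω => Real.exp (l * g (U 1 ω))) P ∧
      ∫ ω, Real.exp (l * g (U 1 ω)) ∂P ≤ Real.exp (l * ∫ ω, g (U 1 ω) ∂P + l ^ 2 / 2)

/-- `V` is a Lyapunov function with constants `C_V`, `α_V`, `β_V`. -/
structure IsLyapunov {d r : ℕ} (b : Vec d → Vec d) (σ : Vec d → Vec r →L[ℝ] Vec d)
    (V : Vec d → ℝ) (CV αV βV : ℝ) : Prop where
  lower : ∃ v > 0, ∀ x, v ≤ V x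
  contDiff : ContDiff ℝ 2 V
  hess : ∃ K : ℝ, ∀ x, ‖iteratedFDeriv ℝ 2 V x‖ ≤ K
  coercive : Tendsto V (cocompact (Vec d)) atTop
  CV_pos : 0 < CV
  growth : ∀ x, ‖∇ V x‖ ^ 2 + ‖b x‖ ^ 2 ≤ CV * V x
  αV_pos : 0 < αV
  βV_nonneg : 0 ≤ βV
  drift : ∀ x, gen b σ V x ≤ -αV * V x + βV

/-- The regularity asked of the test function and of the solution of the Poisson equation. -/
structure TestRegularity {d : ℕ} (b : Vec d → Vec d) (V : Vec d → ℝ) (β : ℝ)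
    (f : Vec d → ℝ) : Prop where
  smooth : HolderClass 3 β f
  lip : ∃ K : ℝ≥0, LipschitzWith K fun x => ⟪b x, ∇ f x⟫_ℝ
  growth : ∃ C > 0, ∀ x, |f x| ≤ C * (1 + √(V x))

/-- `(γ_k)_{k ≥ 1}` is positive, non-increasing, and `γ_k ≍ k^{-θ}`. -/
structure StepSequence (γ : ℕ → ℝ) (θ : ℝ) : Prop where
  pos : ∀ k ≥ 1, 0 < γ k
  anti : ∀ k l, 1 ≤ k → k ≤ l → γ l ≤ γ k
  order : ∃ n₀ : ℕ, ∃ C ≥ (1 : ℝ), ∀ n : ℕ, n₀ ≤ n →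
    C⁻¹ * (n : ℝ) ^ (-θ) ≤ γ n ∧ γ n ≤ C * (n : ℝ) ^ (-θ)

/-- The steps are small: `γ_k ≤ min (1 / (2√(C_V c̄)), α_V / (2 C_V ‖D²V‖_∞))`, where `c̄` is a
constant with `V(x) ≤ c̄ |x|²` outside a ball. -/
def SmallSteps {d : ℕ} (γ : ℕ → ℝ) (V : Vec d → ℝ) (CV αV : ℝ) : Prop :=
  ∃ c > 0, (∃ K > 0, ∀ x, K ≤ ‖x‖ → V x ≤ c * ‖x‖ ^ 2) ∧
    ∀ k ≥ 1, γ k * (2 * √(CV * c)) ≤ 1 ∧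
      γ k * (2 * CV * ⨆ x, ‖iteratedFDeriv ℝ 2 V x‖) ≤ αV

/-! ### The bound -/

/-- The real cube root (odd on `ℝ`). -/
def cbrt (x : ℝ) : ℝ := if 0 ≤ x then x ^ (1 / 3 : ℝ) else -(-x) ^ (1 / 3 : ℝ)

/-- `Ã = q v / 2 + e`, to be used with `v = ν(|σ*∇φ|²)`. -/
def ATilde (v q e : ℝ) : ℝ := q * v / 2 + e

/-- `B̃ = (q³ q̂ / 4) (q̄ s / 2 + e)`, to be used with `s = ‖σ‖_∞² ‖∇ϑ‖_∞²`. -/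
def BTilde (s q qhat qbar e : ℝ) : ℝ := q ^ 3 * qhat / 4 * (qbar * s / 2 + e)

/-- `Φ(a, ρ)` of the Cardano formula, for `Γ_n = G`, `Ã_n = A`, `B̃_n = B`. -/
def cardanoPhi (a G A B ρ : ℝ) : ℝ :=
  cbrt (a / (√G * B) + √(a ^ 2 / (B ^ 2 * G) + (ρ - 1) * (2 * A / (3 * B)) ^ 3)) +
    cbrt (a / (√G * B) - √(a ^ 2 / (B ^ 2 * G) + (ρ - 1) * (2 * A / (3 * B)) ^ 3))

/-- `P_min(a, Γ_n, ρ)`, for `Γ_n = G`, `Ã_n = A`, `B̃_n = B`. -/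
def Pmin (a G A B ρ : ℝ) : ℝ :=
  -(cbrt (ρ - 1) / ρ * (√G * cardanoPhi a G A B ρ / 8)
    * (3 * a - √G * cbrt (ρ - 1) * A * cardanoPhi a G A B ρ))

/-- The quartic `-a l / √Γ_n + l² A_n / Γ_n + l⁴ B_n / Γ_n³` with `A_n = ρ Ã_n` and
`B_n = ρ³ / (ρ - 1) B̃_n`. -/
def quartic (a G A B ρ l : ℝ) : ℝ :=
  -(a * l / √G) + l ^ 2 / G * (ρ * A) + l ^ 4 / G ^ 3 * (ρ ^ 3 / (ρ - 1) * B)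

/-- `c` and `C` are non-negative, tend to `1`, and are respectively non-decreasing and
non-increasing from some rank on. -/
structure DeviationConstants (c C : ℕ → ℝ) : Prop where
  c_nonneg : ∀ n, 0 ≤ c n
  C_nonneg : ∀ n, 0 ≤ C n
  eventually_mono : ∃ N, MonotoneOn c (Ici N) ∧ AntitoneOn C (Ici N)
  c_lim : Tendsto c atTop (𝓝 1)
  C_lim : Tendsto C atTop (𝓝 1)

end

/-!
The proof bounds the Laplace transform of `D_n(f) = ∑_{k<n} γ_{k+1} 𝒜f(X_k)` for `f = φ` and
concludes by the exponential Chebyshev inequality, as `√Γ_n ν_n(𝒜φ) = D_n(φ) / √Γ_n`.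

*Decomposition.* A Taylor expansion of one step gives
`D_n(f) = -M_n(f) + f(X_n) - f(X_0) - R_n(f)`, where `M_n(f)` is the martingale of the increments
`f(X_{k+1}) - E[f(X_{k+1}) | X_k]`. Since the innovations have vanishing odd moments up to order
three, the bias of one step is at most `C γ^{(3+β)/2} √V` (`StepBounds.exists_abs_bias_le`). The
Lyapunov condition makes some exponential moment of `V(X_n)` bounded in `n`
(`exists_expInt_lyapunov_le`), so that a weighted sum of the `√V(X_k)` of total weight `o(√Γ_n)`
costs only a factor `exp(δ + δ l² Γ_n)`. The condition `θ > 1 / (2 + β)` ensures that the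
weights `γ_k^{(3+β)/2}` have such a total (`StepSequence.sum_rpow_isLittleO`). All products are
split by Hölder's inequality with an exponent close to one on the main term.

*Two bounds for the martingale.* Given the past, `f(X_{k+1})` is a Lipschitz function of `U_{k+1}`
with constant `√γ_{k+1} ‖σ‖_∞ ‖∇f‖_∞`, so concentration yields
`E exp(l M_n(f)) ≤ exp(l² Γ_n s / 2)` with `s = ‖σ‖_∞² ‖∇f‖_∞²`. Splitting the increment into its
linear part `√γ ⟨σ*∇f(X_k), U⟩` and a smaller remainder gives the sharper bound `1` for the
exponential moment of `l M_n(φ)` compensated by `(p l² / 2) ∑ γ_{k+1} |σ*∇φ|²(X_k)`, up to negligible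
terms (`ControlledScheme.exists_expInt_compensated_le_one`).

*The Poisson equation.* The compensator equals `(p l² / 2) (Γ_n v + D_n(ϑ))`. Separating it from
the martingale by Hölder's inequality with exponent `ρ` turns the first summand into the quadratic
term with coefficient `ρ v / 2`, and the first bound applied to `D_n(ϑ)`, with parameter of order
`ρ² l² / (2 (ρ - 1))`, gives the quartic term with coefficient `ρ³ / (ρ - 1) · s / 8`
(`ControlledScheme.eventually_expInt_genSum_sharp_le`). The losses are an arbitrary `η > 0`, for `n`
beyond a rank depending on `η`; a diagonal extraction makes `η = η_n` tend to zero, and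
`q_n, q̂_n, q̄_n, e_n` are read off from `η_n`.

*Optimization.* The derivative of the quartic is a cubic without square term, whose root is given
by Cardano's formula; this identifies `P_min` (`isLeast_quartic`). Both regimes follow by comparing
the quartic with its quadratic part, respectively with its terms of order one and four, and by
evaluating it at the minimizer of that part.
-/

/-! ### Exponential integrals -/

/-- The exponential integral `∫ e^f dμ`, with values in `[0, ∞]`. -/
noncomputable def expInt {α : Type*} [MeasurableSpace α] (μ : Measure α) (f : α → ℝ) : ENNReal :=
  ∫⁻ x, ENNReal.ofReal (Real.exp (f x)) ∂μ

section ExpInt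

variable {α : Type*} [MeasurableSpace α] {μ : Measure α}

lemma expInt_mono {f g : α → ℝ} (h : ∀ x, f x ≤ g x) : expInt μ f ≤ expInt μ g :=
  lintegral_mono fun x => ENNReal.ofReal_le_ofReal (Real.exp_le_exp.2 (h x))

lemma expInt_const [IsProbabilityMeasure μ] (c : ℝ) :
    expInt μ (fun _ => c) = ENNReal.ofReal (Real.exp c) := by
  simp [expInt]

lemma expInt_add_const (f : α → ℝ) (c : ℝ) :
    expInt μ (fun x => f x + c) = expInt μ f * ENNReal.ofReal (Real.exp c) := by
  simp only [expInt, Real.exp_add]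
  simp_rw [ENNReal.ofReal_mul (Real.exp_pos _).le]
  exact lintegral_mul_const' _ _ ENNReal.ofReal_ne_top

lemma expInt_add_const_le {f : α → ℝ} {a : ℝ} (c : ℝ)
    (h : expInt μ f ≤ ENNReal.ofReal (Real.exp a)) :
    expInt μ (fun x => f x + c) ≤ ENNReal.ofReal (Real.exp (a + c)) := by
  rw [expInt_add_const, Real.exp_add, ENNReal.ofReal_mul (Real.exp_pos _).le]
  gcongr

lemma ofReal_exp_rpow (a w : ℝ) :
    ENNReal.ofReal (Real.exp a) ^ w = ENNReal.ofReal (Real.exp (w * a)) := by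
  rw [ENNReal.ofReal_rpow_of_pos (Real.exp_pos _), ← Real.exp_mul, mul_comm]

/-- Hölder's inequality for exponential integrals. -/
lemma expInt_holder {f g : α → ℝ} (hf : AEMeasurable f μ) (hg : AEMeasurable g μ) {w a b : ℝ}
    (hw0 : 0 ≤ w) (hw1 : w ≤ 1) (ha : expInt μ f ≤ ENNReal.ofReal (Real.exp a))
    (hb : expInt μ g ≤ ENNReal.ofReal (Real.exp b)) :
    expInt μ (fun x => w * f x + (1 - w) * g x) ≤
      ENNReal.ofReal (Real.exp (w * a + (1 - w) * b)) := by
  have key := ENNReal.lintegral_mul_norm_pow_le (μ := μ) (p := w) (q := 1 - w)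
    (f := fun x => ENNReal.ofReal (Real.exp (f x))) (g := fun x => ENNReal.ofReal (Real.exp (g x)))
    (by fun_prop) (by fun_prop) hw0 (by linarith) (by ring)
  calc expInt μ (fun x => w * f x + (1 - w) * g x)
      = ∫⁻ x, ENNReal.ofReal (Real.exp (f x)) ^ w *
          ENNReal.ofReal (Real.exp (g x)) ^ (1 - w) ∂μ := by
        refine lintegral_congr fun x => ?_
        rw [ofReal_exp_rpow, ofReal_exp_rpow, ← ENNReal.ofReal_mul (Real.exp_pos _).le,
          ← Real.exp_add]
    _ ≤ _ := key
    _ ≤ ENNReal.ofReal (Real.exp a) ^ w * ENNReal.ofReal (Real.exp b) ^ (1 - w) := by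
        have h1 : 0 ≤ 1 - w := by linarith
        gcongr <;> assumption
    _ = _ := by
        rw [ofReal_exp_rpow, ofReal_exp_rpow, ← ENNReal.ofReal_mul (Real.exp_pos _).le,
          ← Real.exp_add]

/-- Hölder's inequality in the form of a bound for the exponential integral of a sum, with
conjugate exponents `p` and `p / (p - 1)`. -/
lemma expInt_add_le {f g : α → ℝ} (hf : AEMeasurable f μ) (hg : AEMeasurable g μ) {p a b : ℝ}
    (hp : 1 < p) (ha : expInt μ (fun x => p * f x) ≤ ENNReal.ofReal (Real.exp a))
    (hb : expInt μ (fun x => p / (p - 1) * g x) ≤ ENNReal.ofReal (Real.exp b)) :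
    expInt μ (fun x => f x + g x) ≤
      ENNReal.ofReal (Real.exp (a / p + b * ((p - 1) / p))) := by
  have hp0 : 0 < p := by linarith
  have hp1 : p - 1 ≠ 0 := by linarith
  have h := expInt_holder (μ := μ) (hf.const_mul p) (hg.const_mul (p / (p - 1))) (w := p⁻¹)
    (by positivity) (inv_le_one_of_one_le₀ hp.le) ha hb
  have e1 : (fun x => p⁻¹ * (p * f x) + (1 - p⁻¹) * (p / (p - 1) * g x)) =
      fun x => f x + g x := by
    funext x; field_simp
  rw [e1] at h
  refine h.trans_eq ?_
  congr 2
  field_simp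

/-- Jensen's inequality for the exponential integral of a multiple. -/
lemma expInt_mul_le [IsProbabilityMeasure μ] {f : α → ℝ} (hf : AEMeasurable f μ) {w a : ℝ}
    (hw0 : 0 ≤ w) (hw1 : w ≤ 1) (ha : expInt μ f ≤ ENNReal.ofReal (Real.exp a)) :
    expInt μ (fun x => w * f x) ≤ ENNReal.ofReal (Real.exp (w * a)) := by
  have h := expInt_holder (μ := μ) (g := fun _ => 0) (b := 0) hf aemeasurable_const hw0 hw1 ha
    (by rw [expInt_const])
  simpa using h

/-- The exponential integral of a convex combination is bounded by a common bound for the terms;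
weights of total mass less than one are completed by a constant term. -/
lemma expInt_sum_le {ι : Type*} (s : Finset ι) (w : ι → ℝ) (hw : ∀ i ∈ s, 0 ≤ w i)
    (W : ℝ) (hW : ∑ i ∈ s, w i = W) (hWpos : 0 < W) {f : ι → α → ℝ} {a : ℝ}
    (hf : ∀ i ∈ s, AEMeasurable (f i) μ)
    (ha : ∀ i ∈ s, expInt μ (fun x => W * f i x) ≤ ENNReal.ofReal (Real.exp a)) :
    expInt μ (fun x => ∑ i ∈ s, w i * f i x) ≤ ENNReal.ofReal (Real.exp a) := by
  have hsum : ∑ i ∈ s, w i / W = 1 := by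
    rw [← Finset.sum_div, hW, div_self hWpos.ne']
  have hpt : ∀ x, Real.exp (∑ i ∈ s, w i * f i x) ≤
      ∑ i ∈ s, w i / W * Real.exp (W * f i x) := by
    intro x
    have := convexOn_exp.map_sum_le (t := s) (w := fun i => w i / W) (p := fun i => W * f i x)
      (fun i hi => div_nonneg (hw i hi) hWpos.le) hsum (fun i _ => mem_univ _)
    simp only [smul_eq_mul] at this
    refine le_trans (le_of_eq ?_) this
    congr 1
    refine Finset.sum_congr rfl fun i _ => ?_
    field_simp
  calc expInt μ (fun x => ∑ i ∈ s, w i * f i x)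
      ≤ ∫⁻ x, ∑ i ∈ s, ENNReal.ofReal (w i / W) * ENNReal.ofReal (Real.exp (W * f i x)) ∂μ := by
        refine lintegral_mono fun x => ?_
        refine (ENNReal.ofReal_le_ofReal (hpt x)).trans_eq ?_
        rw [ENNReal.ofReal_sum_of_nonneg]
        · refine Finset.sum_congr rfl fun i hi => ?_
          rw [ENNReal.ofReal_mul (div_nonneg (hw i hi) hWpos.le)]
        · intro i hi
          have := div_nonneg (hw i hi) hWpos.le
          positivity
    _ = ∑ i ∈ s, ENNReal.ofReal (w i / W) * expInt μ (fun x => W * f i x) := by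
        rw [lintegral_finsetSum' s]
        · refine Finset.sum_congr rfl fun i hi => ?_
          rw [lintegral_const_mul' _ _ ENNReal.ofReal_ne_top]; rfl
        · intro i hi
          have := hf i hi
          fun_prop
    _ ≤ ∑ i ∈ s, ENNReal.ofReal (w i / W) * ENNReal.ofReal (Real.exp a) := by
        gcongr with i hi
        exact ha i hi
    _ = ENNReal.ofReal (Real.exp a) := by
        rw [← Finset.sum_mul, ← ENNReal.ofReal_sum_of_nonneg
          (fun i hi => div_nonneg (hw i hi) hWpos.le), hsum]
        simp

lemma integrable_exp_of_expInt_lt_top {f : α → ℝ} (hf : AEMeasurable f μ)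
    (h : expInt μ f < ⊤) : Integrable (fun x => Real.exp (f x)) μ := by
  refine ⟨by fun_prop, ?_⟩
  rw [hasFiniteIntegral_iff_ofReal (.of_forall fun x => (Real.exp_pos _).le)]
  exact h

lemma expInt_eq_ofReal_integral {f : α → ℝ} (h : Integrable (fun x => Real.exp (f x)) μ) :
    expInt μ f = ENNReal.ofReal (∫ x, Real.exp (f x) ∂μ) := by
  rw [ofReal_integral_eq_lintegral_ofReal h (.of_forall fun x => (Real.exp_pos _).le)]
  rfl

end ExpInt

/-! ### The law of the innovations -/

/-- The properties of the common law of the innovations that the argument uses: the moments up to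
order three are Gaussian, and Lipschitz functions concentrate as under the Gaussian law. -/
structure GaussianLike {r : ℕ} (μ : Measure (Vec r)) : Prop where
  prob : IsProbabilityMeasure μ
  moment_one : ∀ i, ∫ u, u i ∂μ = 0
  moment_two : ∀ i j, ∫ u, u i * u j ∂μ = if i = j then 1 else 0
  moment_three : ∀ i j k, ∫ u, u i * u j * u k ∂μ = 0
  concentration : ∀ g : Vec r → ℝ, LipschitzWith 1 g → ∀ l > 0,
    Integrable (fun u => Real.exp (l * g u)) μ ∧
      ∫ u, Real.exp (l * g u) ∂μ ≤ Real.exp (l * ∫ u, g u ∂μ + l ^ 2 / 2)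

namespace GaussianLike

variable {r : ℕ} {μ : Measure (Vec r)} (hμ : GaussianLike μ)

include hμ

/-- The law of the innovations has a Gaussian tail. With `k = ⌊x⌋` one has
`x² / 8 ≤ 1 / 4 + k x - 3 k² / 4`, which reduces the claim to the concentration of the norm. -/
lemma expInt_sq_lt_top : expInt μ (fun u => ‖u‖ ^ 2 / 8) < ⊤ := by
  set m := ∫ u, ‖u‖ ∂μ
  have hpt : ∀ u : Vec r, ENNReal.ofReal (Real.exp (‖u‖ ^ 2 / 8)) ≤
      ∑' k : ℕ, ENNReal.ofReal (Real.exp ((k : ℝ) * ‖u‖ + (1 / 4 - 3 / 4 * (k : ℝ) ^ 2))) := by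
    intro u
    refine le_trans ?_ (ENNReal.le_tsum ⌊‖u‖⌋₊)
    refine ENNReal.ofReal_le_ofReal (Real.exp_le_exp.2 ?_)
    have h1 := Nat.floor_le (norm_nonneg u)
    have h2 := Nat.lt_floor_add_one ‖u‖
    have h3 : (0 : ℝ) ≤ (⌊‖u‖⌋₊ : ℝ) := by positivity
    set k : ℝ := (⌊‖u‖⌋₊ : ℝ)
    nlinarith [sq_nonneg (k - 1), norm_nonneg u]
  have hbound : ∀ k : ℕ, ∫⁻ u, ENNReal.ofReal
      (Real.exp ((k : ℝ) * ‖u‖ + (1 / 4 - 3 / 4 * (k : ℝ) ^ 2))) ∂μ ≤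
      ENNReal.ofReal (Real.exp (k * m + 1 / 4 - (k : ℝ) ^ 2 / 4)) := by
    intro k
    have h0 : expInt μ (fun u => (k : ℝ) * ‖u‖) ≤
        ENNReal.ofReal (Real.exp (k * m + (k : ℝ) ^ 2 / 2)) := by
      rcases Nat.eq_zero_or_pos k with rfl | hk
      · have := hμ.prob
        simp [expInt]
      · have hk' : (0 : ℝ) < k := by exact_mod_cast hk
        obtain ⟨hi, hle⟩ := hμ.concentration (fun u => ‖u‖) lipschitzWith_one_norm k hk'
        rw [expInt_eq_ofReal_integral hi]
        exact ENNReal.ofReal_le_ofReal hle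
    refine (expInt_add_const_le (1 / 4 - 3 / 4 * (k : ℝ) ^ 2) h0).trans_eq ?_
    congr 2; ring
  have hsummable : Summable fun k : ℕ => Real.exp (k * m + 1 / 4 - (k : ℝ) ^ 2 / 4) := by
    have hs : Summable fun k : ℕ => Real.exp (1 / 4 + (m + 1) ^ 2) * Real.exp (-(k : ℝ)) := by
      refine Summable.mul_left _ ?_
      simpa [Real.exp_neg, ← inv_pow, ← Real.exp_nat_mul, mul_comm] using
        Real.summable_exp_neg_nat
    refine hs.of_nonneg_of_le (fun _ => (Real.exp_pos _).le) fun k => ?_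
    rw [← Real.exp_add]
    refine Real.exp_le_exp.2 ?_
    nlinarith [sq_nonneg ((k : ℝ) / 2 - (m + 1))]
  calc expInt μ (fun u => ‖u‖ ^ 2 / 8)
      ≤ ∫⁻ u, ∑' k : ℕ, ENNReal.ofReal
          (Real.exp ((k : ℝ) * ‖u‖ + (1 / 4 - 3 / 4 * (k : ℝ) ^ 2))) ∂μ := lintegral_mono hpt
    _ = ∑' k : ℕ, ∫⁻ u, ENNReal.ofReal
          (Real.exp ((k : ℝ) * ‖u‖ + (1 / 4 - 3 / 4 * (k : ℝ) ^ 2))) ∂μ :=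
        lintegral_tsum fun k => by fun_prop
    _ ≤ ∑' k : ℕ, ENNReal.ofReal (Real.exp (k * m + 1 / 4 - (k : ℝ) ^ 2 / 4)) :=
        ENNReal.tsum_le_tsum hbound
    _ < ⊤ := by
        rw [← ENNReal.ofReal_tsum_of_nonneg (fun _ => (Real.exp_pos _).le) hsummable]
        exact ENNReal.ofReal_lt_top

lemma integrable_exp_sq : Integrable (fun u : Vec r => Real.exp (‖u‖ ^ 2 / 8)) μ :=
  integrable_exp_of_expInt_lt_top (by fun_prop) hμ.expInt_sq_lt_top

lemma integrable_of_growth {f : Vec r → ℝ} (hf : Continuous f) (C : ℝ)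
    (h : ∀ u, |f u| ≤ C * Real.exp (‖u‖ ^ 2 / 8)) : Integrable f μ :=
  (hμ.integrable_exp_sq.const_mul C).mono' hf.aestronglyMeasurable
    (.of_forall fun u => by simpa using h u)

end GaussianLike

/-- Polynomial and exponential growth are dominated by a Gaussian. -/
lemma sq_mul_exp_le (C t : ℝ) :
    (t ^ 2 + 1) ^ 2 * Real.exp (C * (t + 1)) ≤
      (1024 * Real.exp (4 * C ^ 2 + C)) * Real.exp (t ^ 2 / 8) := by
  have h1 : t ^ 2 + 1 ≤ 32 * Real.exp (t ^ 2 / 32) := by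
    have := Real.add_one_le_exp (t ^ 2 / 32)
    nlinarith [sq_nonneg t]
  have h2 : (t ^ 2 + 1) ^ 2 ≤ 1024 * Real.exp (t ^ 2 / 16) := by
    calc (t ^ 2 + 1) ^ 2 ≤ (32 * Real.exp (t ^ 2 / 32)) ^ 2 := by gcongr
      _ = 1024 * Real.exp (t ^ 2 / 16) := by
        rw [mul_pow, ← Real.exp_nat_mul]
        norm_num
        ring
  have h3 : Real.exp (C * (t + 1)) ≤ Real.exp (4 * C ^ 2 + C) * Real.exp (t ^ 2 / 16) := by
    rw [← Real.exp_add]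
    refine Real.exp_le_exp.2 ?_
    nlinarith [sq_nonneg (t / 4 - 2 * C)]
  calc _ ≤ (1024 * Real.exp (t ^ 2 / 16)) *
        (Real.exp (4 * C ^ 2 + C) * Real.exp (t ^ 2 / 16)) := by gcongr
    _ = (1024 * Real.exp (4 * C ^ 2 + C)) * (Real.exp (t ^ 2 / 16) * Real.exp (t ^ 2 / 16)) := by
        ring
    _ = _ := by rw [← Real.exp_add]; congr 2; ring

namespace GaussianLike

variable {r : ℕ} {μ : Measure (Vec r)} (hμ : GaussianLike μ)

include hμ

lemma integrable_of_sq_growth {f : Vec r → ℝ} (hf : Continuous f) (K C : ℝ)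
    (h : ∀ u, |f u| ≤ K * ((‖u‖ ^ 2 + 1) ^ 2 * Real.exp (C * (‖u‖ + 1)))) : Integrable f μ := by
  refine hμ.integrable_of_growth hf (|K| * (1024 * Real.exp (4 * C ^ 2 + C))) fun u => ?_
  calc |f u| ≤ K * ((‖u‖ ^ 2 + 1) ^ 2 * Real.exp (C * (‖u‖ + 1))) := h u
    _ ≤ |K| * ((‖u‖ ^ 2 + 1) ^ 2 * Real.exp (C * (‖u‖ + 1))) := by
        gcongr; exact le_abs_self K
    _ ≤ |K| * ((1024 * Real.exp (4 * C ^ 2 + C)) * Real.exp (‖u‖ ^ 2 / 8)) :=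
        mul_le_mul_of_nonneg_left (sq_mul_exp_le C ‖u‖) (abs_nonneg K)
    _ = _ := by ring

lemma integrable_of_poly_growth {f : Vec r → ℝ} (hf : Continuous f) (K : ℝ)
    (h : ∀ u, |f u| ≤ K * (‖u‖ ^ 2 + 1) ^ 2) : Integrable f μ :=
  hμ.integrable_of_sq_growth hf K 0 (by simpa using h)

lemma integrable_lipschitz {g : Vec r → ℝ} {L : ℝ≥0} (hg : LipschitzWith L g) :
    Integrable g μ := by
  refine hμ.integrable_of_poly_growth hg.continuous (|g 0| + L) fun u => ?_
  have h1 := hg.dist_le_mul u 0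
  rw [Real.dist_eq, dist_zero_right] at h1
  have h2 : |g u| ≤ |g 0| + L * ‖u‖ := by
    have := abs_sub_abs_le_abs_sub (g u) (g 0)
    linarith
  have h4 : ‖u‖ ≤ (‖u‖ ^ 2 + 1) ^ 2 := by
    nlinarith [sq_nonneg (‖u‖ - 1), sq_nonneg (‖u‖ ^ 2), sq_nonneg ‖u‖]
  have h5 : (1 : ℝ) ≤ (‖u‖ ^ 2 + 1) ^ 2 := by nlinarith [sq_nonneg ‖u‖]
  nlinarith [abs_nonneg (g 0), L.coe_nonneg]

/-- Gaussian concentration for functions with an arbitrary Lipschitz constant, and for exponents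
of both signs. -/
lemma expInt_lipschitz_le {g : Vec r → ℝ} {L : ℝ} (hL : 0 ≤ L)
    (hg : ∀ u w, |g u - g w| ≤ L * ‖u - w‖) (l : ℝ) :
    expInt μ (fun u => l * (g u - ∫ w, g w ∂μ)) ≤
      ENNReal.ofReal (Real.exp (l ^ 2 * L ^ 2 / 2)) := by
  have := hμ.prob
  have hpos : ∀ (f : Vec r → ℝ), (∀ u w, |f u - f w| ≤ L * ‖u - w‖) → ∀ t > 0,
      expInt μ (fun u => t * (f u - ∫ w, f w ∂μ)) ≤
        ENNReal.ofReal (Real.exp (t ^ 2 * L ^ 2 / 2)) := by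
    intro f hf t ht
    rcases hL.eq_or_lt with rfl | hL
    · have hc : ∀ u, f u = f 0 := fun u => by
        have := hf u 0
        simp only [zero_mul] at this
        exact sub_eq_zero.1 (abs_nonpos_iff.1 this)
      have : (fun u => t * (f u - ∫ w, f w ∂μ)) = fun _ => 0 := by
        funext u
        rw [integral_congr_ae (.of_forall hc)]
        simp [hc u]
      rw [this, expInt_const]
      simp
    · have h1 : LipschitzWith 1 (fun u => L⁻¹ * f u) := by
        refine LipschitzWith.of_dist_le_mul fun u w => ?_
        rw [Real.dist_eq, ← mul_sub, abs_mul, abs_of_pos (inv_pos.2 hL), dist_eq_norm]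
        have := hf u w
        rw [NNReal.coe_one, one_mul, inv_mul_le_iff₀ hL]
        exact this
      obtain ⟨hi, hle⟩ := hμ.concentration _ h1 (t * L) (mul_pos ht hL)
      have e1 : ∀ u, t * L * (L⁻¹ * f u) = t * f u := fun u => by field_simp
      simp_rw [e1] at hi hle
      rw [integral_const_mul] at hle
      have e2 : t * L * (L⁻¹ * ∫ u, f u ∂μ) = t * ∫ u, f u ∂μ := by field_simp
      rw [e2] at hle
      have h2 : expInt μ (fun u => t * f u) ≤
          ENNReal.ofReal (Real.exp (t * ∫ u, f u ∂μ + (t * L) ^ 2 / 2)) := by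
        rw [expInt_eq_ofReal_integral hi]
        exact ENNReal.ofReal_le_ofReal hle
      have h3 := expInt_add_const_le (-(t * ∫ u, f u ∂μ)) h2
      convert h3 using 2
      · funext u; ring
      · congr 1; ring
  rcases lt_trichotomy l 0 with hl | rfl | hl
  · have h := hpos (fun u => -g u) (fun u w => by
      rw [neg_sub_neg, abs_sub_comm]; exact hg u w) (-l) (by linarith)
    rw [integral_neg] at h
    convert h using 2
    · funext u; ring
    · congr 1; ring
  · simp [expInt]
  · exact hpos g hg l hl

end GaussianLike

/-! ### Taylor expansions -/

section Taylor

variable {d : ℕ} {f : Vec d → ℝ}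

/-- The `k`-th derivative of `f` at `x`, evaluated along the single direction `h`. -/
noncomputable def dirDeriv (f : Vec d → ℝ) (k : ℕ) (x h : Vec d) : ℝ :=
  iteratedFDeriv ℝ k f x (fun _ => h)

lemma dirDeriv_zero (x h : Vec d) : dirDeriv f 0 x h = f x := by simp [dirDeriv]

lemma dirDeriv_one (x h : Vec d) : dirDeriv f 1 x h = fderiv ℝ f x h := by
  simp [dirDeriv]

lemma abs_dirDeriv_le (k : ℕ) (x h : Vec d) :
    |dirDeriv f k x h| ≤ ‖iteratedFDeriv ℝ k f x‖ * ‖h‖ ^ k := by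
  simpa [dirDeriv] using (iteratedFDeriv ℝ k f x).le_opNorm (fun _ => h)

lemma abs_dirDeriv_sub_le (k : ℕ) (x y h : Vec d) :
    |dirDeriv f k x h - dirDeriv f k y h| ≤
      ‖iteratedFDeriv ℝ k f x - iteratedFDeriv ℝ k f y‖ * ‖h‖ ^ k := by
  simpa [dirDeriv] using
    (iteratedFDeriv ℝ k f x - iteratedFDeriv ℝ k f y).le_opNorm (fun _ => h)

lemma hasDerivAt_dirDeriv {n k : ℕ} (hf : ContDiff ℝ n f) (hk : k < n) (y h : Vec d) (s : ℝ) :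
    HasDerivAt (fun s : ℝ => dirDeriv f k (y + s • h) h) (dirDeriv f (k + 1) (y + s • h) h) s := by
  have h1 : HasFDerivAt (iteratedFDeriv ℝ k f)
      (fderiv ℝ (iteratedFDeriv ℝ k f) (y + s • h)) (y + s • h) :=
    (hf.differentiable_iteratedFDeriv (by exact_mod_cast hk) _).hasFDerivAt
  have h2 : HasDerivAt (fun s : ℝ => y + s • h) h s := by
    simpa using ((hasDerivAt_id s).smul_const h).const_add y
  have h3 := h1.comp_hasDerivAt s h2
  have h4 := ((ContinuousMultilinearMap.apply ℝ (fun _ : Fin k => Vec d) ℝ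
    (fun _ => h)).hasFDerivAt).comp_hasDerivAt s h3
  refine h4.congr_deriv ?_
  rw [dirDeriv, iteratedFDeriv_succ_apply_left]
  rfl

/-- A function on `[0, 1]` that vanishes at `0` is bounded by any bound for its derivative. -/
lemma abs_le_of_hasDerivAt {g g' : ℝ → ℝ} {C : ℝ} (hg : ∀ s, HasDerivAt g (g' s) s)
    (h0 : g 0 = 0) (hC : ∀ s ∈ Icc (0 : ℝ) 1, |g' s| ≤ C) : ∀ s ∈ Icc (0 : ℝ) 1, |g s| ≤ C := by
  intro s hs
  have h := (convex_Icc (0 : ℝ) 1).norm_image_sub_le_of_norm_hasDerivWithin_le (f := g) (f' := g')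
    (C := C) (fun x _ => (hg x).hasDerivWithinAt) hC (left_mem_Icc.2 zero_le_one) hs
  rw [h0, sub_zero, sub_zero, Real.norm_eq_abs, Real.norm_eq_abs, abs_of_nonneg hs.1] at h
  have hC0 : 0 ≤ C := (abs_nonneg _).trans (hC 0 (left_mem_Icc.2 zero_le_one))
  exact h.trans (mul_le_of_le_one_right hC0 hs.2)

lemma abs_sub_le_of_fderiv_bound (hf : ContDiff ℝ 1 f) {K : ℝ} (y h : Vec d)
    (hK : ∀ x, ‖iteratedFDeriv ℝ 1 f x‖ ≤ K) : |f (y + h) - f y| ≤ K * ‖h‖ := by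
  have h1 := abs_le_of_hasDerivAt (g := fun s : ℝ => dirDeriv f 0 (y + s • h) h - f y)
    (g' := fun s => dirDeriv f 1 (y + s • h) h) (C := K * ‖h‖)
    (fun s => ((hasDerivAt_dirDeriv hf (by norm_num) y h s)).sub_const _)
    (by simp [dirDeriv_zero])
    (fun s _ => by
      simpa using (abs_dirDeriv_le 1 (y + s • h) h).trans
        (mul_le_mul_of_nonneg_right (hK _) (by positivity)))
    1 (right_mem_Icc.2 zero_le_one)
  simpa [dirDeriv_zero] using h1

lemma abs_taylor_one_le (hf : ContDiff ℝ 2 f) {K : ℝ} (y h : Vec d)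
    (hK : ∀ x, ‖iteratedFDeriv ℝ 2 f x‖ ≤ K) :
    |f (y + h) - f y - fderiv ℝ f y h| ≤ K * ‖h‖ ^ 2 := by
  have h2 := abs_le_of_hasDerivAt
    (g := fun s : ℝ => dirDeriv f 1 (y + s • h) h - dirDeriv f 1 y h)
    (g' := fun s => dirDeriv f 2 (y + s • h) h) (C := K * ‖h‖ ^ 2)
    (fun s => ((hasDerivAt_dirDeriv hf (by norm_num) y h s)).sub_const _)
    (by simp)
    (fun s _ => (abs_dirDeriv_le 2 _ h).trans
      (mul_le_mul_of_nonneg_right (hK _) (by positivity)))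
  have h1 := abs_le_of_hasDerivAt
    (g := fun s : ℝ => dirDeriv f 0 (y + s • h) h - f y - s * dirDeriv f 1 y h)
    (g' := fun s => dirDeriv f 1 (y + s • h) h - dirDeriv f 1 y h) (C := K * ‖h‖ ^ 2)
    (fun s => by
      refine ((((hasDerivAt_dirDeriv hf (by norm_num) y h s)).sub_const _).sub
        ((hasDerivAt_id s).mul_const (dirDeriv f 1 y h))).congr_deriv ?_
      simp)
    (by simp [dirDeriv_zero]) h2 1 (right_mem_Icc.2 zero_le_one)
  simpa [dirDeriv_zero, dirDeriv_one] using h1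

/-- Third order Taylor expansion of a function whose third derivative is Hölder continuous. -/
lemma abs_taylor_three_le (hf : ContDiff ℝ 3 f) {K β : ℝ} (hβ : 0 < β) (hK0 : 0 ≤ K)
    (y h : Vec d)
    (hK : ∀ x y, ‖iteratedFDeriv ℝ 3 f x - iteratedFDeriv ℝ 3 f y‖ ≤ K * ‖x - y‖ ^ β) :
    |f (y + h) - f y - fderiv ℝ f y h - dirDeriv f 2 y h / 2 - dirDeriv f 3 y h / 6| ≤
      K * ‖h‖ ^ (3 + β) := by
  have hpow : ‖h‖ ^ (3 + β) = ‖h‖ ^ β * ‖h‖ ^ 3 := by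
    rcases eq_or_ne ‖h‖ 0 with h0 | h0
    · rw [h0, Real.zero_rpow (by linarith)]; simp
    · rw [add_comm, Real.rpow_add (lt_of_le_of_ne (norm_nonneg h) h0.symm)]
      norm_cast
  have h3 : ∀ s ∈ Icc (0 : ℝ) 1, |dirDeriv f 3 (y + s • h) h - dirDeriv f 3 y h| ≤
      K * ‖h‖ ^ (3 + β) := by
    intro s hs
    refine (abs_dirDeriv_sub_le 3 _ _ h).trans ?_
    rw [hpow, ← mul_assoc]
    refine mul_le_mul_of_nonneg_right ((hK _ _).trans ?_) (by positivity)
    refine mul_le_mul_of_nonneg_left ?_ hK0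
    refine Real.rpow_le_rpow (norm_nonneg _) ?_ hβ.le
    rw [add_sub_cancel_left, norm_smul, Real.norm_eq_abs, abs_of_nonneg hs.1]
    exact mul_le_of_le_one_left (norm_nonneg h) hs.2
  have h2 := abs_le_of_hasDerivAt
    (g := fun s : ℝ => dirDeriv f 2 (y + s • h) h - dirDeriv f 2 y h - s * dirDeriv f 3 y h)
    (fun s => by
      refine ((((hasDerivAt_dirDeriv hf (by norm_num) y h s)).sub_const _).sub
        ((hasDerivAt_id s).mul_const (dirDeriv f 3 y h))).congr_deriv ?_
      simp)
    (by simp) h3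
  have h1 := abs_le_of_hasDerivAt
    (g := fun s : ℝ => dirDeriv f 1 (y + s • h) h - dirDeriv f 1 y h - s * dirDeriv f 2 y h
      - s ^ 2 * (dirDeriv f 3 y h / 2))
    (g' := fun s : ℝ => dirDeriv f 2 (y + s • h) h - dirDeriv f 2 y h - s * dirDeriv f 3 y h)
    (fun s => by
      refine (((((hasDerivAt_dirDeriv hf (by norm_num) y h s)).sub_const _).sub
        ((hasDerivAt_id s).mul_const (dirDeriv f 2 y h))).sub
        (((hasDerivAt_id s).pow 2).mul_const (dirDeriv f 3 y h / 2))).congr_deriv ?_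
      simp; ring)
    (by simp) h2
  have h0 := abs_le_of_hasDerivAt
    (g := fun s : ℝ => dirDeriv f 0 (y + s • h) h - f y - s * dirDeriv f 1 y h
      - s ^ 2 * (dirDeriv f 2 y h / 2) - s ^ 3 * (dirDeriv f 3 y h / 6))
    (g' := fun s : ℝ => dirDeriv f 1 (y + s • h) h - dirDeriv f 1 y h - s * dirDeriv f 2 y h
      - s ^ 2 * (dirDeriv f 3 y h / 2))
    (fun s => by
      refine ((((((hasDerivAt_dirDeriv hf (by norm_num) y h s)).sub_const _).sub
        ((hasDerivAt_id s).mul_const (dirDeriv f 1 y h))).sub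
        (((hasDerivAt_id s).pow 2).mul_const (dirDeriv f 2 y h / 2))).sub
        (((hasDerivAt_id s).pow 3).mul_const (dirDeriv f 3 y h / 6))).congr_deriv ?_
      simp; ring)
    (by simp [dirDeriv_zero]) h1 1 (right_mem_Icc.2 zero_le_one)
  simpa [dirDeriv_zero, dirDeriv_one] using h0

lemma norm_fderiv_eq_norm_gradient (x : Vec d) : ‖fderiv ℝ f x‖ = ‖∇ f x‖ := by
  rw [← toDual_gradient, LinearIsometryEquiv.norm_map]

lemma norm_iteratedFDeriv_one_eq (x : Vec d) : ‖iteratedFDeriv ℝ 1 f x‖ = ‖∇ f x‖ := by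
  rw [norm_iteratedFDeriv_one, norm_fderiv_eq_norm_gradient]

lemma iteratedFDeriv_two_cons (x a b : Vec d) :
    iteratedFDeriv ℝ 2 f x ![a, b] = fderiv ℝ (fderiv ℝ f) x a b := by
  simp [iteratedFDeriv_two_apply]

lemma norm_fderiv_fderiv_eq (x : Vec d) :
    ‖fderiv ℝ (fderiv ℝ f) x‖ = ‖iteratedFDeriv ℝ 2 f x‖ := by
  rw [← norm_iteratedFDeriv_one, norm_iteratedFDeriv_fderiv]

lemma norm_gradient_sub_le (hf : ContDiff ℝ 2 f) {K : ℝ}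
    (hK : ∀ x, ‖iteratedFDeriv ℝ 2 f x‖ ≤ K) (x y : Vec d) :
    ‖∇ f x - ∇ f y‖ ≤ K * ‖x - y‖ := by
  have h1 : ‖∇ f x - ∇ f y‖ = ‖fderiv ℝ f x - fderiv ℝ f y‖ := by
    rw [← toDual_gradient, ← toDual_gradient, ← map_sub, LinearIsometryEquiv.norm_map]
  have hd : Differentiable ℝ (fderiv ℝ f) :=
    (hf.fderiv_right (m := 1) (by norm_num)).differentiable (by norm_num)
  rw [h1]
  exact convex_univ.norm_image_sub_le_of_norm_fderiv_le (fun z _ => hd z)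
    (fun z _ => (norm_fderiv_fderiv_eq z).le.trans (hK z)) (mem_univ y) (mem_univ x)

lemma abs_hessian_sub_le (hf : ContDiff ℝ 3 f) {K : ℝ}
    (hK : ∀ x, ‖iteratedFDeriv ℝ 3 f x‖ ≤ K) (x y a : Vec d) :
    |iteratedFDeriv ℝ 2 f x ![a, a] - iteratedFDeriv ℝ 2 f y ![a, a]| ≤
      K * ‖x - y‖ * ‖a‖ ^ 2 := by
  have hd : Differentiable ℝ (iteratedFDeriv ℝ 2 f) :=
    hf.differentiable_iteratedFDeriv (by norm_cast)
  have h1 : ‖iteratedFDeriv ℝ 2 f x - iteratedFDeriv ℝ 2 f y‖ ≤ K * ‖x - y‖ :=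
    convex_univ.norm_image_sub_le_of_norm_fderiv_le (fun z _ => hd z)
      (fun z _ => by rw [norm_fderiv_iteratedFDeriv]; exact hK z) (mem_univ y) (mem_univ x)
  have h2 := (iteratedFDeriv ℝ 2 f x - iteratedFDeriv ℝ 2 f y).le_opNorm ![a, a]
  simp only [sub_apply, Fin.prod_univ_two, Matrix.cons_val_zero,
    Matrix.cons_val_one, Real.norm_eq_abs] at h2
  refine h2.trans ?_
  rw [← sq]
  gcongr

end Taylor

/-! ### The Frobenius norm -/

section Frobenius

variable {d r : ℕ}

lemma frobSq_nonneg (A : Vec r →L[ℝ] Vec d) : 0 ≤ frobSq A :=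
  Finset.sum_nonneg fun _ _ => by positivity

lemma vec_eq_sum (u : Vec r) : u = ∑ j, u j • EuclideanSpace.single j (1 : ℝ) := by
  ext i
  simp [Finset.sum_apply, Pi.single_apply]

/-- The operator norm is dominated by the Frobenius norm. -/
lemma norm_apply_le_frob (A : Vec r →L[ℝ] Vec d) (u : Vec r) :
    ‖A u‖ ≤ √(frobSq A) * ‖u‖ := by
  have h1 : A u = ∑ j, u j • A (EuclideanSpace.single j (1 : ℝ)) := by
    conv_lhs => rw [vec_eq_sum u]
    simp [map_sum]
  have h2 : ‖A u‖ ≤ ∑ j, ‖A (EuclideanSpace.single j (1 : ℝ))‖ * |u j| := by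
    rw [h1]
    refine (norm_sum_le _ _).trans_eq (Finset.sum_congr rfl fun j _ => ?_)
    rw [norm_smul, Real.norm_eq_abs, mul_comm]
  refine h2.trans ((Real.sum_mul_le_sqrt_mul_sqrt _ _ _).trans_eq ?_)
  rw [frobSq, EuclideanSpace.norm_eq]
  simp

lemma opNorm_le_frob (A : Vec r →L[ℝ] Vec d) : ‖A‖ ≤ √(frobSq A) :=
  A.opNorm_le_bound (Real.sqrt_nonneg _) (norm_apply_le_frob A)

end Frobenius

/-! ### One step of the scheme -/

section OneStep

variable {d r : ℕ}

/-- One step of the Euler scheme, of length `γ`, from `x` with innovation `u`. -/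
noncomputable def eulerStep (b : Vec d → Vec d) (σ : Vec d → Vec r →L[ℝ] Vec d) (γ : ℝ)
    (x : Vec d) (u : Vec r) : Vec d :=
  x + γ • b x + √γ • σ x u

/-- The mean of `f` after one step of the Euler scheme from `x`. -/
noncomputable def stepMean (b : Vec d → Vec d) (σ : Vec d → Vec r →L[ℝ] Vec d)
    (μ : Measure (Vec r)) (γ : ℝ) (f : Vec d → ℝ) (x : Vec d) : ℝ :=
  ∫ u, f (eulerStep b σ γ x u) ∂μ

/-- All quantitative bounds on the coefficients and on a test function `f`, expressed with a
single constant `K`. Every term of lower order is measured by `√V`. -/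
structure StepBounds (b : Vec d → Vec d) (σ : Vec d → Vec r →L[ℝ] Vec d) (V : Vec d → ℝ)
    (β K : ℝ) (f : Vec d → ℝ) : Prop where
  one_le : 1 ≤ K
  contDiff : ContDiff ℝ 3 f
  grad : ∀ x, ‖∇ f x‖ ≤ K
  hess : ∀ x, ‖iteratedFDeriv ℝ 2 f x‖ ≤ K
  third : ∀ x, ‖iteratedFDeriv ℝ 3 f x‖ ≤ K
  holder : ∀ x y, ‖iteratedFDeriv ℝ 3 f x - iteratedFDeriv ℝ 3 f y‖ ≤ K * ‖x - y‖ ^ β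
  lip : ∀ x y, |⟪b x, ∇ f x⟫_ℝ - ⟪b y, ∇ f y⟫_ℝ| ≤ K * ‖x - y‖
  growth : ∀ x, |f x| ≤ K * √(V x)
  drift_lip : ∀ x y, ‖b x - b y‖ ≤ K * ‖x - y‖
  drift_growth : ∀ x, ‖b x‖ ≤ K * √(V x)
  diffusion : ∀ x, √(frobSq (σ x)) ≤ K
  one_le_sqrt : ∀ x, 1 ≤ K * √(V x)

end OneStep

namespace GaussianLike

variable {r : ℕ} {μ : Measure (Vec r)} (hμ : GaussianLike μ)

include hμ

lemma integrable_coord (i : Fin r) : Integrable (fun u : Vec r => u i) μ := by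
  refine hμ.integrable_of_poly_growth (by fun_prop) 1 fun u => ?_
  have h := PiLp.norm_apply_le u i
  rw [Real.norm_eq_abs] at h
  nlinarith [sq_nonneg (‖u‖ - 1), sq_nonneg (‖u‖ ^ 2)]

lemma integrable_coord_mul (i j : Fin r) : Integrable (fun u : Vec r => u i * u j) μ := by
  refine hμ.integrable_of_poly_growth (by fun_prop) 1 fun u => ?_
  have hi := PiLp.norm_apply_le u i
  have hj := PiLp.norm_apply_le u j
  rw [Real.norm_eq_abs] at hi hj
  rw [abs_mul]
  have := mul_le_mul hi hj (abs_nonneg _) (norm_nonneg u)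
  nlinarith [sq_nonneg (‖u‖ ^ 2), sq_nonneg ‖u‖]

lemma integrable_coord_mul_mul (i j k : Fin r) :
    Integrable (fun u : Vec r => u i * u j * u k) μ := by
  refine hμ.integrable_of_poly_growth (by fun_prop) 1 fun u => ?_
  have hi := PiLp.norm_apply_le u i
  have hj := PiLp.norm_apply_le u j
  have hk := PiLp.norm_apply_le u k
  rw [Real.norm_eq_abs] at hi hj hk
  rw [abs_mul, abs_mul]
  have h1 := mul_le_mul hi hj (abs_nonneg _) (norm_nonneg u)
  have h2 := mul_le_mul h1 hk (abs_nonneg _) (by positivity)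
  nlinarith [sq_nonneg (‖u‖ ^ 2), sq_nonneg ‖u‖, sq_nonneg (‖u‖ ^ 2 - ‖u‖), sq_nonneg (‖u‖ - 1)]

lemma integral_linear (l : Vec r →L[ℝ] ℝ) : ∫ u, l u ∂μ = 0 := by
  have h : ∀ u, l u = ∑ j, u j * l (EuclideanSpace.single j (1 : ℝ)) := fun u => by
    conv_lhs => rw [vec_eq_sum u]
    simp only [map_sum, map_smul, smul_eq_mul]
  rw [integral_congr_ae (.of_forall h),
    integral_finsetSum _ fun j _ => (hμ.integrable_coord j).mul_const _]
  simp [integral_mul_const, hμ.moment_one]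

lemma integrable_bilinear (B : Vec r →L[ℝ] Vec r →L[ℝ] ℝ) : Integrable (fun u => B u u) μ := by
  refine hμ.integrable_of_poly_growth (by fun_prop) ‖B‖ fun u => ?_
  refine (B.le_opNorm₂ u u).trans ?_
  rw [mul_assoc]
  refine mul_le_mul_of_nonneg_left ?_ (norm_nonneg B)
  nlinarith [sq_nonneg (‖u‖ ^ 2), sq_nonneg ‖u‖]

lemma integral_bilinear (B : Vec r →L[ℝ] Vec r →L[ℝ] ℝ) :
    ∫ u, B u u ∂μ = ∑ j, B (EuclideanSpace.single j (1 : ℝ)) (EuclideanSpace.single j (1 : ℝ)) := by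
  have h : ∀ u, B u u = ∑ i, ∑ j, u i * u j *
      B (EuclideanSpace.single i (1 : ℝ)) (EuclideanSpace.single j (1 : ℝ)) := fun u => by
    conv_lhs => rw [vec_eq_sum u]
    simp only [map_sum, map_smul, FunLike.coe_sum, Finset.sum_apply, smul_apply,
      smul_eq_mul, Finset.mul_sum]
    rw [Finset.sum_comm]
    refine Finset.sum_congr rfl fun i _ => Finset.sum_congr rfl fun j _ => ?_
    ring
  simp_rw [h]
  rw [integral_finsetSum _ fun i _ => integrable_finsetSum _ fun j _ =>
    (hμ.integrable_coord_mul i j).mul_const _]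
  refine Finset.sum_congr rfl fun i _ => ?_
  rw [integral_finsetSum _ fun j _ => (hμ.integrable_coord_mul i j).mul_const _]
  simp [integral_mul_const, hμ.moment_two]

lemma integrable_trilinear (T : ContinuousMultilinearMap ℝ (fun _ : Fin 3 => Vec r) ℝ) :
    Integrable (fun u => T fun _ => u) μ := by
  refine hμ.integrable_of_poly_growth (by fun_prop) ‖T‖ fun u => ?_
  refine (T.le_opNorm _).trans ?_
  refine mul_le_mul_of_nonneg_left ?_ (norm_nonneg T)
  simp only [Finset.prod_const, Finset.card_univ, Fintype.card_fin]
  nlinarith [sq_nonneg (‖u‖ ^ 2), sq_nonneg ‖u‖, sq_nonneg (‖u‖ ^ 2 - ‖u‖), sq_nonneg (‖u‖ - 1)]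

lemma integral_trilinear (T : ContinuousMultilinearMap ℝ (fun _ : Fin 3 => Vec r) ℝ) :
    ∫ u, T (fun _ => u) ∂μ = 0 := by
  have h : ∀ u : Vec r, T (fun _ => u) = ∑ s : Fin 3 → Fin r, u (s 0) * u (s 1) * u (s 2) *
      T (fun i => EuclideanSpace.single (s i) (1 : ℝ)) := fun u => by
    conv_lhs => rw [vec_eq_sum u]
    rw [T.map_sum]
    refine Finset.sum_congr rfl fun s _ => ?_
    rw [T.map_smul_univ (fun i => u (s i)), Fin.prod_univ_three, smul_eq_mul]
  simp_rw [h]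
  rw [integral_finsetSum _ fun s _ =>
    (hμ.integrable_coord_mul_mul (s 0) (s 1) (s 2)).mul_const _]
  simp [integral_mul_const, hμ.moment_three]

lemma integrable_poly : Integrable (fun u : Vec r => (‖u‖ ^ 2 + 1) ^ 2) μ :=
  hμ.integrable_of_poly_growth (by fun_prop) 1 fun u => by
    rw [abs_of_nonneg (by positivity), one_mul]

lemma integrable_poly_mul_exp (C : ℝ) :
    Integrable (fun u : Vec r => (‖u‖ ^ 2 + 1) ^ 2 * Real.exp (C * (‖u‖ + 1))) μ :=
  hμ.integrable_of_sq_growth (by fun_prop) 1 C fun u => by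
    rw [abs_of_nonneg (by positivity), one_mul]

end GaussianLike

namespace StepBounds

variable {d r : ℕ} {b : Vec d → Vec d} {σ : Vec d → Vec r →L[ℝ] Vec d} {V : Vec d → ℝ}
  {β K : ℝ} {f : Vec d → ℝ} (hf : StepBounds b σ V β K f)

include hf

lemma norm_diffusion_apply_le (x : Vec d) (u : Vec r) : ‖σ x u‖ ≤ K * ‖u‖ :=
  (norm_apply_le_frob _ _).trans (mul_le_mul_of_nonneg_right (hf.diffusion x) (norm_nonneg u))

lemma norm_noise_le (γ : ℝ) (x : Vec d) (u : Vec r) : ‖√γ • σ x u‖ ≤ K * √γ * ‖u‖ := by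
  rw [norm_smul, Real.norm_eq_abs, abs_of_nonneg (Real.sqrt_nonneg γ)]
  have := mul_le_mul_of_nonneg_left (hf.norm_diffusion_apply_le x u) (Real.sqrt_nonneg γ)
  linarith

lemma contDiff_two : ContDiff ℝ 2 f := hf.contDiff.of_le (by norm_num)

lemma differentiable : Differentiable ℝ f := hf.contDiff.differentiable (by norm_num)

lemma abs_sub_le (x y : Vec d) : |f x - f y| ≤ K * ‖x - y‖ := by
  have := abs_sub_le_of_fderiv_bound (hf.contDiff.of_le (by norm_num)) y (x - y)
    (fun z => (norm_iteratedFDeriv_one_eq z).le.trans (hf.grad z))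
  simpa using this

/-- The discretization error of the drift. Comparing `⟨b, ∇f⟩` at two points, and not `∇f`
alone, keeps this error linear in `|b|`. -/
lemma abs_drift_error_le {γ : ℝ} (hγ : 0 ≤ γ) (x : Vec d) :
    |f (x + γ • b x) - f x - γ * ⟪b x, ∇ f x⟫_ℝ| ≤ 2 * K ^ 3 * γ ^ 2 * √(V x) := by
  have hK := hf.one_le
  have hV := Real.sqrt_nonneg (V x)
  have hder : ∀ s : ℝ, HasDerivAt
      (fun s : ℝ => f (x + s • (γ • b x)) - f x - s * (γ * ⟪b x, ∇ f x⟫_ℝ))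
      (γ * ⟪b x, ∇ f (x + s • (γ • b x))⟫_ℝ - γ * ⟪b x, ∇ f x⟫_ℝ) s := by
    intro s
    have h2 : HasDerivAt (fun s : ℝ => x + s • (γ • b x)) (γ • b x) s := by
      simpa using ((hasDerivAt_id s).smul_const (γ • b x)).const_add x
    have h3 := (hf.differentiable (x + s • (γ • b x))).hasFDerivAt.comp_hasDerivAt s h2
    refine ((h3.sub_const (f x)).sub
      ((hasDerivAt_id s).mul_const (γ * ⟪b x, ∇ f x⟫_ℝ))).congr_deriv ?_
    rw [map_smul, ← inner_gradient_left, real_inner_comm]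
    simp
  have h := abs_le_of_hasDerivAt hder (by simp) (C := 2 * K ^ 3 * γ ^ 2 * √(V x)) ?_ 1
    (right_mem_Icc.2 zero_le_one)
  · simpa using h
  intro s hs
  set z := x + s • (γ • b x) with hz
  have hzx : ‖z - x‖ ≤ γ * (K * √(V x)) := by
    rw [hz, add_sub_cancel_left, norm_smul, norm_smul, Real.norm_eq_abs, Real.norm_eq_abs,
      abs_of_nonneg hs.1, abs_of_nonneg hγ]
    have h1 := mul_le_mul_of_nonneg_left (hf.drift_growth x) hγ
    have h2 : 0 ≤ γ * ‖b x‖ := by positivity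
    nlinarith [hs.1, hs.2]
  have h1 := hf.lip z x
  have h2 : |⟪b x - b z, ∇ f z⟫_ℝ| ≤ K * ‖z - x‖ * K := by
    refine (abs_real_inner_le_norm _ _).trans ?_
    have := hf.drift_lip x z
    rw [norm_sub_rev x z] at this
    exact mul_le_mul this (hf.grad z) (norm_nonneg _) (by positivity)
  have h3 : |⟪b x, ∇ f z⟫_ℝ - ⟪b x, ∇ f x⟫_ℝ| ≤ K * ‖z - x‖ + K * ‖z - x‖ * K := by
    have e : ⟪b x, ∇ f z⟫_ℝ - ⟪b x, ∇ f x⟫_ℝ =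
        (⟪b z, ∇ f z⟫_ℝ - ⟪b x, ∇ f x⟫_ℝ) + ⟪b x - b z, ∇ f z⟫_ℝ := by
      rw [inner_sub_left]; ring
    rw [e]
    exact (abs_add_le _ _).trans (add_le_add h1 h2)
  rw [← mul_sub, abs_mul, abs_of_nonneg hγ]
  have h4 : K * ‖z - x‖ + K * ‖z - x‖ * K ≤ 2 * K ^ 2 * (γ * (K * √(V x))) := by
    have h5 : K * ‖z - x‖ + K * ‖z - x‖ * K ≤ 2 * K ^ 2 * ‖z - x‖ := by
      nlinarith [norm_nonneg (z - x), mul_nonneg (norm_nonneg (z - x)) (by linarith : 0 ≤ K - 1)]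
    refine h5.trans (mul_le_mul_of_nonneg_left hzx (by positivity))
  calc γ * |⟪b x, ∇ f z⟫_ℝ - ⟪b x, ∇ f x⟫_ℝ| ≤ γ * (2 * K ^ 2 * (γ * (K * √(V x)))) :=
        mul_le_mul_of_nonneg_left (h3.trans h4) hγ
    _ = _ := by ring

/-- The mean effect of the noise: the third order term of the Taylor expansion has mean zero, so
that the error is that of the Hölder remainder. -/
lemma abs_noise_error_le {μ : Measure (Vec r)} (hμ : GaussianLike μ) (hβ : β ∈ Ioc (0 : ℝ) 1)
    {γ : ℝ} (hγ : 0 < γ) (x y : Vec d) :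
    |∫ u, f (y + √γ • σ x u) ∂μ - f y - γ / 2 * ∑ j : Fin r, iteratedFDeriv ℝ 2 f y
      ![σ x (EuclideanSpace.single j 1), σ x (EuclideanSpace.single j 1)]| ≤
      K ^ 5 * (∫ u, (‖u‖ ^ 2 + 1) ^ 2 ∂μ) * γ ^ ((3 + β) / 2) := by
  have := hμ.prob
  have hK := hf.one_le
  have hcont := hf.contDiff.continuous
  have hsq : √γ ^ 2 = γ := Real.sq_sqrt hγ.le
  set A : Vec r →L[ℝ] Vec d := √γ • σ x with hA
  set T3 := (iteratedFDeriv ℝ 3 f y).compContinuousLinearMap (fun _ => A) with hT3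
  set B : Vec r →L[ℝ] Vec r →L[ℝ] ℝ :=
    (fderiv ℝ (fderiv ℝ f) y).bilinearComp A A with hB
  have hB2 : ∀ u, dirDeriv f 2 y (A u) = B u u := fun u => by
    rw [dirDeriv, iteratedFDeriv_two_apply]; rfl
  have hT : ∀ u, dirDeriv f 3 y (A u) = T3 fun _ => u := fun u => rfl
  have i1 : Integrable (fun u => fderiv ℝ f y (A u)) μ :=
    hμ.integrable_lipschitz ((fderiv ℝ f y).comp A).lipschitz
  have i2 : Integrable (fun u => dirDeriv f 2 y (A u)) μ := by
    simp_rw [hB2]; exact hμ.integrable_bilinear B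
  have i3 : Integrable (fun u => dirDeriv f 3 y (A u)) μ := by
    simp_rw [hT]; exact hμ.integrable_trilinear T3
  have i0 : Integrable (fun u => f (y + A u)) μ := by
    refine hμ.integrable_lipschitz (L := (Real.toNNReal (K * ‖A‖)))
      (LipschitzWith.of_dist_le_mul fun u w => ?_)
    rw [Real.dist_eq, dist_eq_norm, Real.coe_toNNReal _ (by positivity)]
    refine (hf.abs_sub_le _ _).trans ?_
    rw [add_sub_add_left_eq_sub, ← map_sub, mul_assoc]
    exact mul_le_mul_of_nonneg_left (A.le_opNorm _) (by positivity)
  have e1 : ∫ u, fderiv ℝ f y (A u) ∂μ = 0 := hμ.integral_linear ((fderiv ℝ f y).comp A)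
  have e2 : ∫ u, dirDeriv f 2 y (A u) ∂μ = γ * ∑ j : Fin r, iteratedFDeriv ℝ 2 f y
      ![σ x (EuclideanSpace.single j 1), σ x (EuclideanSpace.single j 1)] := by
    simp_rw [hB2]
    rw [hμ.integral_bilinear B, Finset.mul_sum]
    refine Finset.sum_congr rfl fun j _ => ?_
    rw [iteratedFDeriv_two_cons, ← hsq]
    simp [hB, hA]
    ring
  have e3 : ∫ u, dirDeriv f 3 y (A u) ∂μ = 0 := by
    simp_rw [hT]; exact hμ.integral_trilinear T3
  have key : ∫ u, f (y + √γ • σ x u) ∂μ - f y - γ / 2 * ∑ j : Fin r, iteratedFDeriv ℝ 2 f y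
      ![σ x (EuclideanSpace.single j 1), σ x (EuclideanSpace.single j 1)] =
      ∫ u, (f (y + A u) - f y - fderiv ℝ f y (A u) - dirDeriv f 2 y (A u) / 2
        - dirDeriv f 3 y (A u) / 6) ∂μ := by
    have j1 : Integrable (fun u => f (y + A u) - f y) μ := i0.sub (integrable_const _)
    have j2 : Integrable (fun u => f (y + A u) - f y - fderiv ℝ f y (A u)) μ := j1.sub i1
    have j3 : Integrable (fun u => f (y + A u) - f y - fderiv ℝ f y (A u)
      - dirDeriv f 2 y (A u) / 2) μ := j2.sub (i2.div_const 2)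
    rw [integral_sub j3 (i3.div_const 6), integral_sub j2 (i2.div_const 2), integral_sub j1 i1,
      integral_sub i0 (integrable_const _),
      integral_div, integral_div, e1, e2, e3]
    simp [hA]
    ring
  rw [key]
  have hpt : ∀ u, ‖f (y + A u) - f y - fderiv ℝ f y (A u) - dirDeriv f 2 y (A u) / 2
        - dirDeriv f 3 y (A u) / 6‖ ≤
      K ^ 5 * γ ^ ((3 + β) / 2) * (‖u‖ ^ 2 + 1) ^ 2 := by
    intro u
    refine (abs_taylor_three_le hf.contDiff hβ.1 (by linarith) y (A u) hf.holder).trans ?_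
    have h1 : ‖A u‖ ^ (3 + β) ≤ (K * √γ * ‖u‖) ^ (3 + β) :=
      Real.rpow_le_rpow (norm_nonneg _) (hf.norm_noise_le γ x u) (by linarith [hβ.1])
    have h2 : (K * √γ * ‖u‖) ^ (3 + β) =
        K ^ (3 + β) * γ ^ ((3 + β) / 2) * ‖u‖ ^ (3 + β) := by
      rw [Real.mul_rpow (by positivity) (norm_nonneg u), Real.mul_rpow (by linarith)
        (Real.sqrt_nonneg _), Real.sqrt_eq_rpow, ← Real.rpow_mul hγ.le]
      congr 3; ring
    have h3 : K ^ (3 + β) ≤ K ^ 4 := by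
      rw [← Real.rpow_natCast]
      exact Real.rpow_le_rpow_of_exponent_le hK (by norm_num; linarith [hβ.2])
    have h4 : ‖u‖ ^ (3 + β) ≤ (‖u‖ ^ 2 + 1) ^ 2 := by
      rcases le_total ‖u‖ 1 with hu | hu
      · exact (Real.rpow_le_one (norm_nonneg u) hu (by linarith [hβ.1])).trans
          (by nlinarith [sq_nonneg ‖u‖])
      · calc ‖u‖ ^ (3 + β) ≤ ‖u‖ ^ (4 : ℝ) :=
              Real.rpow_le_rpow_of_exponent_le hu (by linarith [hβ.2])
          _ = ‖u‖ ^ 4 := by norm_cast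
          _ ≤ _ := by nlinarith [sq_nonneg ‖u‖]
    have hγp : 0 ≤ γ ^ ((3 + β) / 2) := Real.rpow_nonneg hγ.le _
    calc K * ‖A u‖ ^ (3 + β) ≤ K * (K ^ (3 + β) * γ ^ ((3 + β) / 2) * ‖u‖ ^ (3 + β)) := by
          rw [← h2]; exact mul_le_mul_of_nonneg_left h1 (by linarith)
      _ ≤ K * (K ^ 4 * γ ^ ((3 + β) / 2) * (‖u‖ ^ 2 + 1) ^ 2) := by
          gcongr
      _ = _ := by ring
  refine (norm_integral_le_of_norm_le (hμ.integrable_poly.const_mul _) (.of_forall hpt)).trans_eq ?_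
  rw [integral_const_mul]
  ring

/-- One step of the scheme acts as the generator up to an error of order `γ ^ ((3 + β) / 2)`. -/
lemma exists_abs_bias_le {μ : Measure (Vec r)} (hμ : GaussianLike μ) (hβ : β ∈ Ioc (0 : ℝ) 1)
    (G : ℝ) : ∃ C ≥ 0, ∀ γ > 0, γ ≤ G → ∀ x,
      |stepMean b σ μ γ f x - f x - γ * gen b σ f x| ≤ C * γ ^ ((3 + β) / 2) * √(V x) := by
  set M := ∫ u : Vec r, (‖u‖ ^ 2 + 1) ^ 2 ∂μ with hM
  have hM0 : 0 ≤ M := integral_nonneg fun u => by positivity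
  have hK := hf.one_le
  set G' := max G 1 with hG'
  have hG1 : 1 ≤ G' := le_max_right _ _
  refine ⟨(2 * K ^ 3 + K ^ 4) * G' + K ^ 6 * M, by positivity, fun γ hγ hγG x => ?_⟩
  have hV := Real.sqrt_nonneg (V x)
  have hγp : 0 ≤ γ ^ ((3 + β) / 2) := Real.rpow_nonneg hγ.le _
  have h1 := hf.abs_drift_error_le hγ.le x
  have h2 := hf.abs_noise_error_le hμ hβ hγ x (x + γ • b x)
  have h3 : |∑ j : Fin r, iteratedFDeriv ℝ 2 f (x + γ • b x)
        ![σ x (EuclideanSpace.single j 1), σ x (EuclideanSpace.single j 1)] -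
      ∑ j : Fin r, iteratedFDeriv ℝ 2 f x
        ![σ x (EuclideanSpace.single j 1), σ x (EuclideanSpace.single j 1)]| ≤
      K ^ 4 * γ * √(V x) := by
    rw [← Finset.sum_sub_distrib]
    have hb : ‖x + γ • b x - x‖ ≤ γ * (K * √(V x)) := by
      rw [add_sub_cancel_left, norm_smul, Real.norm_eq_abs, abs_of_pos hγ]
      exact mul_le_mul_of_nonneg_left (hf.drift_growth x) hγ.le
    have hfrob : frobSq (σ x) ≤ K ^ 2 := by
      have := hf.diffusion x
      rw [← Real.sq_sqrt (frobSq_nonneg (σ x))]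
      gcongr
    calc _ ≤ ∑ j : Fin r, K * ‖x + γ • b x - x‖ * ‖σ x (EuclideanSpace.single j 1)‖ ^ 2 :=
          (Finset.abs_sum_le_sum_abs _ _).trans
            (Finset.sum_le_sum fun j _ => abs_hessian_sub_le hf.contDiff hf.third _ _ _)
      _ = K * ‖x + γ • b x - x‖ * frobSq (σ x) := by rw [← Finset.mul_sum]; rfl
      _ ≤ K * (γ * (K * √(V x))) * K ^ 2 := by
          have := frobSq_nonneg (σ x)
          gcongr
      _ = _ := by ring
  have hγ2 : γ ^ 2 ≤ G' * γ ^ ((3 + β) / 2) := by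
    have e : γ ^ 2 = γ ^ ((1 - β) / 2) * γ ^ ((3 + β) / 2) := by
      rw [← Real.rpow_add hγ, ← Real.rpow_natCast]
      congr 1; push_cast; ring
    rw [e]
    refine mul_le_mul_of_nonneg_right ?_ hγp
    calc γ ^ ((1 - β) / 2) ≤ G' ^ ((1 - β) / 2) :=
          Real.rpow_le_rpow hγ.le (hγG.trans (le_max_left _ _)) (by linarith [hβ.2])
      _ ≤ G' ^ (1 : ℝ) := Real.rpow_le_rpow_of_exponent_le hG1 (by linarith [hβ.1])
      _ = G' := Real.rpow_one _
  set S1 := ∑ j : Fin r, iteratedFDeriv ℝ 2 f (x + γ • b x)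
        ![σ x (EuclideanSpace.single j 1), σ x (EuclideanSpace.single j 1)]
  set S0 := ∑ j : Fin r, iteratedFDeriv ℝ 2 f x
        ![σ x (EuclideanSpace.single j 1), σ x (EuclideanSpace.single j 1)]
  have e : stepMean b σ μ γ f x - f x - γ * gen b σ f x =
      (∫ u, f (x + γ • b x + √γ • σ x u) ∂μ - f (x + γ • b x) - γ / 2 * S1) +
      (f (x + γ • b x) - f x - γ * ⟪b x, ∇ f x⟫_ℝ) + γ / 2 * (S1 - S0) := by
    simp only [stepMean, eulerStep, gen, S0]
    ring
  rw [e]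
  have h4 : |γ / 2 * (S1 - S0)| ≤ γ / 2 * (K ^ 4 * γ * √(V x)) := by
    rw [abs_mul, abs_of_pos (by positivity : 0 < γ / 2)]
    gcongr
  refine ((abs_add_le _ _).trans (add_le_add ((abs_add_le _ _).trans (add_le_add h2 h1))
    h4)).trans ?_
  have h5 : K ^ 5 * M * γ ^ ((3 + β) / 2) ≤ K ^ 5 * M * γ ^ ((3 + β) / 2) * (K * √(V x)) :=
    le_mul_of_one_le_right (by positivity) (hf.one_le_sqrt x)
  have h6 : (2 * K ^ 3 + K ^ 4) * √(V x) * γ ^ 2 ≤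
      (2 * K ^ 3 + K ^ 4) * √(V x) * (G' * γ ^ ((3 + β) / 2)) :=
    mul_le_mul_of_nonneg_left hγ2 (by positivity)
  have h7 : 0 ≤ K ^ 4 * √(V x) * γ ^ 2 := by positivity
  linarith

end StepBounds

/-! ### Exponential bounds for one step -/

/-- Second order Taylor bound for the exponential. -/
lemma exp_le_quadratic_exp (x : ℝ) :
    Real.exp x ≤ 1 + x + x ^ 2 * Real.exp |x| := by
  have h := Complex.norm_exp_sub_sum_le_norm_mul_exp (x : ℂ) 2
  simp only [Finset.sum_range_succ, Finset.sum_range_zero] at h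
  norm_num at h
  have e : Complex.exp x - (1 + x) = ((Real.exp x - (1 + x) : ℝ) : ℂ) := by push_cast; ring
  rw [e, Complex.norm_real, Real.norm_eq_abs] at h
  linarith [le_of_abs_le h]

namespace StepBounds

variable {d r : ℕ} {b : Vec d → Vec d} {σ : Vec d → Vec r →L[ℝ] Vec d} {V : Vec d → ℝ}
  {β K : ℝ} {f : Vec d → ℝ} (hf : StepBounds b σ V β K f)

include hf

lemma bddAbove_grad : BddAbove (range fun x => ‖∇ f x‖) :=
  ⟨K, by rintro _ ⟨x, rfl⟩; exact hf.grad x⟩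

lemma bddAbove_frob : BddAbove (range fun x => √(frobSq (σ x))) :=
  ⟨K, by rintro _ ⟨x, rfl⟩; exact hf.diffusion x⟩

lemma abs_step_sub_le (γ : ℝ) (x : Vec d) (u w : Vec r) :
    |f (eulerStep b σ γ x u) - f (eulerStep b σ γ x w)| ≤
      (supFrob σ * supGrad f * √γ) * ‖u - w‖ := by
  have h1 : |f (eulerStep b σ γ x u) - f (eulerStep b σ γ x w)| ≤
      supGrad f * ‖eulerStep b σ γ x u - eulerStep b σ γ x w‖ := by
    have := abs_sub_le_of_fderiv_bound (K := supGrad f) (hf.contDiff.of_le (by norm_num))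
      (eulerStep b σ γ x w) (eulerStep b σ γ x u - eulerStep b σ γ x w)
      (fun z => (norm_iteratedFDeriv_one_eq z).le.trans (le_ciSup hf.bddAbove_grad z))
    simpa using this
  have h2 : ‖eulerStep b σ γ x u - eulerStep b σ γ x w‖ ≤ √γ * (supFrob σ * ‖u - w‖) := by
    have e : eulerStep b σ γ x u - eulerStep b σ γ x w = √γ • σ x (u - w) := by
      simp only [eulerStep, map_sub, smul_sub]; abel
    rw [e, norm_smul, Real.norm_eq_abs, abs_of_nonneg (Real.sqrt_nonneg γ)]
    refine mul_le_mul_of_nonneg_left ((norm_apply_le_frob _ _).trans ?_) (Real.sqrt_nonneg γ)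
    exact mul_le_mul_of_nonneg_right (le_ciSup hf.bddAbove_frob x) (norm_nonneg _)
  have h3 : 0 ≤ supGrad f := Real.iSup_nonneg fun x => norm_nonneg _
  refine h1.trans ((mul_le_mul_of_nonneg_left h2 h3).trans_eq ?_)
  ring

/-- The sub-Gaussian bound for one martingale increment, with the uniform Lipschitz constant. -/
lemma expInt_increment_le {μ : Measure (Vec r)} (hμ : GaussianLike μ) {γ : ℝ} (hγ : 0 ≤ γ)
    (x : Vec d) (l : ℝ) :
    expInt μ (fun u => l * (f (eulerStep b σ γ x u) - stepMean b σ μ γ f x)) ≤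
      ENNReal.ofReal (Real.exp (l ^ 2 * γ * (supFrob σ ^ 2 * supGrad f ^ 2) / 2)) := by
  have h1 : 0 ≤ supGrad f := Real.iSup_nonneg fun x => norm_nonneg _
  have h2 : 0 ≤ supFrob σ := Real.iSup_nonneg fun x => Real.sqrt_nonneg _
  refine (hμ.expInt_lipschitz_le (g := fun u => f (eulerStep b σ γ x u)) (by positivity)
    (hf.abs_step_sub_le γ x) l).trans_eq ?_
  congr 3
  rw [mul_pow, mul_pow, Real.sq_sqrt hγ]
  ring

/-- The non-linear part of an increment has exponential moments of order `γ²`. Below the scale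
`|t| √γ ≤ 1` this comes from its quadratic size, above it from its Lipschitz constant. -/
lemma exists_expInt_remainder_le {μ : Measure (Vec r)} (hμ : GaussianLike μ) :
    ∃ C ≥ 0, ∀ γ > 0, ∀ (x y : Vec d) (t : ℝ),
      expInt μ (fun u => t * ((f (y + √γ • σ x u) - fderiv ℝ f y (√γ • σ x u)) -
        ∫ w, (f (y + √γ • σ x w) - fderiv ℝ f y (√γ • σ x w)) ∂μ)) ≤
      ENNReal.ofReal (Real.exp (C * (γ ^ 2 * t ^ 2 + γ ^ 2 * t ^ 4))) := by
  have := hμ.prob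
  have hK := hf.one_le
  have hcont := hf.contDiff.continuous
  set M := ∫ u : Vec r, (‖u‖ ^ 2 + 1) ^ 2 ∂μ with hM
  have hM0 : 0 ≤ M := integral_nonneg fun u => by positivity
  set C0 := 2 * K ^ 3 * (1 + M) with hC0
  have hC00 : 0 ≤ C0 := by positivity
  set M2 := ∫ u : Vec r, (‖u‖ ^ 2 + 1) ^ 2 * Real.exp (C0 * (‖u‖ + 1)) ∂μ with hM2
  have hM20 : 0 ≤ M2 := integral_nonneg fun u => by positivity
  refine ⟨C0 ^ 2 * M2 + 2 * K ^ 4, by positivity, fun γ hγ x y t => ?_⟩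
  set A : Vec r →L[ℝ] Vec d := √γ • σ x with hA
  set h : Vec r → ℝ := fun u => f (y + A u) - fderiv ℝ f y (A u) with hh
  change expInt μ (fun u => t * (h u - ∫ w, h w ∂μ)) ≤ _
  have hsγ := Real.sqrt_nonneg γ
  have hsq : √γ ^ 2 = γ := Real.sq_sqrt hγ.le
  have hAu : ∀ u, ‖A u‖ ≤ K * √γ * ‖u‖ := hf.norm_noise_le γ x
  have hfd : ∀ z, |fderiv ℝ f y z| ≤ K * ‖z‖ := fun z => by
    have := (fderiv ℝ f y).le_opNorm z
    rw [norm_fderiv_eq_norm_gradient] at this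
    exact this.trans (mul_le_mul_of_nonneg_right (hf.grad y) (norm_nonneg z))
  have hlip : ∀ u w, |h u - h w| ≤ 2 * K ^ 2 * √γ * ‖u - w‖ := by
    intro u w
    have h1 := hf.abs_sub_le (y + A u) (y + A w)
    have h2 := hfd (A (u - w))
    have h3 := hAu (u - w)
    rw [add_sub_add_left_eq_sub, ← map_sub] at h1
    have e : h u - h w = (f (y + A u) - f (y + A w)) - fderiv ℝ f y (A (u - w)) := by
      simp only [hh, map_sub]; ring
    rw [e]
    have h4 : K * ‖A (u - w)‖ ≤ K * (K * √γ * ‖u - w‖) :=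
      mul_le_mul_of_nonneg_left h3 (by linarith)
    calc _ ≤ |f (y + A u) - f (y + A w)| + |fderiv ℝ f y (A (u - w))| := abs_sub _ _
      _ ≤ K * (K * √γ * ‖u - w‖) + K * (K * √γ * ‖u - w‖) := by linarith
      _ = _ := by ring
  have hhc : Continuous h := by
    simp only [hh]; fun_prop
  have hint : Integrable h μ := hμ.integrable_lipschitz (L := (2 * K ^ 2 * √γ).toNNReal)
    (LipschitzWith.of_dist_le_mul fun u w => by
      rw [Real.dist_eq, dist_eq_norm, Real.coe_toNNReal _ (by positivity)]; exact hlip u w)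
  have hquad : ∀ u, |h u - h 0| ≤ K ^ 3 * γ * ‖u‖ ^ 2 := by
    intro u
    have h1 := abs_taylor_one_le hf.contDiff_two y (A u) hf.hess
    have e : h u - h 0 = f (y + A u) - f y - fderiv ℝ f y (A u) := by
      simp only [hh, map_zero, add_zero, sub_zero]; ring
    rw [e]
    have h2 : ‖A u‖ ^ 2 ≤ (K * √γ * ‖u‖) ^ 2 := by
      have := hAu u
      gcongr
    calc _ ≤ K * ‖A u‖ ^ 2 := h1
      _ ≤ K * (K * √γ * ‖u‖) ^ 2 := mul_le_mul_of_nonneg_left h2 (by linarith)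
      _ = K ^ 3 * √γ ^ 2 * ‖u‖ ^ 2 := by ring
      _ = _ := by rw [hsq]
  set c := ∫ w, h w ∂μ with hc
  have hcsub : c - h 0 = ∫ u, (h u - h 0) ∂μ := by
    rw [integral_sub hint (integrable_const _)]; simp [hc]
  have hc1 : |c - h 0| ≤ K ^ 3 * γ * M := by
    rw [hcsub, ← Real.norm_eq_abs]
    refine (norm_integral_le_of_norm_le (hμ.integrable_poly.const_mul (K ^ 3 * γ))
      (.of_forall fun u => (hquad u).trans ?_)).trans_eq (integral_const_mul _ _)
    refine mul_le_mul_of_nonneg_left ?_ (by positivity)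
    nlinarith [sq_nonneg ‖u‖]
  have hc2 : |c - h 0| ≤ 2 * K ^ 2 * √γ * M := by
    rw [hcsub, ← Real.norm_eq_abs]
    refine (norm_integral_le_of_norm_le (hμ.integrable_poly.const_mul (2 * K ^ 2 * √γ))
      (.of_forall fun u => (hlip u 0).trans ?_)).trans_eq (integral_const_mul _ _)
    refine mul_le_mul_of_nonneg_left ?_ (by positivity)
    rw [sub_zero]
    nlinarith [sq_nonneg ‖u‖, sq_nonneg (‖u‖ - 1)]
  rcases le_or_gt (|t| * √γ) 1 with ht | ht
  · have hb1 : ∀ u, |h u - c| ≤ C0 * γ * (‖u‖ ^ 2 + 1) := by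
      intro u
      have h1 : |h u - c| ≤ |h u - h 0| + |c - h 0| := by
        rw [abs_sub_comm c]; exact _root_.abs_sub_le _ _ _
      have h2 := hquad u
      have e : C0 * γ * (‖u‖ ^ 2 + 1) = K ^ 3 * γ * ‖u‖ ^ 2 + K ^ 3 * γ * M +
        (K ^ 3 * γ * ‖u‖ ^ 2 * (1 + 2 * M) + K ^ 3 * γ * (2 + M)) := by rw [hC0]; ring
      have h3 : 0 ≤ K ^ 3 * γ * ‖u‖ ^ 2 * (1 + 2 * M) + K ^ 3 * γ * (2 + M) := by positivity
      linarith
    have hb2 : ∀ u, |t * (h u - c)| ≤ C0 * (‖u‖ + 1) := by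
      intro u
      have h1 : |h u - c| ≤ |h u - h 0| + |c - h 0| := by
        rw [abs_sub_comm c]; exact _root_.abs_sub_le _ _ _
      have h2 := hlip u 0
      rw [sub_zero] at h2
      have hK23 : K ^ 2 ≤ K ^ 3 := pow_le_pow_right₀ hK (by norm_num)
      have h4 : |h u - c| ≤ √γ * (C0 * (‖u‖ + 1)) := by
        have e : √γ * (C0 * (‖u‖ + 1)) = 2 * K ^ 3 * √γ * ‖u‖ + 2 * K ^ 3 * √γ * M +
          (2 * K ^ 3 * √γ * ‖u‖ * M + 2 * K ^ 3 * √γ) := by rw [hC0]; ring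
        have h5 : 0 ≤ 2 * K ^ 3 * √γ * ‖u‖ * M + 2 * K ^ 3 * √γ := by positivity
        have h6 : 2 * K ^ 2 * √γ * ‖u‖ ≤ 2 * K ^ 3 * √γ * ‖u‖ := by gcongr
        have h7 : 2 * K ^ 2 * √γ * M ≤ 2 * K ^ 3 * √γ * M := by gcongr
        linarith
      rw [abs_mul]
      calc |t| * |h u - c| ≤ |t| * (√γ * (C0 * (‖u‖ + 1))) :=
            mul_le_mul_of_nonneg_left h4 (abs_nonneg t)
        _ = (|t| * √γ) * (C0 * (‖u‖ + 1)) := by ring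
        _ ≤ 1 * (C0 * (‖u‖ + 1)) := mul_le_mul_of_nonneg_right ht (by positivity)
        _ = _ := one_mul _
    have hpt : ∀ u, Real.exp (t * (h u - c)) ≤ 1 + t * (h u - c) +
        t ^ 2 * γ ^ 2 * C0 ^ 2 * ((‖u‖ ^ 2 + 1) ^ 2 * Real.exp (C0 * (‖u‖ + 1))) := by
      intro u
      have h1 : Real.exp (t * (h u - c)) ≤ 1 + t * (h u - c) +
          |t * (h u - c)| ^ 2 * Real.exp |t * (h u - c)| := by
        have := exp_le_quadratic_exp (t * (h u - c))
        rwa [sq_abs]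
      have h2 : |t * (h u - c)| ^ 2 ≤ t ^ 2 * γ ^ 2 * C0 ^ 2 * (‖u‖ ^ 2 + 1) ^ 2 := by
        have h3 : |t * (h u - c)| ≤ |t| * (C0 * γ * (‖u‖ ^ 2 + 1)) := by
          rw [abs_mul]; exact mul_le_mul_of_nonneg_left (hb1 u) (abs_nonneg t)
        calc |t * (h u - c)| ^ 2 ≤ (|t| * (C0 * γ * (‖u‖ ^ 2 + 1))) ^ 2 := by gcongr
          _ = |t| ^ 2 * γ ^ 2 * C0 ^ 2 * (‖u‖ ^ 2 + 1) ^ 2 := by ring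
          _ = _ := by rw [sq_abs]
      have h3 := mul_le_mul h2 (Real.exp_le_exp.2 (hb2 u)) (Real.exp_pos _).le (by positivity)
      rw [mul_assoc (t ^ 2 * γ ^ 2 * C0 ^ 2)] at h3
      linarith
    have i1 : Integrable (fun u => 1 + t * (h u - c)) μ :=
      (integrable_const _).add ((hint.sub (integrable_const _)).const_mul t)
    have i2 : Integrable (fun u : Vec r => t ^ 2 * γ ^ 2 * C0 ^ 2 *
        ((‖u‖ ^ 2 + 1) ^ 2 * Real.exp (C0 * (‖u‖ + 1)))) μ :=
      (hμ.integrable_poly_mul_exp C0).const_mul _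
    have iexp : Integrable (fun u => Real.exp (t * (h u - c))) μ :=
      (i1.add i2).mono' (by fun_prop) (.of_forall fun u => by
        rw [Real.norm_eq_abs, Real.abs_exp]; exact hpt u)
    rw [expInt_eq_ofReal_integral iexp]
    refine ENNReal.ofReal_le_ofReal ((integral_mono iexp (i1.add i2) hpt).trans ?_)
    have i3 : Integrable (fun u => t * (h u - c)) μ :=
      (hint.sub (integrable_const _)).const_mul t
    have e : ∫ u, (1 + t * (h u - c) + t ^ 2 * γ ^ 2 * C0 ^ 2 *
        ((‖u‖ ^ 2 + 1) ^ 2 * Real.exp (C0 * (‖u‖ + 1)))) ∂μ =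
        1 + t ^ 2 * γ ^ 2 * C0 ^ 2 * M2 := by
      rw [integral_add i1 i2, integral_add (integrable_const _) i3, integral_const_mul,
        integral_const_mul, integral_sub hint (integrable_const _)]
      simp [hc, hM2]
    refine e.le.trans ?_
    have h1 : C0 ^ 2 * M2 * (γ ^ 2 * t ^ 2) ≤
        (C0 ^ 2 * M2 + 2 * K ^ 4) * (γ ^ 2 * t ^ 2 + γ ^ 2 * t ^ 4) := by
      gcongr
      · have : 0 ≤ 2 * K ^ 4 := by positivity
        linarith
      · have : 0 ≤ γ ^ 2 * t ^ 4 := by positivity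
        linarith
    have h2 := Real.add_one_le_exp
      ((C0 ^ 2 * M2 + 2 * K ^ 4) * (γ ^ 2 * t ^ 2 + γ ^ 2 * t ^ 4))
    linarith
  · refine (hμ.expInt_lipschitz_le (by positivity) hlip t).trans
      (ENNReal.ofReal_le_ofReal (Real.exp_le_exp.2 ?_))
    have h1 : 1 ≤ t ^ 2 * γ := by
      have : 1 ≤ (|t| * √γ) ^ 2 := one_le_pow₀ ht.le
      rwa [mul_pow, sq_abs, hsq] at this
    calc t ^ 2 * (2 * K ^ 2 * √γ) ^ 2 / 2 = 2 * K ^ 4 * t ^ 2 * √γ ^ 2 := by ring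
      _ = 2 * K ^ 4 * (t ^ 2 * γ) * 1 := by rw [hsq]; ring
      _ ≤ 2 * K ^ 4 * (t ^ 2 * γ) * (t ^ 2 * γ) := by gcongr
      _ = 2 * K ^ 4 * (γ ^ 2 * t ^ 4) := by ring
      _ ≤ (C0 ^ 2 * M2 + 2 * K ^ 4) * (γ ^ 2 * t ^ 2 + γ ^ 2 * t ^ 4) := by
        gcongr
        · have : 0 ≤ C0 ^ 2 * M2 := by positivity
          linarith
        · have : 0 ≤ γ ^ 2 * t ^ 2 := by positivity
          linarith

lemma norm_adjoint_apply_le (x z : Vec d) :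
    ‖ContinuousLinearMap.adjoint (σ x) z‖ ≤ K * ‖z‖ := by
  refine ((ContinuousLinearMap.adjoint (σ x)).le_opNorm z).trans ?_
  rw [LinearIsometryEquiv.norm_map]
  exact mul_le_mul_of_nonneg_right ((opNorm_le_frob _).trans (hf.diffusion x)) (norm_nonneg z)

lemma norm_adjoint_gradient_sq_le {γ : ℝ} (hγ : 0 ≤ γ) (x : Vec d) :
    ‖ContinuousLinearMap.adjoint (σ x) (∇ f (x + γ • b x))‖ ^ 2 ≤
      carre σ f x + 2 * K ^ 5 * γ * √(V x) := by
  have hK := hf.one_le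
  set a := ContinuousLinearMap.adjoint (σ x) (∇ f (x + γ • b x)) with ha
  set c := ContinuousLinearMap.adjoint (σ x) (∇ f x) with hc
  have h1 : ‖a‖ ≤ K * K := (hf.norm_adjoint_apply_le x _).trans
    (mul_le_mul_of_nonneg_left (hf.grad _) (by linarith))
  have h2 : ‖c‖ ≤ K * K := (hf.norm_adjoint_apply_le x _).trans
    (mul_le_mul_of_nonneg_left (hf.grad _) (by linarith))
  have h3 : ‖a - c‖ ≤ K * (K * (γ * (K * √(V x)))) := by
    rw [ha, hc, ← map_sub]
    refine (hf.norm_adjoint_apply_le x _).trans (mul_le_mul_of_nonneg_left ?_ (by linarith))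
    refine (norm_gradient_sub_le hf.contDiff_two hf.hess _ _).trans
      (mul_le_mul_of_nonneg_left ?_ (by linarith))
    rw [add_sub_cancel_left, norm_smul, Real.norm_eq_abs, abs_of_nonneg hγ]
    exact mul_le_mul_of_nonneg_left (hf.drift_growth x) hγ
  have h4 : ‖a‖ - ‖c‖ ≤ ‖a - c‖ := norm_sub_norm_le a c
  have h5 : ‖a‖ ^ 2 - ‖c‖ ^ 2 ≤ ‖a - c‖ * (2 * K ^ 2) := by
    calc ‖a‖ ^ 2 - ‖c‖ ^ 2 = (‖a‖ - ‖c‖) * (‖a‖ + ‖c‖) := by ring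
      _ ≤ ‖a - c‖ * (‖a‖ + ‖c‖) := mul_le_mul_of_nonneg_right h4 (by positivity)
      _ ≤ ‖a - c‖ * (2 * K ^ 2) :=
        mul_le_mul_of_nonneg_left (by linarith [sq K]) (norm_nonneg _)
  have h6 : ‖a - c‖ * (2 * K ^ 2) ≤ K * (K * (γ * (K * √(V x)))) * (2 * K ^ 2) :=
    mul_le_mul_of_nonneg_right h3 (by positivity)
  have h7 : carre σ f x = ‖c‖ ^ 2 := rfl
  rw [h7]
  linarith

/-- The sharp bound for one martingale increment: up to a factor `p > 1` close to one and terms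
of order `γ²`, its variance proxy is `γ |σ*∇f|²` at the current position. -/
lemma exists_expInt_increment_sharp_le {μ : Measure (Vec r)} (hμ : GaussianLike μ) {p : ℝ}
    (hp : 1 < p) : ∃ C ≥ 0, ∀ γ > 0, ∀ (x : Vec d) (l : ℝ),
      expInt μ (fun u => l * (f (eulerStep b σ γ x u) - stepMean b σ μ γ f x)) ≤
      ENNReal.ofReal (Real.exp (p * l ^ 2 / 2 * (γ * carre σ f x) +
        C * (l ^ 2 * (γ ^ 2 * √(V x)) + l ^ 4 * γ ^ 2))) := by
  have := hμ.prob
  have hK := hf.one_le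
  have hcont := hf.contDiff.continuous
  obtain ⟨C, hC, hrem⟩ := hf.exists_expInt_remainder_le hμ
  have hp1 : 0 < p - 1 := by linarith
  set q := p / (p - 1) with hq
  have hq0 : 0 ≤ q := by positivity
  refine ⟨p * K ^ 5 + C * (q ^ 2 + q ^ 4) * K, by positivity, fun γ hγ x l => ?_⟩
  set y := x + γ • b x with hy
  set A : Vec r →L[ℝ] Vec d := √γ • σ x with hA
  have hV := Real.sqrt_nonneg (V x)
  set g : Vec r → ℝ := fun u => fderiv ℝ f y (A u) with hg
  set h : Vec r → ℝ := fun u => f (y + A u) - fderiv ℝ f y (A u) with hh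
  have hg0 : ∫ u, g u ∂μ = 0 := hμ.integral_linear ((fderiv ℝ f y).comp A)
  have hgi : Integrable g μ := hμ.integrable_lipschitz ((fderiv ℝ f y).comp A).lipschitz
  have hgc : Continuous g := by simp only [hg]; fun_prop
  have hhc : Continuous h := by simp only [hh]; fun_prop
  set w := ContinuousLinearMap.adjoint (σ x) (∇ f y) with hw
  have hgw : ∀ u, g u = √γ * ⟪w, u⟫_ℝ := fun u => by
    simp only [hg, hA, hw]
    rw [ContinuousLinearMap.adjoint_inner_left, inner_gradient_left]
    simp
  have hglip : ∀ u v, |g u - g v| ≤ √γ * ‖w‖ * ‖u - v‖ := fun u v => by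
    rw [hgw, hgw, ← mul_sub, ← inner_sub_right, abs_mul, abs_of_nonneg (Real.sqrt_nonneg γ),
      mul_assoc]
    exact mul_le_mul_of_nonneg_left (abs_real_inner_le_norm _ _) (Real.sqrt_nonneg γ)
  have hG : expInt μ (fun u => p * (l * g u)) ≤
      ENNReal.ofReal (Real.exp ((p * l) ^ 2 * (√γ * ‖w‖) ^ 2 / 2)) := by
    have := hμ.expInt_lipschitz_le (by positivity) hglip (p * l)
    rw [hg0] at this
    convert this using 3
    ring
  have hH : expInt μ (fun u => q * (l * (h u - ∫ v, h v ∂μ))) ≤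
      ENNReal.ofReal (Real.exp (C * (γ ^ 2 * (q * l) ^ 2 + γ ^ 2 * (q * l) ^ 4))) := by
    have := hrem γ hγ x y (q * l)
    simp_rw [mul_assoc] at this
    exact this
  have hfull := expInt_add_le (μ := μ) (f := fun u => l * g u)
    (g := fun u => l * (h u - ∫ v, h v ∂μ)) (by fun_prop) (by fun_prop) hp hG hH
  have hhi : Integrable (fun u => f (y + A u)) μ := by
    have hlip := hf.abs_step_sub_le γ x
    have hs1 : 0 ≤ supGrad f := Real.iSup_nonneg fun x => norm_nonneg _
    have hs2 : 0 ≤ supFrob σ := Real.iSup_nonneg fun x => Real.sqrt_nonneg _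
    exact hμ.integrable_lipschitz (L := (supFrob σ * supGrad f * √γ).toNNReal)
      (LipschitzWith.of_dist_le_mul fun u w => by
        rw [Real.dist_eq, dist_eq_norm, Real.coe_toNNReal _ (by positivity)]; exact hlip u w)
  have emean : stepMean b σ μ γ f x = ∫ v, h v ∂μ := by
    have : ∫ v, h v ∂μ = ∫ v, f (y + A v) ∂μ - ∫ v, g v ∂μ := integral_sub hhi hgi
    rw [this, hg0, sub_zero]
    rfl
  have e1 : (fun u => l * (f (eulerStep b σ γ x u) - stepMean b σ μ γ f x)) =
      fun u => l * g u + l * (h u - ∫ v, h v ∂μ) := by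
    funext u
    have : f (eulerStep b σ γ x u) = g u + h u := by
      simp only [hh, hg, add_sub_cancel]; rfl
    rw [emean, this]; ring
  rw [e1]
  refine hfull.trans (ENNReal.ofReal_le_ofReal (Real.exp_le_exp.2 ?_))
  have hw2 := hf.norm_adjoint_gradient_sq_le hγ.le x
  rw [← hy, ← hw] at hw2
  have hsq : √γ ^ 2 = γ := Real.sq_sqrt hγ.le
  have t1 : (p * l) ^ 2 * (√γ * ‖w‖) ^ 2 / 2 / p ≤
      p * l ^ 2 / 2 * (γ * carre σ f x) + p * K ^ 5 * (l ^ 2 * (γ ^ 2 * √(V x))) := by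
    calc (p * l) ^ 2 * (√γ * ‖w‖) ^ 2 / 2 / p = p * l ^ 2 / 2 * γ * ‖w‖ ^ 2 := by
          rw [mul_pow √γ, hsq]; field_simp
      _ ≤ p * l ^ 2 / 2 * γ * (carre σ f x + 2 * K ^ 5 * γ * √(V x)) :=
          mul_le_mul_of_nonneg_left hw2 (by positivity)
      _ = _ := by ring
  have t2 : C * (γ ^ 2 * (q * l) ^ 2 + γ ^ 2 * (q * l) ^ 4) * ((p - 1) / p) ≤
      C * (q ^ 2 + q ^ 4) * K * (l ^ 2 * (γ ^ 2 * √(V x)) + l ^ 4 * γ ^ 2) := by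
    have h1 : (p - 1) / p ≤ 1 := by rw [div_le_one (by linarith)]; linarith
    have h2 : C * (γ ^ 2 * (q * l) ^ 2 + γ ^ 2 * (q * l) ^ 4) * ((p - 1) / p) ≤
        C * (γ ^ 2 * (q * l) ^ 2 + γ ^ 2 * (q * l) ^ 4) :=
      mul_le_of_le_one_right (by positivity) h1
    refine h2.trans ?_
    have h3 : γ ^ 2 * (q * l) ^ 2 + γ ^ 2 * (q * l) ^ 4 ≤
        (q ^ 2 + q ^ 4) * (l ^ 2 * γ ^ 2 + l ^ 4 * γ ^ 2) := by
      have : 0 ≤ q ^ 2 * (l ^ 4 * γ ^ 2) + q ^ 4 * (l ^ 2 * γ ^ 2) := by positivity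
      nlinarith
    have h4 : l ^ 2 * γ ^ 2 + l ^ 4 * γ ^ 2 ≤
        K * (l ^ 2 * (γ ^ 2 * √(V x)) + l ^ 4 * γ ^ 2) := by
      have h5 : l ^ 2 * γ ^ 2 * 1 ≤ l ^ 2 * γ ^ 2 * (K * √(V x)) :=
        mul_le_mul_of_nonneg_left (hf.one_le_sqrt x) (by positivity)
      have h6 : l ^ 4 * γ ^ 2 * 1 ≤ l ^ 4 * γ ^ 2 * K :=
        mul_le_mul_of_nonneg_left hK (by positivity)
      linarith
    calc _ ≤ C * ((q ^ 2 + q ^ 4) * (l ^ 2 * γ ^ 2 + l ^ 4 * γ ^ 2)) :=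
          mul_le_mul_of_nonneg_left h3 hC
      _ ≤ C * ((q ^ 2 + q ^ 4) * (K * (l ^ 2 * (γ ^ 2 * √(V x)) + l ^ 4 * γ ^ 2))) := by
          gcongr
      _ = _ := by ring
  have t3 : 0 ≤ p * K ^ 5 * (l ^ 4 * γ ^ 2) := by positivity
  linarith

end StepBounds

/-! ### Independence of the past -/

section Independence

variable {Ω : Type*} [MeasurableSpace Ω] {P : Measure Ω} [IsProbabilityMeasure P]

/-- If `X` is independent of `(A, B)` and `A` of `B`, then `(X, A)` is independent of `B`. -/
lemma IndepFun.prodMk_left_of_prodMk_right {α β δ : Type*} [MeasurableSpace α]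
    [MeasurableSpace β] [MeasurableSpace δ] {X : Ω → α} {A : Ω → β} {B : Ω → δ}
    (hX : Measurable X) (hA : Measurable A) (hB : Measurable B)
    (h1 : IndepFun X (fun ω => (A ω, B ω)) P) (h2 : IndepFun A B P) :
    IndepFun (fun ω => (X ω, A ω)) B P := by
  have := Measure.isProbabilityMeasure_map (μ := P) hX.aemeasurable
  have := Measure.isProbabilityMeasure_map (μ := P) hA.aemeasurable
  have := Measure.isProbabilityMeasure_map (μ := P) hB.aemeasurable
  have hXA : IndepFun X A P := h1.comp (φ := id) (ψ := Prod.fst) measurable_id measurable_fst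
  rw [indepFun_iff_map_prod_eq_prod_map_map (by fun_prop) (by fun_prop)] at h1 h2 hXA ⊢
  refine MeasurableEquiv.prodAssoc.map_measurableEquiv_injective ?_
  rw [hXA, Measure.prodAssoc_prod, ← h2, ← h1, Measure.map_map (by fun_prop) (by fun_prop)]
  rfl

lemma lintegral_of_indepFun {α β : Type*} [MeasurableSpace α] [MeasurableSpace β] {H : Ω → α}
    {B : Ω → β} (hH : Measurable H) (hB : Measurable B) (h : IndepFun H B P)
    {F : α × β → ENNReal} (hF : Measurable F) :
    ∫⁻ ω, F (H ω, B ω) ∂P = ∫⁻ ω, ∫⁻ u, F (H ω, u) ∂(P.map B) ∂P := by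
  have := Measure.isProbabilityMeasure_map (μ := P) hB.aemeasurable
  have := Measure.isProbabilityMeasure_map (μ := P) hH.aemeasurable
  rw [← lintegral_map (g := fun ω => (H ω, B ω)) hF (by fun_prop),
    (indepFun_iff_map_prod_eq_prod_map_map hH.aemeasurable hB.aemeasurable).1 h,
    lintegral_prod _ hF.aemeasurable, lintegral_map hF.lintegral_prod_right' hH]

end Independence

section Scheme

variable {d r : ℕ} {b : Vec d → Vec d} {σ : Vec d → Vec r →L[ℝ] Vec d} {γ : ℕ → ℝ}
  {Ω : Type*} {X₀ : Ω → Vec d} {U : ℕ → Ω → Vec r}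

/-- The σ-algebra generated by the initial condition and the first `n` innovations. -/
abbrev past (X₀ : Ω → Vec d) (U : ℕ → Ω → Vec r) (n : ℕ) : MeasurableSpace Ω :=
  MeasurableSpace.comap (fun ω => (X₀ ω, fun k : Finset.range n => U (k + 1) ω)) inferInstance

lemma scheme_succ (n : ℕ) (ω : Ω) : scheme b σ γ X₀ U (n + 1) ω =
    eulerStep b σ (γ (n + 1)) (scheme b σ γ X₀ U n ω) (U (n + 1) ω) := rfl

lemma measurable_start_past (n : ℕ) : Measurable[past X₀ U n] X₀ :=
  measurable_fst.comp (comap_measurable _)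

lemma measurable_innovation_past {k n : ℕ} (h : k < n) : Measurable[past X₀ U n] (U (k + 1)) :=
  (measurable_pi_apply (⟨k, Finset.mem_range.2 h⟩ : Finset.range n)).comp
    (measurable_snd.comp
      (comap_measurable (fun ω => (X₀ ω, fun k : Finset.range n => U (k + 1) ω))))

lemma continuous_eulerStep (hb : Continuous b) (hσ : Continuous σ) (g : ℝ) :
    Continuous fun p : Vec d × Vec r => eulerStep b σ g p.1 p.2 := by
  unfold eulerStep
  fun_prop

lemma measurable_scheme_past (hb : Continuous b) (hσ : Continuous σ) {k n : ℕ} (h : k ≤ n) :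
    Measurable[past X₀ U n] (scheme b σ γ X₀ U k) := by
  induction k with
  | zero => exact measurable_start_past n
  | succ k ih =>
    have h1 := ih (by omega)
    have h2 : Measurable[past X₀ U n] (U (k + 1)) := measurable_innovation_past (by omega)
    exact (continuous_eulerStep hb hσ (γ (k + 1))).measurable.comp (h1.prodMk h2)

variable [mΩ : MeasurableSpace Ω] {P : Measure Ω}

lemma past_le (hX₀ : Measurable X₀) (hU : GaussianConcentration P X₀ U) (n : ℕ) :
    past X₀ U n ≤ mΩ :=
  (hX₀.prodMk (measurable_pi_lambda _ fun k : Finset.range n => hU.meas k)).comap_le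

variable [IsProbabilityMeasure P]

lemma indep_past (hX₀ : Measurable X₀) (hU : GaussianConcentration P X₀ U) (n : ℕ) :
    Indep (past X₀ U n) (MeasurableSpace.comap (U (n + 1)) inferInstance) P := by
  have h1 : IndepFun (fun ω (k : Finset.range n) => U (k + 1) ω) (U (n + 1)) P := by
    have := hU.indep.indepFun_finset (Finset.range n) {n} (by simp) hU.meas
    exact this.comp (φ := id) (ψ := fun g : ({n} : Finset ℕ) → Vec r => g ⟨n, by simp⟩)
      measurable_id (measurable_pi_apply _)
  have h2 : IndepFun X₀ (fun ω => ((fun k : Finset.range n => U (k + 1) ω), U (n + 1) ω)) P :=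
    hU.indep_start.comp (φ := id)
      (ψ := fun g : ℕ → Vec r => ((fun k : Finset.range n => g k), g n))
      measurable_id (by fun_prop)
  exact IndepFun.prodMk_left_of_prodMk_right hX₀ (measurable_pi_lambda _ fun k => hU.meas k)
    (hU.meas n) h2 h1

lemma GaussianConcentration.gaussianLike (hU : GaussianConcentration P X₀ U) :
    GaussianLike (P.map (U 1)) := by
  have h1 : AEMeasurable (U 1) P := (hU.meas 0).aemeasurable
  refine ⟨Measure.isProbabilityMeasure_map h1, fun i => ?_, fun i j => ?_, fun i j k => ?_,
    fun g hg l hl => ?_⟩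
  · rw [integral_map h1 (by fun_prop)]; exact hU.moment_one i
  · rw [integral_map h1 (by fun_prop)]; exact hU.moment_two i j
  · rw [integral_map h1 (by fun_prop)]; exact hU.moment_three i j k
  · have hc := hg.continuous
    have h2 := hU.concentration g hg l hl
    rw [integrable_map_measure (by fun_prop) h1, integral_map h1 (by fun_prop),
      integral_map h1 (by fun_prop)]
    exact h2

/-- Conditioning on the past: the innovation may be integrated out first. -/
lemma lintegral_condition_past (hX₀ : Measurable X₀) (hU : GaussianConcentration P X₀ U) (n : ℕ)
    {α : Type*} [MeasurableSpace α] {H : Ω → α} (hH : Measurable[past X₀ U n] H)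
    {F : α × Vec r → ENNReal} (hF : Measurable F) :
    ∫⁻ ω, F (H ω, U (n + 1) ω) ∂P = ∫⁻ ω, ∫⁻ u, F (H ω, u) ∂(P.map (U 1)) ∂P := by
  have h1 : IndepFun H (U (n + 1)) P :=
    indep_of_indep_of_le_left (indep_past hX₀ hU n) hH.comap_le
  rw [lintegral_of_indepFun (hH.mono (past_le hX₀ hU n) le_rfl) (hU.meas n) h1 hF,
    (hU.ident n).map_eq]

/-- The exponential supermartingale: if every increment `ψ k x` has exponential integral at most
one under the law of the innovation, then so has the sum of the increments along the scheme. -/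
lemma expInt_sum_increments_le_one (hb : Continuous b) (hσ : Continuous σ) (hX₀ : Measurable X₀)
    (hU : GaussianConcentration P X₀ U) {ψ : ℕ → Vec d × Vec r → ℝ} (hψ : ∀ k, Measurable (ψ k))
    (h : ∀ k x, expInt (P.map (U 1)) (fun u => ψ k (x, u)) ≤ 1) (n : ℕ) :
    expInt P (fun ω => ∑ k ∈ Finset.range n, ψ k (scheme b σ γ X₀ U k ω, U (k + 1) ω)) ≤ 1 := by
  induction n with
  | zero => simp [expInt]
  | succ n ih =>
    set Z : Ω → ℝ := fun ω =>
      ∑ k ∈ Finset.range n, ψ k (scheme b σ γ X₀ U k ω, U (k + 1) ω) with hZ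
    have hZm : Measurable[past X₀ U n] Z := by
      refine Finset.measurable_sum _ fun k hk => ?_
      rw [Finset.mem_range] at hk
      exact (hψ k).comp ((measurable_scheme_past hb hσ hk.le).prodMk
        (measurable_innovation_past hk))
    have hHm : Measurable[past X₀ U n] (fun ω => (Z ω, scheme b σ γ X₀ U n ω)) :=
      hZm.prodMk (measurable_scheme_past hb hσ le_rfl)
    have key := lintegral_condition_past hX₀ hU n hHm
      (F := fun p => ENNReal.ofReal (Real.exp (p.1.1 + ψ n (p.1.2, p.2))))
      (by have := hψ n; fun_prop)
    simp only at key
    calc expInt P (fun ω =>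
          ∑ k ∈ Finset.range (n + 1), ψ k (scheme b σ γ X₀ U k ω, U (k + 1) ω))
        = ∫⁻ ω, ∫⁻ u, ENNReal.ofReal
            (Real.exp (Z ω + ψ n (scheme b σ γ X₀ U n ω, u))) ∂(P.map (U 1)) ∂P := by
          rw [← key]
          simp only [expInt, Finset.sum_range_succ, hZ]
      _ ≤ ∫⁻ ω, ENNReal.ofReal (Real.exp (Z ω)) ∂P := by
          refine lintegral_mono fun ω => ?_
          have h1 := h n (scheme b σ γ X₀ U n ω)
          have h2 := expInt_add_const (μ := P.map (U 1))
            (fun u => ψ n (scheme b σ γ X₀ U n ω, u)) (Z ω)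
          simp only [add_comm _ (Z ω)] at h2
          change expInt _ _ ≤ _
          rw [h2]
          exact mul_le_of_le_one_left' h1
      _ ≤ 1 := ih

end Scheme

/-! ### Exponential moments of the Lyapunov function -/

section Lyapunov

variable {d r : ℕ} {b : Vec d → Vec d} {σ : Vec d → Vec r →L[ℝ] Vec d} {V : Vec d → ℝ}
  {CV αV βV : ℝ}

/-- The Lyapunov function contracts in one step, at the level of exponential moments. -/
lemma exists_expInt_lyapunov_step {μ : Measure (Vec r)} (hμ : GaussianLike μ)
    (hV : IsLyapunov b σ V CV αV βV) {ks : ℝ} (hks : 0 < ks) (hσ : ∀ x, frobSq (σ x) ≤ ks)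
    {g : ℝ} (hg : 0 < g) : ∃ κ₀ > 0, ∃ α > 0, α * g ≤ 1 ∧ ∀ κ > 0, κ ≤ κ₀ → ∃ c ≥ 0,
      ∀ γ > 0, γ ≤ g → γ * (2 * CV * ⨆ x, ‖iteratedFDeriv ℝ 2 V x‖) ≤ αV → ∀ x,
        expInt μ (fun u => κ * V (eulerStep b σ γ x u)) ≤
          ENNReal.ofReal (Real.exp ((1 - α * γ) * (κ * V x) + c * γ)) := by
  have := hμ.prob
  obtain ⟨v, hv, hVv⟩ := hV.lower
  obtain ⟨KV, hKV⟩ := hV.hess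
  have hbdd : BddAbove (range fun x => ‖iteratedFDeriv ℝ 2 V x‖) :=
    ⟨KV, by rintro _ ⟨x, rfl⟩; exact hKV x⟩
  set Kh := ⨆ x, ‖iteratedFDeriv ℝ 2 V x‖ with hKh
  have hKh0 : 0 ≤ Kh := Real.iSup_nonneg fun x => norm_nonneg _
  have hKhle : ∀ x, ‖iteratedFDeriv ℝ 2 V x‖ ≤ Kh := fun x => le_ciSup hbdd x
  have hVc : Continuous V := hV.contDiff.continuous
  obtain ⟨a8, ha80, ha8⟩ : ∃ a8 ≥ 0, expInt μ (fun u => ‖u‖ ^ 2 / 8) ≤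
      ENNReal.ofReal (Real.exp a8) := by
    refine ⟨(expInt μ (fun u => ‖u‖ ^ 2 / 8)).toReal, ENNReal.toReal_nonneg, ?_⟩
    rw [← ENNReal.ofReal_toReal hμ.expInt_sq_lt_top.ne]
    simp only [ENNReal.toReal_ofReal ENNReal.toReal_nonneg]
    refine ENNReal.ofReal_le_ofReal ?_
    linarith [Real.add_one_le_exp (expInt μ (fun u => ‖u‖ ^ 2 / 8)).toReal]
  have hCV := hV.CV_pos
  have hα := hV.αV_pos
  refine ⟨min (αV / (8 * ks * CV)) (1 / (48 * (Kh + 1) * ks * g)), by positivity,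
    min (αV / 8) (1 / g), by positivity, ?_, fun κ hκ hκle => ?_⟩
  · calc min (αV / 8) (1 / g) * g ≤ 1 / g * g := by gcongr; exact min_le_right _ _
      _ = 1 := by field_simp
  have hκ1 : κ * (ks * CV) ≤ αV / 8 := by
    have := hκle.trans (min_le_left _ _)
    rw [le_div_iff₀ (by positivity)] at this
    linarith
  have hκ2 : κ * (48 * (Kh + 1) * ks * g) ≤ 1 := by
    have := hκle.trans (min_le_right _ _)
    rwa [le_div_iff₀ (by positivity)] at this
  set η := 6 * κ * Kh * ks with hη
  have hη0 : 0 ≤ η := by positivity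
  have hβ0 := hV.βV_nonneg
  set c1 := βV + 1 / 2 * (Kh * ks) with hc1
  have hc10 : 0 ≤ c1 := by positivity
  refine ⟨κ * c1 + 4 * η * a8, by positivity, fun γ hγ hγg hγs x => ?_⟩
  have hVx : 0 < V x := hv.trans_le (hVv x)
  set w := ContinuousLinearMap.adjoint (σ x) (∇ V x) with hw
  have hsγ : √γ ^ 2 = γ := Real.sq_sqrt hγ.le
  have hgrow := hV.growth x
  have hnw : ‖w‖ ^ 2 ≤ ks * (CV * V x) := by
    have h1 : ‖w‖ ≤ √(frobSq (σ x)) * ‖∇ V x‖ := by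
      refine ((ContinuousLinearMap.adjoint (σ x)).le_opNorm _).trans ?_
      rw [LinearIsometryEquiv.norm_map]
      exact mul_le_mul_of_nonneg_right (opNorm_le_frob _) (norm_nonneg _)
    calc ‖w‖ ^ 2 ≤ (√(frobSq (σ x)) * ‖∇ V x‖) ^ 2 := by gcongr
      _ = frobSq (σ x) * ‖∇ V x‖ ^ 2 := by rw [mul_pow, Real.sq_sqrt (frobSq_nonneg _)]
      _ ≤ ks * (CV * V x) :=
        mul_le_mul (hσ x) (by nlinarith [sq_nonneg ‖b x‖]) (by positivity) hks.le
  -- the first order part of the drift, through the generator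
  have hdrift : ⟪b x, ∇ V x⟫_ℝ ≤ -αV * V x + c1 := by
    have h1 := hV.drift x
    have h2 : |∑ j : Fin r, iteratedFDeriv ℝ 2 V x ![σ x (EuclideanSpace.single j 1),
        σ x (EuclideanSpace.single j 1)]| ≤ Kh * ks := by
      calc _ ≤ ∑ j : Fin r, Kh * ‖σ x (EuclideanSpace.single j 1)‖ ^ 2 := by
            refine (Finset.abs_sum_le_sum_abs _ _).trans (Finset.sum_le_sum fun j _ => ?_)
            have := (iteratedFDeriv ℝ 2 V x).le_opNorm ![σ x (EuclideanSpace.single j 1),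
              σ x (EuclideanSpace.single j 1)]
            simp only [Fin.prod_univ_two, Matrix.cons_val_zero, Matrix.cons_val_one,
              Real.norm_eq_abs] at this
            rw [sq]
            exact this.trans (mul_le_mul_of_nonneg_right (hKhle x) (by positivity))
        _ = Kh * frobSq (σ x) := by rw [← Finset.mul_sum]; rfl
        _ ≤ Kh * ks := mul_le_mul_of_nonneg_left (hσ x) hKh0
    have h3 := neg_le_of_abs_le h2
    rw [gen] at h1
    linarith
  have hpt : ∀ u, κ * V (eulerStep b σ γ x u) ≤
      (κ * (√γ * ⟪w, u⟫_ℝ) + κ * (3 * Kh * ks * γ * ‖u‖ ^ 2)) +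
        (κ * (V x - αV / 4 * γ * V x) + κ * (c1 * γ)) := by
    intro u
    set h := γ • b x + √γ • σ x u with hh
    have h1 := le_of_abs_le (abs_taylor_one_le hV.contDiff x h hKhle)
    have e1 : fderiv ℝ V x h = γ * ⟪b x, ∇ V x⟫_ℝ + √γ * ⟪w, u⟫_ℝ := by
      rw [hw, ContinuousLinearMap.adjoint_inner_left, inner_gradient_left, real_inner_comm,
        inner_gradient_left, hh]
      simp
    have e2 : x + h = eulerStep b σ γ x u := by rw [hh, eulerStep, add_assoc]
    have h2 : ‖h‖ ^ 2 ≤ 3 / 2 * (γ ^ 2 * (CV * V x)) + 3 * (γ * (ks * ‖u‖ ^ 2)) := by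
      have n1 : ‖γ • b x‖ ^ 2 ≤ γ ^ 2 * (CV * V x) := by
        rw [norm_smul, mul_pow, Real.norm_eq_abs, sq_abs]
        exact mul_le_mul_of_nonneg_left (by nlinarith [sq_nonneg ‖∇ V x‖]) (sq_nonneg γ)
      have n2 : ‖√γ • σ x u‖ ^ 2 ≤ γ * (ks * ‖u‖ ^ 2) := by
        rw [norm_smul, mul_pow, Real.norm_eq_abs, sq_abs, hsγ]
        refine mul_le_mul_of_nonneg_left ?_ hγ.le
        calc ‖σ x u‖ ^ 2 ≤ (√(frobSq (σ x)) * ‖u‖) ^ 2 := by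
              have := norm_apply_le_frob (σ x) u
              gcongr
          _ = frobSq (σ x) * ‖u‖ ^ 2 := by rw [mul_pow, Real.sq_sqrt (frobSq_nonneg _)]
          _ ≤ _ := mul_le_mul_of_nonneg_right (hσ x) (by positivity)
      have n3 : ‖h‖ ≤ ‖γ • b x‖ + ‖√γ • σ x u‖ := norm_add_le _ _
      have n4 : ‖h‖ ^ 2 ≤ (‖γ • b x‖ + ‖√γ • σ x u‖) ^ 2 := by gcongr
      nlinarith [sq_nonneg (‖γ • b x‖ - 2 * ‖√γ • σ x u‖)]
    have h3 : Kh * ‖h‖ ^ 2 ≤ 3 / 4 * αV * γ * V x + 3 * Kh * ks * γ * ‖u‖ ^ 2 := by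
      have h4 := mul_le_mul_of_nonneg_left h2 hKh0
      have h5 : γ * (2 * CV * Kh) * (3 / 4 * γ * V x) ≤ αV * (3 / 4 * γ * V x) :=
        mul_le_mul_of_nonneg_right hγs (by positivity)
      linarith
    have h6 := mul_le_mul_of_nonneg_left hdrift hγ.le
    rw [e1, e2] at h1
    have h7 : V (eulerStep b σ γ x u) ≤ √γ * ⟪w, u⟫_ℝ + 3 * Kh * ks * γ * ‖u‖ ^ 2 +
        (V x - αV / 4 * γ * V x + c1 * γ) := by linarith
    have := mul_le_mul_of_nonneg_left h7 hκ.le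
    linarith
  refine (expInt_mono hpt).trans ?_
  have hlin : expInt μ (fun u => 2 * (κ * (√γ * ⟪w, u⟫_ℝ))) ≤
      ENNReal.ofReal (Real.exp (2 * κ ^ 2 * γ * ‖w‖ ^ 2)) := by
    have h1 := hμ.expInt_lipschitz_le (g := fun u => ⟪w, u⟫_ℝ) (norm_nonneg w)
      (fun u v => by rw [← inner_sub_right]; exact abs_real_inner_le_norm _ _) (2 * κ * √γ)
    have h0 : ∫ u, ⟪w, u⟫_ℝ ∂μ = 0 := hμ.integral_linear (innerSL ℝ w)
    rw [h0] at h1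
    convert h1 using 2
    · funext u; ring
    · congr 1
      calc 2 * κ ^ 2 * γ * ‖w‖ ^ 2 = 2 * κ ^ 2 * √γ ^ 2 * ‖w‖ ^ 2 := by rw [hsγ]
        _ = _ := by ring
  have hsq : expInt μ (fun u => 2 / (2 - 1) * (κ * (3 * Kh * ks * γ * ‖u‖ ^ 2))) ≤
      ENNReal.ofReal (Real.exp (8 * η * γ * a8)) := by
    have h1 : 8 * η * γ ≤ 1 := by
      calc 8 * η * γ ≤ 8 * η * g := by gcongr
        _ = κ * (48 * Kh * ks * g) := by rw [hη]; ring
        _ ≤ κ * (48 * (Kh + 1) * ks * g) := by gcongr; linarith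
        _ ≤ 1 := hκ2
    have h2 := expInt_mul_le (μ := μ) (w := 8 * η * γ) (by fun_prop) (by positivity) h1 ha8
    convert h2 using 2
    funext u
    rw [hη]; ring
  refine (expInt_add_const_le _ (expInt_add_le (by fun_prop) (by fun_prop) one_lt_two hlin
    hsq)).trans (ENNReal.ofReal_le_ofReal (Real.exp_le_exp.2 ?_))
  have h1 : κ ^ 2 * γ * ‖w‖ ^ 2 ≤ κ * γ * V x * (αV / 8) := by
    calc κ ^ 2 * γ * ‖w‖ ^ 2 ≤ κ ^ 2 * γ * (ks * (CV * V x)) := by gcongr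
      _ = κ * γ * V x * (κ * (ks * CV)) := by ring
      _ ≤ _ := by gcongr
  have h2 : min (αV / 8) (1 / g) * (γ * (κ * V x)) ≤ αV / 8 * (γ * (κ * V x)) :=
    mul_le_mul_of_nonneg_right (min_le_left _ _) (by positivity)
  linarith

/-- The scheme has a uniformly bounded exponential moment of the Lyapunov function. -/
lemma exists_expInt_lyapunov_le {γ : ℕ → ℝ} {Ω : Type*} [MeasurableSpace Ω] {P : Measure Ω}
    [IsProbabilityMeasure P] {X₀ : Ω → Vec d} {U : ℕ → Ω → Vec r}
    (hb : Continuous b) (hσc : Continuous σ) (hV : IsLyapunov b σ V CV αV βV)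
    (hσ : ∃ κ > 0, ∀ x, frobSq (σ x) ≤ κ) (hγpos : ∀ k ≥ 1, 0 < γ k) (hγle : ∀ k ≥ 1, γ k ≤ γ 1)
    (hγs : SmallSteps γ V CV αV) (hX₀ : Measurable X₀) (hX₀s : SubGaussianStart P X₀)
    (hU : GaussianConcentration P X₀ U) : ∃ κ > 0, ∃ a ≥ 0, ∀ n,
      expInt P (fun ω => κ * V (scheme b σ γ X₀ U n ω)) ≤ ENNReal.ofReal (Real.exp a) := by
  have hμ := hU.gaussianLike
  obtain ⟨ks, hks, hσ⟩ := hσ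
  obtain ⟨κ₀, hκ₀, α, hα, hαg, hstep⟩ :=
    exists_expInt_lyapunov_step hμ hV hks hσ (hγpos 1 le_rfl)
  obtain ⟨v, hv, hVv⟩ := hV.lower
  obtain ⟨KV, hKV⟩ := hV.hess
  have hVc : Continuous V := hV.contDiff.continuous
  have hKV0 : 0 ≤ KV := (norm_nonneg _).trans (hKV 0)
  -- the quadratic growth of `V`
  obtain ⟨A, B, hB, hAB⟩ : ∃ A B : ℝ, 0 < B ∧ ∀ x, V x ≤ A + B * ‖x‖ ^ 2 := by
    refine ⟨V 0 + ‖fderiv ℝ V 0‖, KV + ‖fderiv ℝ V 0‖ + 1, by positivity, fun x => ?_⟩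
    have h1 := le_of_abs_le (abs_taylor_one_le hV.contDiff 0 x hKV)
    have h2 : fderiv ℝ V 0 x ≤ ‖fderiv ℝ V 0‖ * ‖x‖ :=
      (le_abs_self _).trans ((fderiv ℝ V 0).le_opNorm x)
    rw [zero_add] at h1
    have h3 : ‖fderiv ℝ V 0‖ * ‖x‖ ≤ ‖fderiv ℝ V 0‖ * (1 + ‖x‖ ^ 2) := by
      refine mul_le_mul_of_nonneg_left ?_ (norm_nonneg _)
      nlinarith [sq_nonneg (‖x‖ - 1)]
    nlinarith [sq_nonneg ‖x‖]
  obtain ⟨l₀, hl₀, hl⟩ := hX₀s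
  obtain ⟨_, _, _, hγs⟩ := hγs
  set κ := min κ₀ (l₀ / (2 * B)) with hκ
  have hκpos : 0 < κ := by positivity
  obtain ⟨c, hc, hc'⟩ := hstep κ hκpos (min_le_left _ _)
  obtain ⟨a0, ha0⟩ : ∃ a0, expInt P (fun ω => κ * V (X₀ ω)) ≤ ENNReal.ofReal (Real.exp a0) := by
    have hκB : κ * B < l₀ := by
      calc κ * B ≤ l₀ / (2 * B) * B := by gcongr; exact min_le_right _ _
        _ = l₀ / 2 := by field_simp
        _ < l₀ := by linarith
    have h1 := hl (κ * B) hκB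
    have h2 : expInt P (fun ω => κ * V (X₀ ω)) ≤
        expInt P (fun ω => κ * B * ‖X₀ ω‖ ^ 2 + κ * A) := expInt_mono fun ω => by
      have := mul_le_mul_of_nonneg_left (hAB (X₀ ω)) hκpos.le
      linarith
    rw [expInt_add_const, expInt_eq_ofReal_integral h1,
      ← ENNReal.ofReal_mul (integral_nonneg fun _ => (Real.exp_pos _).le)] at h2
    set I := (∫ ω, Real.exp (κ * B * ‖X₀ ω‖ ^ 2) ∂P) * Real.exp (κ * A)
    exact ⟨I, h2.trans (ENNReal.ofReal_le_ofReal (by linarith [Real.add_one_le_exp I]))⟩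
  set a := max (max a0 0) (c / α) with ha
  have haα : c ≤ α * a := by
    have : c / α ≤ a := le_max_right _ _
    rw [div_le_iff₀ hα] at this
    linarith
  refine ⟨κ, hκpos, a, (le_max_right _ _).trans (le_max_left _ _), fun n => ?_⟩
  induction n with
  | zero =>
    exact ha0.trans (ENNReal.ofReal_le_ofReal (Real.exp_le_exp.2
      ((le_max_left _ _).trans (le_max_left _ _))))
  | succ n ih =>
    have hγn := hγpos (n + 1) (by omega)
    have hγn1 := hγle (n + 1) (by omega)
    have hm : Measurable (scheme b σ γ X₀ U n) :=
      (measurable_scheme_past hb hσc le_rfl).mono (past_le hX₀ hU n) le_rfl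
    have hw : α * γ (n + 1) ≤ 1 := (mul_le_mul_of_nonneg_left hγn1 hα.le).trans hαg
    have hF : Measurable fun p : Vec d × Vec r =>
        ENNReal.ofReal (Real.exp (κ * V (eulerStep b σ (γ (n + 1)) p.1 p.2))) := by
      have := continuous_eulerStep hb hσc (γ (n + 1))
      fun_prop
    have key := lintegral_condition_past hX₀ hU n
      (measurable_scheme_past hb hσc (γ := γ) le_rfl) hF
    calc expInt P (fun ω => κ * V (scheme b σ γ X₀ U (n + 1) ω))
        = _ := key
      _ ≤ expInt P (fun ω => (1 - α * γ (n + 1)) * (κ * V (scheme b σ γ X₀ U n ω)) +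
            c * γ (n + 1)) :=
          lintegral_mono fun ω => hc' _ hγn hγn1 (hγs (n + 1) (by omega)).2 _
      _ ≤ ENNReal.ofReal (Real.exp ((1 - α * γ (n + 1)) * a + c * γ (n + 1))) :=
          expInt_add_const_le _ (expInt_mul_le (by fun_prop) (by linarith)
            (by have := mul_pos hα hγn; linarith) ih)
      _ ≤ ENNReal.ofReal (Real.exp a) := by
          refine ENNReal.ofReal_le_ofReal (Real.exp_le_exp.2 ?_)
          nlinarith

/-- Exponential moments of weighted sums of `√V`: a total weight `W` contributes a Gaussian
factor of variance of order `W²`, and a constant that may be made close to one. -/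
lemma expInt_sum_sqrt_le {Ω : Type*} [MeasurableSpace Ω] {P : Measure Ω}
    [IsProbabilityMeasure P] {Y : ℕ → Ω → ℝ} (hY : ∀ k, Measurable (Y k))
    (hY0 : ∀ k ω, 0 ≤ Y k ω) {κ a : ℝ} (hκ : 0 < κ)
    (h : ∀ k, expInt P (fun ω => κ * Y k ω) ≤ ENNReal.ofReal (Real.exp a)) (s : Finset ℕ)
    (w : ℕ → ℝ) (hw : ∀ k ∈ s, 0 ≤ w k) {ε : ℝ} (hε : 0 < ε) (hε1 : ε ≤ 1) (t : ℝ) :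
    expInt P (fun ω => t * ∑ k ∈ s, w k * √(Y k ω)) ≤
      ENNReal.ofReal (Real.exp (ε * a + t ^ 2 * (∑ k ∈ s, w k) ^ 2 / (4 * κ * ε))) := by
  set W := ∑ k ∈ s, w k with hW
  have hW0 : 0 ≤ W := Finset.sum_nonneg hw
  have hbound : ∀ k, expInt P (fun ω => W * (t * √(Y k ω))) ≤
      ENNReal.ofReal (Real.exp (ε * a + t ^ 2 * W ^ 2 / (4 * κ * ε))) := by
    intro k
    have hYk := hY k
    refine (expInt_mono fun ω => ?_).trans (expInt_add_const_le (t ^ 2 * W ^ 2 / (4 * κ * ε))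
      (expInt_mul_le (w := ε) (by fun_prop) hε.le hε1 (h k)))
    have hsq : √(Y k ω) ^ 2 = Y k ω := Real.sq_sqrt (hY0 k ω)
    have h4 : 0 < 4 * κ * ε := by positivity
    have h1 : 0 ≤ (2 * κ * ε * √(Y k ω) - t * W) ^ 2 / (4 * κ * ε) := by positivity
    have h2 : (2 * κ * ε * √(Y k ω) - t * W) ^ 2 / (4 * κ * ε) =
        ε * (κ * √(Y k ω) ^ 2) + t ^ 2 * W ^ 2 / (4 * κ * ε) - W * (t * √(Y k ω)) := by
      field_simp; ring
    rw [h2, hsq] at h1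
    linarith
  rcases hW0.eq_or_lt with h0 | hpos
  · have hz : ∀ k ∈ s, w k = 0 := (Finset.sum_eq_zero_iff_of_nonneg hw).1 (hW.symm.trans h0.symm)
    refine le_trans (expInt_mono fun ω => ?_) (hbound 0)
    rw [Finset.sum_eq_zero fun k hk => by rw [hz k hk, zero_mul], ← h0]
    simp
  · have := expInt_sum_le (μ := P) s w hw W hW.symm hpos (f := fun k ω => t * √(Y k ω))
      (fun k _ => by have := hY k; fun_prop) (fun k _ => hbound k)
    refine le_trans (expInt_mono fun ω => ?_) this
    rw [Finset.mul_sum]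
    exact (Finset.sum_congr rfl fun k _ => by ring).le

end Lyapunov

/-! ### The step sequence -/

lemma Gam_eq_sum_range (γ : ℕ → ℝ) (n : ℕ) : Gam γ n = ∑ k ∈ Finset.range n, γ (k + 1) := by
  rw [Gam, Finset.range_eq_Ico, Finset.sum_Ico_add' γ 0 n 1]
  rfl

lemma Gam_succ (γ : ℕ → ℝ) (n : ℕ) : Gam γ (n + 1) = Gam γ n + γ (n + 1) := by
  rw [Gam_eq_sum_range, Gam_eq_sum_range, Finset.sum_range_succ]

lemma sum_rpow_neg_le {θ : ℝ} (h0 : 0 ≤ θ) (h1 : θ < 1) (n : ℕ) :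
    ∑ k ∈ Finset.range n, ((k + 1 : ℕ) : ℝ) ^ (-θ) ≤ (n : ℝ) ^ (1 - θ) / (1 - θ) := by
  have h2 : 0 < 1 - θ := by linarith
  induction n with
  | zero => simp [Real.zero_rpow h2.ne']
  | succ n ih =>
    rw [Finset.sum_range_succ]
    set m : ℝ := ((n + 1 : ℕ) : ℝ) with hm
    have hm1 : 1 ≤ m := by rw [hm]; push_cast; linarith [n.cast_nonneg (α := ℝ)]
    have hmpos : 0 < m := by linarith
    have hn : (n : ℝ) = m * (1 + -1 / m) := by
      rw [hm]; field_simp; push_cast; ring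
    have hneg : -1 ≤ -1 / m := by rw [le_div_iff₀ hmpos]; linarith
    have h3 : (n : ℝ) ^ (1 - θ) ≤ m ^ (1 - θ) * (1 + (1 - θ) * (-1 / m)) := by
      rw [hn, Real.mul_rpow hmpos.le (by linarith)]
      exact mul_le_mul_of_nonneg_left
        (rpow_one_add_le_one_add_mul_self hneg h2.le (by linarith)) (by positivity)
    have h4 : m ^ (1 - θ) = m * m ^ (-θ) := by
      rw [sub_eq_add_neg, Real.rpow_add hmpos, Real.rpow_one]
    have h5 : m ^ (1 - θ) * (1 + (1 - θ) * (-1 / m)) = m ^ (1 - θ) - (1 - θ) * m ^ (-θ) := by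
      rw [h4]; field_simp; ring
    rw [h5] at h3
    rw [le_div_iff₀ h2] at ih ⊢
    linarith

namespace StepSequence

variable {γ : ℕ → ℝ} {θ : ℝ} (hγ : StepSequence γ θ)

include hγ

lemma Gam_pos {n : ℕ} (hn : 1 ≤ n) : 0 < Gam γ n :=
  Finset.sum_pos (fun k hk => hγ.pos k (Finset.mem_Icc.1 hk).1) ⟨1, by simp [hn]⟩

lemma Gam_nonneg (n : ℕ) : 0 ≤ Gam γ n :=
  Finset.sum_nonneg fun k hk => (hγ.pos k (Finset.mem_Icc.1 hk).1).le

lemma tendsto_Gam (hθ : θ ≤ 1) : Tendsto (Gam γ) atTop atTop := by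
  have h1 : ¬ Summable fun k => γ (k + 1) := by
    intro h
    rw [summable_nat_add_iff 1] at h
    obtain ⟨n₀, C, hC, hord⟩ := hγ.order
    have h2 : Summable fun n : ℕ => (n : ℝ) ^ (-θ) := by
      refine Summable.of_norm_bounded_eventually_nat (h.mul_left C) ?_
      filter_upwards [eventually_ge_atTop n₀] with n hn
      have h3 := (hord n hn).1
      rw [Real.norm_eq_abs, abs_of_nonneg (Real.rpow_nonneg n.cast_nonneg _)]
      rwa [inv_mul_le_iff₀ (by linarith)] at h3
    rw [Real.summable_nat_rpow] at h2
    linarith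
  have h2 := (not_summable_iff_tendsto_nat_atTop_of_nonneg
    fun k => (hγ.pos (k + 1) (by omega)).le).1 h1
  exact h2.congr fun n => (Gam_eq_sum_range γ n).symm

lemma exists_le_rpow (hθ : 0 ≤ θ) : ∃ C > 0, ∀ k ≥ 1, γ k ≤ C * (k : ℝ) ^ (-θ) := by
  obtain ⟨n₀, C, hC, hord⟩ := hγ.order
  have hγ1 := hγ.pos 1 le_rfl
  refine ⟨C + γ 1 * (n₀ : ℝ) ^ θ, by positivity, fun k hk => ?_⟩
  have hk0 : (0 : ℝ) < k := by exact_mod_cast hk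
  rcases le_total n₀ k with h | h
  · refine (hord k h).2.trans (mul_le_mul_of_nonneg_right ?_ (by positivity))
    have : 0 ≤ γ 1 * (n₀ : ℝ) ^ θ := by positivity
    linarith
  · have h1 : 1 ≤ (n₀ : ℝ) ^ θ * (k : ℝ) ^ (-θ) := by
      rw [Real.rpow_neg hk0.le, ← div_eq_mul_inv, one_le_div (by positivity)]
      exact Real.rpow_le_rpow hk0.le (by exact_mod_cast h) hθ
    have h2 := hγ.anti 1 k le_rfl hk
    have h3 : γ 1 * 1 ≤ γ 1 * ((n₀ : ℝ) ^ θ * (k : ℝ) ^ (-θ)) :=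
      mul_le_mul_of_nonneg_left h1 hγ1.le
    have h4 : 0 ≤ C * (k : ℝ) ^ (-θ) := by positivity
    linarith

/-- The step condition `θ > 1 / (2 + β)`, in the form in which it enters the argument. -/
lemma tendsto_rpow_mul_Gam {β : ℝ} (hβ : 0 < β) (hθ : θ ∈ Ioc (1 / (2 + β)) 1) :
    Tendsto (fun k => γ k ^ (1 + β) * Gam γ k) atTop (𝓝 0) := by
  have h2β : 0 < 2 + β := by linarith
  have hθ0 : 0 < θ := lt_trans (by positivity) hθ.1
  obtain ⟨C, hC, hle⟩ := hγ.exists_le_rpow hθ0.le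
  -- an exponent below `θ` and below `1`, so that the power sums are again powers
  set t := (1 / (2 + β) + θ) / 2 with ht
  have ht1 : 1 / (2 + β) < t := by linarith [hθ.1]
  have ht2 : t < θ := by linarith [hθ.1]
  have ht0 : 0 < t := lt_trans (by positivity) ht1
  have ht3 : t < 1 := ht2.trans_le hθ.2
  have h1t : 0 < 1 - t := by linarith
  have hle' : ∀ k ≥ 1, γ k ≤ C * (k : ℝ) ^ (-t) := fun k hk => by
    refine (hle k hk).trans (mul_le_mul_of_nonneg_left ?_ hC.le)
    exact Real.rpow_le_rpow_of_exponent_le (by exact_mod_cast hk) (by linarith)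
  have hG : ∀ n, Gam γ n ≤ C / (1 - t) * (n : ℝ) ^ (1 - t) := fun n => by
    rw [Gam_eq_sum_range]
    calc _ ≤ ∑ k ∈ Finset.range n, C * ((k + 1 : ℕ) : ℝ) ^ (-t) :=
          Finset.sum_le_sum fun k _ => hle' (k + 1) (by omega)
      _ ≤ C * ((n : ℝ) ^ (1 - t) / (1 - t)) := by
          rw [← Finset.mul_sum]
          exact mul_le_mul_of_nonneg_left (sum_rpow_neg_le ht0.le ht3 n) hC.le
      _ = _ := by ring
  have hexp : 0 < t * (2 + β) - 1 := by
    rw [div_lt_iff₀ h2β] at ht1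
    linarith
  have hlim : Tendsto (fun n : ℕ => C ^ (1 + β) * (C / (1 - t)) *
      (n : ℝ) ^ (-(t * (2 + β) - 1))) atTop (𝓝 0) := by
    simpa using ((tendsto_rpow_neg_atTop hexp).comp tendsto_natCast_atTop_atTop).const_mul
      (C ^ (1 + β) * (C / (1 - t)))
  refine tendsto_of_tendsto_of_tendsto_of_le_of_le' tendsto_const_nhds hlim ?_ ?_
  · filter_upwards [eventually_ge_atTop 1] with n hn
    exact mul_nonneg (Real.rpow_nonneg (hγ.pos n hn).le _) (hγ.Gam_nonneg n)
  · filter_upwards [eventually_ge_atTop 1] with n hn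
    have hn0 : (0 : ℝ) < n := by exact_mod_cast hn
    have h1 : γ n ^ (1 + β) ≤ (C * (n : ℝ) ^ (-t)) ^ (1 + β) :=
      Real.rpow_le_rpow (hγ.pos n hn).le (hle' n hn) (by linarith)
    calc γ n ^ (1 + β) * Gam γ n
        ≤ (C * (n : ℝ) ^ (-t)) ^ (1 + β) * (C / (1 - t) * (n : ℝ) ^ (1 - t)) :=
          mul_le_mul h1 (hG n) (hγ.Gam_nonneg n) (by positivity)
      _ = C ^ (1 + β) * (C / (1 - t)) * ((n : ℝ) ^ (-t * (1 + β)) * (n : ℝ) ^ (1 - t)) := by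
          rw [Real.mul_rpow hC.le (by positivity), ← Real.rpow_mul hn0.le]
          ring
      _ = _ := by
          rw [← Real.rpow_add hn0]
          congr 2; ring

/-- The accumulated bias of the scheme is negligible against `√Γ_n`. The summands are compared
with the increments of `√Γ`, and the comparison is then summed. -/
lemma sum_rpow_isLittleO {β : ℝ} (hβ : 0 < β) (hθ : θ ∈ Ioc (1 / (2 + β)) 1) :
    (fun n => ∑ k ∈ Finset.range n, γ (k + 1) ^ ((3 + β) / 2)) =o[atTop]
      fun n => √(Gam γ n) := by
  have hmono : ∀ n, √(Gam γ n) ≤ √(Gam γ (n + 1)) := fun n => by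
    refine Real.sqrt_le_sqrt ?_
    rw [Gam_succ]
    linarith [hγ.pos (n + 1) (by omega)]
  have htel : ∀ n, ∑ k ∈ Finset.range n, (√(Gam γ (k + 1)) - √(Gam γ k)) = √(Gam γ n) :=
    fun n => by rw [Finset.sum_range_sub fun k => √(Gam γ k)]; simp [Gam]
  have hinf : Tendsto (fun n => √(Gam γ n)) atTop atTop :=
    Real.tendsto_sqrt_atTop.comp (hγ.tendsto_Gam hθ.2)
  have key : (fun k => γ (k + 1) ^ ((3 + β) / 2)) =o[atTop]
      fun k => √(Gam γ (k + 1)) - √(Gam γ k) := by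
    have h1 := ((hγ.tendsto_rpow_mul_Gam hβ hθ).comp (tendsto_add_atTop_nat 1)).sqrt
    have h2 := h1.const_mul 2
    rw [Real.sqrt_zero, mul_zero] at h2
    rw [Asymptotics.isLittleO_iff]
    intro c hc
    filter_upwards [h2.eventually (gt_mem_nhds hc)] with k hk
    have hγk := hγ.pos (k + 1) (by omega)
    have hGk := hγ.Gam_pos (n := k + 1) (by omega)
    have hs := Real.sqrt_pos.2 hGk
    simp only [Function.comp] at hk
    rw [Real.sqrt_mul (Real.rpow_nonneg hγk.le _), Real.sqrt_eq_rpow, ← Real.rpow_mul hγk.le] at hk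
    rw [Real.norm_eq_abs, abs_of_nonneg (Real.rpow_nonneg hγk.le _), Real.norm_eq_abs,
      abs_of_nonneg (sub_nonneg.2 (hmono k))]
    have e1 : γ (k + 1) ^ ((3 + β) / 2) = γ (k + 1) ^ ((1 + β) * (1 / 2)) * γ (k + 1) := by
      rw [← Real.rpow_add_one hγk.ne']
      congr 1; ring
    have e2 : γ (k + 1) = (√(Gam γ (k + 1)) - √(Gam γ k)) * (√(Gam γ (k + 1)) + √(Gam γ k)) := by
      have h3 := Real.sq_sqrt hGk.le
      have h4 := Real.sq_sqrt (hγ.Gam_nonneg k)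
      have h5 := Gam_succ γ k
      linarith
    have e3 : γ (k + 1) ≤ (√(Gam γ (k + 1)) - √(Gam γ k)) * (2 * √(Gam γ (k + 1))) := by
      conv_lhs => rw [e2]
      exact mul_le_mul_of_nonneg_left (by linarith [hmono k]) (sub_nonneg.2 (hmono k))
    rw [e1]
    calc _ ≤ γ (k + 1) ^ ((1 + β) * (1 / 2)) *
          ((√(Gam γ (k + 1)) - √(Gam γ k)) * (2 * √(Gam γ (k + 1)))) :=
          mul_le_mul_of_nonneg_left e3 (Real.rpow_nonneg hγk.le _)
      _ = (2 * (γ (k + 1) ^ ((1 + β) * (1 / 2)) * √(Gam γ (k + 1)))) *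
          (√(Gam γ (k + 1)) - √(Gam γ k)) := by ring
      _ ≤ c * (√(Gam γ (k + 1)) - √(Gam γ k)) := by
          exact mul_le_mul_of_nonneg_right hk.le (sub_nonneg.2 (hmono k))
  have h := key.sum_range (fun k => sub_nonneg.2 (hmono k)) (hinf.congr fun n => (htel n).symm)
  simpa only [htel] using h

lemma eventually_sq_le {β : ℝ} (hβ : 0 < β) (hθ : θ ∈ Ioc (1 / (2 + β)) 1) (A B : ℝ) {ε : ℝ}
    (hε : 0 < ε) : ∀ᶠ n in atTop,
      (A + B * ∑ k ∈ Finset.range n, γ (k + 1) ^ ((3 + β) / 2)) ^ 2 ≤ ε * Gam γ n := by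
  have hinf : Tendsto (fun n => √(Gam γ n)) atTop atTop :=
    Real.tendsto_sqrt_atTop.comp (hγ.tendsto_Gam hθ.2)
  have h1 : (fun _ : ℕ => A) =o[atTop] fun n => √(Gam γ n) :=
    Asymptotics.isLittleO_const_left.2 (Or.inr (tendsto_norm_atTop_atTop.comp hinf))
  have h2 := h1.add ((hγ.sum_rpow_isLittleO hβ hθ).const_mul_left B)
  filter_upwards [Asymptotics.isLittleO_iff.1 h2 (Real.sqrt_pos.2 hε)] with n hn
  rw [Real.norm_eq_abs, Real.norm_eq_abs, abs_of_nonneg (Real.sqrt_nonneg _)] at hn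
  calc _ = |A + B * ∑ k ∈ Finset.range n, γ (k + 1) ^ ((3 + β) / 2)| ^ 2 := (sq_abs _).symm
    _ ≤ (√ε * √(Gam γ n)) ^ 2 := by gcongr
    _ = _ := by rw [mul_pow, Real.sq_sqrt hε.le, Real.sq_sqrt (hγ.Gam_nonneg n)]

end StepSequence

/-! ### Exponential moments along the scheme -/

/-- The bounds on the data, collected with one constant. -/
lemma exists_stepBounds {d r : ℕ} {b : Vec d → Vec d} {σ : Vec d → Vec r →L[ℝ] Vec d}
    (hb : ∃ K : ℝ≥0, LipschitzWith K b) (hσ : ∃ κ > 0, ∀ x, frobSq (σ x) ≤ κ) {V : Vec d → ℝ}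
    {CV αV βV : ℝ} (hV : IsLyapunov b σ V CV αV βV) {β : ℝ} {f : Vec d → ℝ}
    (hf : TestRegularity b V β f) : ∃ K, StepBounds b σ V β K f := by
  obtain ⟨Kb, hKb⟩ := hb
  obtain ⟨ks, hks, hσ⟩ := hσ
  obtain ⟨v, hv, hVv⟩ := hV.lower
  obtain ⟨K1, hK1⟩ := hf.smooth.bounded 1 (by simp)
  obtain ⟨K2, hK2⟩ := hf.smooth.bounded 2 (by simp)
  obtain ⟨K3, hK3⟩ := hf.smooth.bounded 3 (by simp)
  obtain ⟨KH, hKH⟩ := hf.smooth.holder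
  obtain ⟨L, hL⟩ := hf.lip
  obtain ⟨C, hC, hgrow⟩ := hf.growth
  have hCV := hV.CV_pos
  have p1 : 0 ≤ K1 := (norm_nonneg _).trans (hK1 0)
  have p2 : 0 ≤ K2 := (norm_nonneg _).trans (hK2 0)
  have p3 : 0 ≤ K3 := (norm_nonneg _).trans (hK3 0)
  have p4 : 0 ≤ |KH| := abs_nonneg KH
  have p5 := L.coe_nonneg
  have p6 := Kb.coe_nonneg
  have p7 : 0 ≤ C * (1 / √v + 1) := by positivity
  have p8 : 0 ≤ √CV := Real.sqrt_nonneg _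
  have p9 : 0 ≤ √ks := Real.sqrt_nonneg _
  have p10 : 0 ≤ 1 / √v := by positivity
  have hsv := Real.sqrt_pos.2 hv
  have hone : ∀ x, 1 ≤ 1 / √v * √(V x) := fun x => by
    rw [one_div, inv_mul_eq_div, one_le_div hsv]
    exact Real.sqrt_le_sqrt (hVv x)
  refine ⟨1 + K1 + K2 + K3 + |KH| + L + Kb + C * (1 / √v + 1) + √CV + √ks + 1 / √v, ?_⟩
  set K := 1 + K1 + K2 + K3 + |KH| + L + Kb + C * (1 / √v + 1) + √CV + √ks + 1 / √v with hK
  refine ⟨by linarith, hf.smooth.contDiff, fun x => ?_, fun x => (hK2 x).trans (by linarith),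
    fun x => (hK3 x).trans (by linarith), fun x y => ?_, fun x y => ?_, fun x => ?_, fun x y => ?_,
    fun x => ?_, fun x => ?_, fun x => ?_⟩
  · rw [← norm_iteratedFDeriv_one_eq]
    exact (hK1 x).trans (by linarith)
  · refine (hKH x y).trans (mul_le_mul_of_nonneg_right ?_ (by positivity))
    linarith [le_abs_self KH]
  · have := hL.dist_le_mul x y
    rw [Real.dist_eq, dist_eq_norm] at this
    exact this.trans (mul_le_mul_of_nonneg_right (by linarith) (norm_nonneg _))
  · have h1 := hone x
    calc |f x| ≤ C * (1 + √(V x)) := hgrow x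
      _ ≤ C * (1 / √v * √(V x) + √(V x)) := by gcongr
      _ = C * (1 / √v + 1) * √(V x) := by ring
      _ ≤ _ := mul_le_mul_of_nonneg_right (by linarith) (Real.sqrt_nonneg _)
  · have := hKb.dist_le_mul x y
    rw [dist_eq_norm, dist_eq_norm] at this
    exact this.trans (mul_le_mul_of_nonneg_right (by linarith) (norm_nonneg _))
  · have h1 : ‖b x‖ ^ 2 ≤ CV * V x := by
      have := hV.growth x
      nlinarith [sq_nonneg ‖∇ V x‖]
    have h2 : ‖b x‖ ≤ √CV * √(V x) := by
      rw [← Real.sqrt_mul hCV.le]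
      exact Real.le_sqrt_of_sq_le h1
    exact h2.trans (mul_le_mul_of_nonneg_right (by linarith) (Real.sqrt_nonneg _))
  · exact (Real.sqrt_le_sqrt (hσ x)).trans (by linarith)
  · exact (hone x).trans (mul_le_mul_of_nonneg_right (by linarith) (Real.sqrt_nonneg _))

lemma continuous_gen {d r : ℕ} {b : Vec d → Vec d} {σ : Vec d → Vec r →L[ℝ] Vec d}
    (hb : Continuous b) (hσ : Continuous σ) {f : Vec d → ℝ} (hf : ContDiff ℝ 2 f) :
    Continuous (gen b σ f) := by
  have h1 : Continuous (fderiv ℝ f) := hf.continuous_fderiv (by norm_num)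
  have h2 : Continuous (fderiv ℝ (fderiv ℝ f)) :=
    (hf.fderiv_right (m := 1) (by norm_num)).continuous_fderiv (by norm_num)
  unfold gen
  simp_rw [iteratedFDeriv_two_cons, real_inner_comm (∇ f _), inner_gradient_left]
  fun_prop

section Controlled

variable {d r : ℕ}

/-- The weighted sum `∑ γ_k 𝒜f(X_{k-1})` along the scheme. -/
noncomputable def genSum (b : Vec d → Vec d) (σ : Vec d → Vec r →L[ℝ] Vec d) (γ : ℕ → ℝ)
    {Ω : Type*} (X₀ : Ω → Vec d) (U : ℕ → Ω → Vec r) (f : Vec d → ℝ) (n : ℕ) (ω : Ω) : ℝ :=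
  ∑ k ∈ Finset.range n, γ (k + 1) * gen b σ f (scheme b σ γ X₀ U k ω)

/-- The martingale of the increments of `f` along the scheme, centered by their conditional means
given the past. -/
noncomputable def martSum (b : Vec d → Vec d) (σ : Vec d → Vec r →L[ℝ] Vec d) (γ : ℕ → ℝ)
    {Ω : Type*} (X₀ : Ω → Vec d) (U : ℕ → Ω → Vec r) (μ : Measure (Vec r)) (f : Vec d → ℝ)
    (n : ℕ) (ω : Ω) : ℝ :=
  ∑ k ∈ Finset.range n, (f (scheme b σ γ X₀ U (k + 1) ω) -
    stepMean b σ μ (γ (k + 1)) f (scheme b σ γ X₀ U k ω))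

/-- The standing facts about the scheme: regularity of the data, boundedness of the exponential
moments of `V`, and smallness of the accumulated bias against `√Γ_n`. -/
structure ControlledScheme (b : Vec d → Vec d) (σ : Vec d → Vec r →L[ℝ] Vec d) (V : Vec d → ℝ)
    (γ : ℕ → ℝ) (β : ℝ) {Ω : Type*} [MeasurableSpace Ω] (P : Measure Ω) (X₀ : Ω → Vec d)
    (U : ℕ → Ω → Vec r) : Prop where
  prob : IsProbabilityMeasure P
  drift_cont : Continuous b
  diffusion_cont : Continuous σ
  lyapunov_cont : Continuous V
  lyapunov_nonneg : ∀ x, 0 ≤ V x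
  order : β ∈ Ioc (0 : ℝ) 1
  step_pos : ∀ k, 0 < γ (k + 1)
  step_le : ∀ k, γ (k + 1) ≤ γ 1
  start_meas : Measurable X₀
  innov : GaussianConcentration P X₀ U
  moment : ∃ κ > 0, ∃ a ≥ 0, ∀ n,
    expInt P (fun ω => κ * V (scheme b σ γ X₀ U n ω)) ≤ ENNReal.ofReal (Real.exp a)
  bias : ∀ A B ε : ℝ, 0 < ε → ∀ᶠ n in atTop,
    (A + B * ∑ k ∈ Finset.range n, γ (k + 1) ^ ((3 + β) / 2)) ^ 2 ≤ ε * Gam γ n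

namespace ControlledScheme

variable {b : Vec d → Vec d} {σ : Vec d → Vec r →L[ℝ] Vec d} {V : Vec d → ℝ}
  {γ : ℕ → ℝ} {β K : ℝ} {Ω : Type*} [MeasurableSpace Ω] {P : Measure Ω} {X₀ : Ω → Vec d}
  {U : ℕ → Ω → Vec r} (h : ControlledScheme b σ V γ β P X₀ U) {f : Vec d → ℝ}

include h

lemma measurable_scheme (n : ℕ) : Measurable (scheme b σ γ X₀ U n) :=
  (measurable_scheme_past h.drift_cont h.diffusion_cont le_rfl).mono
    (past_le h.start_meas h.innov n) le_rfl

lemma measurable_genSum (hf : ContDiff ℝ 2 f) (n : ℕ) : Measurable (genSum b σ γ X₀ U f n) := by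
  have h1 := (continuous_gen h.drift_cont h.diffusion_cont hf).measurable
  exact Finset.measurable_sum _ fun k _ => (h1.comp (h.measurable_scheme k)).const_mul _

lemma measurable_stepMean (hf : Continuous f) (g : ℝ) :
    Measurable (stepMean b σ (P.map (U 1)) g f) := by
  have := h.prob
  have := h.innov.gaussianLike.prob
  have h1 : StronglyMeasurable fun p : Vec d × Vec r => f (eulerStep b σ g p.1 p.2) :=
    (hf.comp (continuous_eulerStep h.drift_cont h.diffusion_cont g)).stronglyMeasurable
  exact h1.integral_prod_right.measurable

lemma measurable_martSum (hf : Continuous f) (n : ℕ) :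
    Measurable (martSum b σ γ X₀ U (P.map (U 1)) f n) :=
  Finset.measurable_sum _ fun _ _ => (hf.measurable.comp (h.measurable_scheme _)).sub
    ((h.measurable_stepMean hf _).comp (h.measurable_scheme _))

lemma measurable_sqrt (n : ℕ) : Measurable fun ω => √(V (scheme b σ γ X₀ U n ω)) :=
  Real.continuous_sqrt.measurable.comp (h.lyapunov_cont.measurable.comp (h.measurable_scheme n))

lemma Gam_nonneg (n : ℕ) : 0 ≤ Gam γ n := by
  rw [Gam_eq_sum_range]
  exact Finset.sum_nonneg fun k _ => (h.step_pos k).le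

/-- Remainder terms, that is, weighted sums of `√V` of total weight `o(√Γ_n)`, have exponential
integrals arbitrarily close to those of a negligible Gaussian variable. -/
lemma eventually_expInt_sum_sqrt_le {w : ℕ → ℕ → ℝ} (hw : ∀ n k, 0 ≤ w n k) (A B : ℝ)
    (hW : ∀ n, ∑ k ∈ Finset.range (n + 1), w n k ≤
      A + B * ∑ k ∈ Finset.range n, γ (k + 1) ^ ((3 + β) / 2)) {δ : ℝ} (hδ : 0 < δ) :
    ∀ᶠ n in atTop, ∀ t, expInt P (fun ω => t * ∑ k ∈ Finset.range (n + 1),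
      w n k * √(V (scheme b σ γ X₀ U k ω))) ≤
        ENNReal.ofReal (Real.exp (δ + δ * t ^ 2 * Gam γ n)) := by
  have := h.prob
  obtain ⟨κ, hκ, a, ha, hmom⟩ := h.moment
  set ε := min 1 (δ / (a + 1)) with hε
  have hε0 : 0 < ε := by positivity
  have hεa : ε * a ≤ δ := by
    have h1 : ε ≤ δ / (a + 1) := min_le_right _ _
    rw [le_div_iff₀ (by positivity)] at h1
    linarith
  filter_upwards [h.bias A B (4 * κ * ε * δ) (by positivity)] with n hn t
  refine (expInt_sum_sqrt_le (fun k => h.lyapunov_cont.measurable.comp (h.measurable_scheme k))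
    (fun k ω => h.lyapunov_nonneg _) hκ hmom (Finset.range (n + 1)) (w n) (fun k _ => hw n k) hε0
    (min_le_left _ _) t).trans (ENNReal.ofReal_le_ofReal (Real.exp_le_exp.2 ?_))
  have hW0 : 0 ≤ ∑ k ∈ Finset.range (n + 1), w n k := Finset.sum_nonneg fun k _ => hw n k
  have h2 : (∑ k ∈ Finset.range (n + 1), w n k) ^ 2 ≤ 4 * κ * ε * δ * Gam γ n :=
    (pow_le_pow_left₀ hW0 (hW n) 2).trans hn
  have h3 : t ^ 2 * (∑ k ∈ Finset.range (n + 1), w n k) ^ 2 / (4 * κ * ε) ≤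
      δ * t ^ 2 * Gam γ n := by
    rw [div_le_iff₀ (by positivity)]
    calc _ ≤ t ^ 2 * (4 * κ * ε * δ * Gam γ n) := by gcongr
      _ = _ := by ring
  linarith

/-- The sum of `γ_k 𝒜f` is, up to a remainder, minus the martingale of `f`. -/
lemma eventually_expInt_genSum_le (hf : StepBounds b σ V β K f) {p : ℝ} (hp : 1 < p) {δ : ℝ}
    (hδ : 0 < δ) : ∀ᶠ n in atTop, ∀ l c : ℝ,
      expInt P (fun ω => p * (-l * martSum b σ γ X₀ U (P.map (U 1)) f n ω)) ≤
        ENNReal.ofReal (Real.exp c) →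
      expInt P (fun ω => l * genSum b σ γ X₀ U f n ω) ≤
        ENNReal.ofReal (Real.exp (c / p + δ + δ * l ^ 2 * Gam γ n)) := by
  have := h.prob
  have hμ := h.innov.gaussianLike
  have hK := hf.one_le
  obtain ⟨C, hC, hbias⟩ := hf.exists_abs_bias_le hμ h.order (γ 1)
  have hγp : ∀ k, 0 ≤ γ (k + 1) ^ ((3 + β) / 2) := fun k => Real.rpow_nonneg (h.step_pos k).le _
  set w : ℕ → ℕ → ℝ := fun n k => (if k < n then C * γ (k + 1) ^ ((3 + β) / 2) else 0) +
    ((if k = 0 then K else 0) + if k = n then K else 0) with hw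
  have hwsum : ∀ (n : ℕ) (y : ℕ → ℝ), ∑ k ∈ Finset.range (n + 1), w n k * y k =
      ∑ k ∈ Finset.range n, C * γ (k + 1) ^ ((3 + β) / 2) * y k + K * y 0 + K * y n := by
    intro n y
    simp only [hw, add_mul, ite_mul, zero_mul, Finset.sum_add_distrib]
    rw [Finset.sum_range_succ]
    have e : ∑ k ∈ Finset.range n, (if k < n then C * γ (k + 1) ^ ((3 + β) / 2) * y k else 0) =
        ∑ k ∈ Finset.range n, C * γ (k + 1) ^ ((3 + β) / 2) * y k :=
      Finset.sum_congr rfl fun k hk => if_pos (Finset.mem_range.1 hk)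
    rw [e]
    simp
    ring
  have hw0 : ∀ n k, 0 ≤ w n k := fun n k => by
    have := hγp k
    have : 0 ≤ K := by linarith
    simp only [hw]
    positivity
  set q := p / (p - 1) with hq
  have hp1 : 0 < p - 1 := by linarith
  have hq1 : 1 ≤ q := by rw [hq, one_le_div hp1]; linarith
  have hrem := h.eventually_expInt_sum_sqrt_le hw0 (2 * K) C (fun n => by
    have := hwsum n fun _ => 1
    simp only [mul_one] at this
    rw [this, ← Finset.mul_sum]
    linarith) (δ := δ / q) (by positivity)
  filter_upwards [hrem] with n hn l c hc
  set S : Ω → ℝ := fun ω =>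
    ∑ k ∈ Finset.range (n + 1), w n k * √(V (scheme b σ γ X₀ U k ω)) with hS
  have hpt : ∀ ω, l * genSum b σ γ X₀ U f n ω ≤
      -l * martSum b σ γ X₀ U (P.map (U 1)) f n ω + |l| * S ω := by
    intro ω
    set X := fun k => scheme b σ γ X₀ U k ω with hX
    set B := ∑ k ∈ Finset.range n, (stepMean b σ (P.map (U 1)) (γ (k + 1)) f (X k) - f (X k) -
      γ (k + 1) * gen b σ f (X k)) with hB
    have e : genSum b σ γ X₀ U f n ω + martSum b σ γ X₀ U (P.map (U 1)) f n ω =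
        f (X n) - f (X 0) - B := by
      rw [hB, genSum, martSum, ← Finset.sum_range_sub (fun k => f (X k)) n,
        ← Finset.sum_add_distrib, ← Finset.sum_sub_distrib]
      exact Finset.sum_congr rfl fun k _ => by simp only [hX]; ring
    have hB' : |B| ≤ ∑ k ∈ Finset.range n, C * γ (k + 1) ^ ((3 + β) / 2) * √(V (X k)) :=
      (Finset.abs_sum_le_sum_abs _ _).trans
        (Finset.sum_le_sum fun k _ => hbias _ (h.step_pos k) (h.step_le k) _)
    have h1 : |f (X n) - f (X 0) - B| ≤ S ω := by
      rw [hS]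
      simp only
      rw [hwsum n fun k => √(V (X k))]
      have h2 := hf.growth (X n)
      have h3 := hf.growth (X 0)
      have h4 := abs_sub (f (X n) - f (X 0)) B
      have h5 := abs_sub (f (X n)) (f (X 0))
      linarith
    have h2 : l * (f (X n) - f (X 0) - B) ≤ |l| * S ω :=
      (le_abs_self _).trans (by
        rw [abs_mul]; exact mul_le_mul_of_nonneg_left h1 (abs_nonneg l))
    rw [← e] at h2
    linarith
  have hSm : Measurable S := Finset.measurable_sum _ fun k _ => (h.measurable_sqrt k).const_mul _
  have hMm := h.measurable_martSum hf.contDiff.continuous n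
  have hR : expInt P (fun ω => p / (p - 1) * (|l| * S ω)) ≤
      ENNReal.ofReal (Real.exp (δ / q + δ / q * (q * |l|) ^ 2 * Gam γ n)) := by
    have := hn (q * |l|)
    simp_rw [mul_assoc q] at this ⊢
    exact this
  refine (expInt_mono hpt).trans ((expInt_add_le (by fun_prop) (by fun_prop) hp hc hR).trans
    (ENNReal.ofReal_le_ofReal (Real.exp_le_exp.2 ?_)))
  have hqinv : (p - 1) / p = 1 / q := by rw [hq]; field_simp
  rw [hqinv, mul_pow, sq_abs]
  have h1 : δ / q * (1 / q) ≤ δ := by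
    have hqq : 1 ≤ q * q := by nlinarith
    rw [div_mul_div_comm, mul_one, div_le_iff₀ (by positivity)]
    exact le_mul_of_one_le_right hδ.le hqq
  have h2 : (δ / q + δ / q * (q ^ 2 * l ^ 2) * Gam γ n) * (1 / q) =
      δ / q * (1 / q) + δ * l ^ 2 * Gam γ n := by
    field_simp
  rw [h2]
  linarith

/-- The martingale part, with the uniform variance proxy. -/
lemma expInt_martSum_le (hf : StepBounds b σ V β K f) (n : ℕ) (l : ℝ) :
    expInt P (fun ω => l * martSum b σ γ X₀ U (P.map (U 1)) f n ω) ≤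
      ENNReal.ofReal (Real.exp (l ^ 2 * Gam γ n * (supFrob σ ^ 2 * supGrad f ^ 2) / 2)) := by
  have := h.prob
  have hμ := h.innov.gaussianLike
  set s := supFrob σ ^ 2 * supGrad f ^ 2 with hs
  have hfc := hf.contDiff.continuous
  have key := expInt_sum_increments_le_one (γ := γ) h.drift_cont h.diffusion_cont h.start_meas
    h.innov
    (ψ := fun k p => l * (f (eulerStep b σ (γ (k + 1)) p.1 p.2) -
      stepMean b σ (P.map (U 1)) (γ (k + 1)) f p.1) + -(l ^ 2 * γ (k + 1) * s / 2))
    (fun k => by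
      have h1 := h.measurable_stepMean hfc (γ (k + 1))
      have h2 := continuous_eulerStep h.drift_cont h.diffusion_cont (γ (k + 1))
      fun_prop)
    (fun k x => by
      refine (expInt_add_const_le _
        (hf.expInt_increment_le hμ (h.step_pos k).le x l)).trans_eq ?_
      rw [add_neg_cancel]; simp) n
  have h2 := expInt_add_const_le (a := 0) (l ^ 2 * Gam γ n * s / 2) (by simpa using key)
  rw [zero_add] at h2
  refine (expInt_mono fun ω => le_of_eq ?_).trans h2
  rw [Finset.sum_add_distrib, martSum, Gam_eq_sum_range, Finset.mul_sum, Finset.sum_neg_distrib,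
    Finset.mul_sum, Finset.sum_mul, Finset.sum_div]
  simp only [scheme_succ]
  ring

/-- The uniform Gaussian bound for the sums of `γ_k 𝒜f`. -/
lemma eventually_expInt_genSum_uniform_le (hf : StepBounds b σ V β K f) {s : ℝ}
    (hs : s = supFrob σ ^ 2 * supGrad f ^ 2) {δ : ℝ} (hδ : 0 < δ) :
    ∀ᶠ n in atTop, ∀ l, expInt P (fun ω => l * genSum b σ γ X₀ U f n ω) ≤
      ENNReal.ofReal (Real.exp (δ + l ^ 2 * Gam γ n * (s / 2 + δ))) := by
  have hs0 : 0 ≤ s := by rw [hs]; positivity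
  set p := 1 + δ / (s + 1) with hp
  have hp1 : 1 < p := by
    have : 0 < δ / (s + 1) := by positivity
    linarith
  filter_upwards [h.eventually_expInt_genSum_le hf hp1 (δ := δ / 2) (by positivity)] with n hn l
  have h1 := h.expInt_martSum_le hf n (p * -l)
  simp_rw [mul_assoc p] at h1
  refine (hn l _ h1).trans (ENNReal.ofReal_le_ofReal (Real.exp_le_exp.2 ?_))
  rw [← hs]
  have e : (p * -l) ^ 2 * Gam γ n * s / 2 / p = l ^ 2 * Gam γ n * (p * s / 2) := by
    field_simp
  rw [e]
  have h2 : p * s / 2 ≤ s / 2 + δ / 2 := by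
    have : δ / (s + 1) * s ≤ δ := by
      rw [div_mul_eq_mul_div, div_le_iff₀ (by positivity)]
      nlinarith
    rw [hp]; linarith
  have h3 : l ^ 2 * Gam γ n * (p * s / 2) ≤ l ^ 2 * Gam γ n * (s / 2 + δ / 2) :=
    mul_le_mul_of_nonneg_left h2 (mul_nonneg (sq_nonneg l) (h.Gam_nonneg n))
  linarith

/-- The martingale part, compensated by its quadratic variation. -/
lemma exists_expInt_compensated_le_one (hf : StepBounds b σ V β K f) {p : ℝ} (hp : 1 < p) :
    ∃ C ≥ 0, ∀ (n : ℕ) (l : ℝ),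
      expInt P (fun ω => l * martSum b σ γ X₀ U (P.map (U 1)) f n ω -
        (p * l ^ 2 / 2 * ∑ k ∈ Finset.range n, γ (k + 1) * carre σ f (scheme b σ γ X₀ U k ω) +
          C * (l ^ 2 * ∑ k ∈ Finset.range n, γ (k + 1) ^ 2 * √(V (scheme b σ γ X₀ U k ω)) +
            l ^ 4 * ∑ k ∈ Finset.range n, γ (k + 1) ^ 2))) ≤ 1 := by
  have := h.prob
  have hμ := h.innov.gaussianLike
  have hfc := hf.contDiff.continuous
  have hcarre : Continuous (carre σ f) := by
    have h1 : Continuous (fderiv ℝ f) := hf.contDiff.continuous_fderiv (by norm_num)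
    have h2 : Continuous fun x => ∇ f x :=
      (InnerProductSpace.toDual ℝ (Vec d)).symm.continuous.comp h1
    have h3 : Continuous fun x => ContinuousLinearMap.adjoint (σ x) :=
      (ContinuousLinearMap.adjoint (𝕜 := ℝ) (E := Vec r) (F := Vec d)).continuous.comp
        h.diffusion_cont
    exact (h3.clm_apply h2).norm.pow 2
  have hVc := h.lyapunov_cont
  obtain ⟨C, hC, hinc⟩ := hf.exists_expInt_increment_sharp_le hμ hp
  refine ⟨C, hC, fun n l => ?_⟩
  have key := expInt_sum_increments_le_one (γ := γ) h.drift_cont h.diffusion_cont h.start_meas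
    h.innov
    (ψ := fun k y => l * (f (eulerStep b σ (γ (k + 1)) y.1 y.2) -
      stepMean b σ (P.map (U 1)) (γ (k + 1)) f y.1) + -(p * l ^ 2 / 2 *
        (γ (k + 1) * carre σ f y.1) +
        C * (l ^ 2 * (γ (k + 1) ^ 2 * √(V y.1)) + l ^ 4 * γ (k + 1) ^ 2)))
    (fun k => by
      have h1 := h.measurable_stepMean hfc (γ (k + 1))
      have h2 := continuous_eulerStep h.drift_cont h.diffusion_cont (γ (k + 1))
      fun_prop)
    (fun k x => by
      refine (expInt_add_const_le (-(p * l ^ 2 / 2 * (γ (k + 1) * carre σ f x) +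
        C * (l ^ 2 * (γ (k + 1) ^ 2 * √(V x)) + l ^ 4 * γ (k + 1) ^ 2)))
        (hinc _ (h.step_pos k) x l)).trans_eq ?_
      rw [add_neg_cancel]; simp) n
  refine (expInt_mono fun ω => le_of_eq ?_).trans key
  simp only [martSum, Finset.mul_sum, ← Finset.sum_add_distrib, ← Finset.sum_sub_distrib]
  refine Finset.sum_congr rfl fun k _ => ?_
  rw [scheme_succ]
  ring

end ControlledScheme

end Controlled

/-! ### Compensation through the Poisson equation -/

/-- The function `ρ ↦ ρ³ / (ρ - 1)` is smallest at `ρ = 3 / 2`. -/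
lemma cube_div_sub_one_ge {ρ : ℝ} (hρ : 1 < ρ) : 27 / 4 ≤ ρ ^ 3 / (ρ - 1) := by
  rw [div_le_div_iff₀ (by norm_num) (by linarith)]
  nlinarith [mul_nonneg (by linarith : 0 ≤ ρ + 3) (sq_nonneg (2 * ρ - 3))]

/-- The arithmetic of the exponents in the compensation of the martingale of `φ`, where `G` stands
for `Γ_n` and `T` for the sum of the squared steps. -/
lemma compensated_exponent_le {C ρ p δ δ₁ s G T : ℝ} (hC : 0 ≤ C) (hρ1 : 1 < ρ) (hρ2 : ρ ≤ 3 / 2)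
    (hp : 1 < p) (hδ : 0 < δ) (hδ₁ : 0 < δ₁) (hδ₁δ : δ₁ ≤ δ)
    (hδ₁q : δ₁ * (p / (p - 1) * C ^ 2) ≤ δ / 2) (hG : 0 ≤ G)
    (hT : T ≤ δ / (C + 1) * G) (l v : ℝ) :
    0 / ρ + ((δ₁ + (p * (p * ρ ^ 2 * l ^ 2 / (2 * (ρ - 1)))) ^ 2 * G * (s / 2 + δ₁)) / p +
      (δ₁ + δ₁ * (p / (p - 1) * (C * ρ ^ 2 * l ^ 2 / (ρ - 1))) ^ 2 * G) * ((p - 1) / p) +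
      (p * ρ ^ 2 * l ^ 2 / (2 * (ρ - 1)) * (G * v) + C * ρ ^ 4 * l ^ 4 / (ρ - 1) * T)) *
        ((ρ - 1) / ρ) ≤
      δ + ρ * (p * l ^ 2 / 2) * G * v +
        ρ ^ 3 / (ρ - 1) * l ^ 4 * G * (p ^ 3 / 4 * (s / 2 + δ) + δ) := by
  have hρ0 : 0 < ρ := by linarith
  have hρp : 0 < ρ - 1 := by linarith
  have hp0 : 0 < p := by linarith
  have hp1 : 0 < p - 1 := by linarith
  set R := ρ ^ 3 / (ρ - 1) with hR
  have hR0 : 0 ≤ R := by positivity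
  have e : 0 / ρ + ((δ₁ + (p * (p * ρ ^ 2 * l ^ 2 / (2 * (ρ - 1)))) ^ 2 * G * (s / 2 + δ₁)) / p +
      (δ₁ + δ₁ * (p / (p - 1) * (C * ρ ^ 2 * l ^ 2 / (ρ - 1))) ^ 2 * G) * ((p - 1) / p) +
      (p * ρ ^ 2 * l ^ 2 / (2 * (ρ - 1)) * (G * v) + C * ρ ^ 4 * l ^ 4 / (ρ - 1) * T)) *
        ((ρ - 1) / ρ) =
      δ₁ * ((ρ - 1) / ρ) + R * l ^ 4 * G * (p ^ 3 / 4 * (s / 2 + δ₁)) +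
      R * l ^ 4 * G * (δ₁ * (p / (p - 1) * C ^ 2)) + ρ * (p * l ^ 2 / 2) * G * v +
      C * ρ ^ 3 * l ^ 4 * T := by
    rw [hR]
    field_simp
    ring
  rw [e]
  have i1 : δ₁ * ((ρ - 1) / ρ) ≤ δ :=
    (mul_le_of_le_one_right hδ₁.le (by rw [div_le_one hρ0]; linarith)).trans hδ₁δ
  have hL : 0 ≤ R * l ^ 4 * G := by positivity
  have i2 : R * l ^ 4 * G * (p ^ 3 / 4 * (s / 2 + δ₁)) ≤
      R * l ^ 4 * G * (p ^ 3 / 4 * (s / 2 + δ)) := by gcongr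
  have i3 := mul_le_mul_of_nonneg_left hδ₁q hL
  have i4 : C * ρ ^ 3 * l ^ 4 * T ≤ R * l ^ 4 * G * (δ / 2) := by
    have h1 : C * T ≤ δ * G := by
      refine (mul_le_mul_of_nonneg_left hT hC).trans ?_
      rw [← mul_assoc]
      refine mul_le_mul_of_nonneg_right ?_ hG
      rw [mul_div_assoc', div_le_iff₀ (by positivity)]
      linarith
    -- here `ρ ≤ 3 / 2` enters
    have h4 : ρ ^ 3 ≤ R / 2 := by
      rw [hR, div_div, le_div_iff₀ (by positivity)]
      exact mul_le_of_le_one_right (by positivity) (by linarith)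
    calc C * ρ ^ 3 * l ^ 4 * T = ρ ^ 3 * (l ^ 4 * (C * T)) := by ring
      _ ≤ ρ ^ 3 * (l ^ 4 * (δ * G)) := by gcongr
      _ ≤ R / 2 * (l ^ 4 * (δ * G)) := by gcongr
      _ = _ := by ring
  linarith

namespace ControlledScheme

variable {d r : ℕ} {b : Vec d → Vec d} {σ : Vec d → Vec r →L[ℝ] Vec d} {V : Vec d → ℝ}
  {γ : ℕ → ℝ} {β K K' : ℝ} {Ω : Type*} [MeasurableSpace Ω] {P : Measure Ω} {X₀ : Ω → Vec d}
  {U : ℕ → Ω → Vec r} (h : ControlledScheme b σ V γ β P X₀ U) {φ ϑ : Vec d → ℝ}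

include h

lemma exists_sum_sq_le :
    ∃ C ≥ 0, ∀ n, ∑ k ∈ Finset.range n, γ (k + 1) ^ 2 ≤
      C * ∑ k ∈ Finset.range n, γ (k + 1) ^ ((3 + β) / 2) := by
  have hg := h.step_pos 0
  rw [zero_add] at hg
  refine ⟨γ 1 ^ ((1 - β) / 2), by positivity, fun n => ?_⟩
  rw [Finset.mul_sum]
  refine Finset.sum_le_sum fun k _ => ?_
  have hk := h.step_pos k
  have e : γ (k + 1) ^ 2 = γ (k + 1) ^ ((1 - β) / 2) * γ (k + 1) ^ ((3 + β) / 2) := by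
    rw [← Real.rpow_add hk, ← Real.rpow_natCast]
    congr 1; push_cast; ring
  rw [e]
  exact mul_le_mul_of_nonneg_right (Real.rpow_le_rpow hk.le (h.step_le k)
    (by linarith [h.order.2])) (Real.rpow_nonneg hk.le _)

lemma eventually_sum_sq_le {ε : ℝ} (hε : 0 < ε) :
    ∀ᶠ n in atTop, ∑ k ∈ Finset.range n, γ (k + 1) ^ 2 ≤ ε * Gam γ n := by
  obtain ⟨C, hC, hle⟩ := h.exists_sum_sq_le
  filter_upwards [h.bias 1 C ε hε] with n hn
  have h1 := hle n
  have h0 : 0 ≤ C * ∑ k ∈ Finset.range n, γ (k + 1) ^ ((3 + β) / 2) :=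
    mul_nonneg hC (Finset.sum_nonneg fun k _ => Real.rpow_nonneg (h.step_pos k).le _)
  nlinarith

/-- The sharp bound for the martingale part of `φ`. The martingale is compensated by its quadratic
variation with Hölder exponent `ρ`. The quadratic variation is replaced by its mean `v` with the
help of the Poisson equation: its fluctuation is a sum of `γ_k 𝒜ϑ`, to which the uniform bound
applies and which produces the quartic term. -/
lemma eventually_expInt_martSum_sharp_le (hφ : StepBounds b σ V β K φ)
    (hϑ : StepBounds b σ V β K' ϑ) {v s : ℝ} (hs : s = supFrob σ ^ 2 * supGrad ϑ ^ 2)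
    (hPoisson : ∀ x, gen b σ ϑ x = carre σ φ x - v) {p : ℝ} (hp : 1 < p) {δ : ℝ} (hδ : 0 < δ) :
    ∀ᶠ n in atTop, ∀ l ρ : ℝ, 1 < ρ → ρ ≤ 3 / 2 →
      expInt P (fun ω => l * martSum b σ γ X₀ U (P.map (U 1)) φ n ω) ≤
        ENNReal.ofReal (Real.exp (δ + ρ * (p * l ^ 2 / 2) * Gam γ n * v +
          ρ ^ 3 / (ρ - 1) * l ^ 4 * Gam γ n * (p ^ 3 / 4 * (s / 2 + δ) + δ))) := by
  have := h.prob
  obtain ⟨C, hC, hcomp⟩ := h.exists_expInt_compensated_le_one hφ hp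
  obtain ⟨Cs, hCs, hsq⟩ := h.exists_sum_sq_le
  have hp1 : 0 < p - 1 := by linarith
  set q := p / (p - 1) with hq
  have hq1 : 1 ≤ q := by rw [hq, one_le_div hp1]; linarith
  set δ₁ := min δ (δ / (2 * (q * C ^ 2 + 1))) with hδ₁
  have hδ₁0 : 0 < δ₁ := by positivity
  have hδ₁δ : δ₁ ≤ δ := min_le_left _ _
  have hδ₁q : δ₁ * (q * C ^ 2) ≤ δ / 2 := by
    have h1 : δ₁ ≤ δ / (2 * (q * C ^ 2 + 1)) := min_le_right _ _
    rw [le_div_iff₀ (by positivity)] at h1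
    linarith
  have hrem := h.eventually_expInt_sum_sqrt_le
    (w := fun n k => if k < n then γ (k + 1) ^ 2 else 0)
    (fun n k => by positivity) 0 Cs (fun n => by
      rw [zero_add, Finset.sum_range_succ]
      simp only [lt_irrefl, if_false, add_zero]
      refine (Finset.sum_congr rfl fun k hk => if_pos (Finset.mem_range.1 hk)).trans_le (hsq n))
    hδ₁0
  filter_upwards [hrem, h.eventually_expInt_genSum_uniform_le hϑ hs hδ₁0,
    h.eventually_sum_sq_le (ε := δ / (C + 1)) (by positivity)] with n hn₁ hn₂ hn₃ l ρ hρ1 hρ2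
  have hG := h.Gam_nonneg n
  have hρ0 : 0 < ρ := by linarith
  have hρp : 0 < ρ - 1 := by linarith
  set M := martSum b σ γ X₀ U (P.map (U 1)) φ n with hM
  set D := genSum b σ γ X₀ U ϑ n with hD
  set S : Ω → ℝ := fun ω =>
    ∑ k ∈ Finset.range n, γ (k + 1) ^ 2 * √(V (scheme b σ γ X₀ U k ω)) with hS
  set T := ∑ k ∈ Finset.range n, γ (k + 1) ^ 2 with hT
  have hMm : Measurable M := h.measurable_martSum hφ.contDiff.continuous n
  have hDm : Measurable D := h.measurable_genSum hϑ.contDiff_two n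
  have hSm : Measurable S := Finset.measurable_sum _ fun k _ => (h.measurable_sqrt k).const_mul _
  have hS' : ∀ t, expInt P (fun ω => t * S ω) ≤
      ENNReal.ofReal (Real.exp (δ₁ + δ₁ * t ^ 2 * Gam γ n)) := fun t => by
    refine (expInt_mono fun ω => le_of_eq ?_).trans (hn₁ t)
    rw [Finset.sum_range_succ]
    simp only [lt_irrefl, if_false, zero_mul, add_zero, hS]
    congr 1
    exact Finset.sum_congr rfl fun k hk => by rw [if_pos (Finset.mem_range.1 hk)]
  have hcar : ∀ ω, ∑ k ∈ Finset.range n, γ (k + 1) * carre σ φ (scheme b σ γ X₀ U k ω) =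
      D ω + Gam γ n * v := fun ω => by
    rw [hD, genSum, Gam_eq_sum_range, Finset.sum_mul, ← Finset.sum_add_distrib]
    refine Finset.sum_congr rfl fun k _ => ?_
    rw [hPoisson]; ring
  set ν := p * ρ ^ 2 * l ^ 2 / (2 * (ρ - 1)) with hν
  set τ := C * ρ ^ 2 * l ^ 2 / (ρ - 1) with hτ
  set m := ν * (Gam γ n * v) + C * ρ ^ 4 * l ^ 4 / (ρ - 1) * T with hm
  -- the compensated martingale and the compensator
  set g : Ω → ℝ := fun ω => (ρ - 1) / ρ * ((ν * D ω + τ * S ω) + m) with hg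
  have hgm : Measurable g := by fun_prop
  have hF : expInt P (fun ω => ρ * (l * M ω - g ω)) ≤ ENNReal.ofReal (Real.exp 0) := by
    rw [Real.exp_zero, ENNReal.ofReal_one]
    refine (expInt_mono fun ω => le_of_eq ?_).trans (hcomp n (ρ * l))
    rw [hcar ω, ← hT]
    simp only [hg, hm, hν, hτ, hS, hM]
    field_simp
    ring
  have hDS : expInt P (fun ω => ν * D ω + τ * S ω) ≤ ENNReal.ofReal (Real.exp
      ((δ₁ + (p * ν) ^ 2 * Gam γ n * (s / 2 + δ₁)) / p +
        (δ₁ + δ₁ * (q * τ) ^ 2 * Gam γ n) * ((p - 1) / p))) := by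
    refine expInt_add_le (by fun_prop) (by fun_prop) hp ?_ ?_
    · simpa only [mul_assoc] using hn₂ (p * ν)
    · simpa only [mul_assoc] using hS' (q * τ)
  have hgE : expInt P (fun ω => ρ / (ρ - 1) * g ω) ≤ ENNReal.ofReal (Real.exp
      ((δ₁ + (p * ν) ^ 2 * Gam γ n * (s / 2 + δ₁)) / p +
        (δ₁ + δ₁ * (q * τ) ^ 2 * Gam γ n) * ((p - 1) / p) + m)) := by
    refine (expInt_mono fun ω => le_of_eq ?_).trans (expInt_add_const_le m hDS)
    simp only [hg]
    field_simp
  have hfull := expInt_add_le (f := fun ω => l * M ω - g ω) (g := g) (by fun_prop) (by fun_prop)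
    hρ1 hF hgE
  simp only [sub_add_cancel] at hfull
  refine hfull.trans (ENNReal.ofReal_le_ofReal (Real.exp_le_exp.2 ?_))
  exact compensated_exponent_le hC hρ1 hρ2 hp hδ hδ₁0 hδ₁δ hδ₁q hG hn₃ l v

/-- The Laplace transform of the sums of `γ_k 𝒜φ`, with the sharp constants up to an arbitrarily
small `η`, uniformly in the parameters. -/
lemma eventually_expInt_genSum_sharp_le (hφ : StepBounds b σ V β K φ)
    (hϑ : StepBounds b σ V β K' ϑ) {v s : ℝ} (hv : 0 ≤ v)
    (hs : s = supFrob σ ^ 2 * supGrad ϑ ^ 2)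
    (hPoisson : ∀ x, gen b σ ϑ x = carre σ φ x - v) {η : ℝ} (hη : 0 < η) :
    ∀ᶠ n in atTop, ∀ l ρ : ℝ, 1 < ρ →
      expInt P (fun ω => l * genSum b σ γ X₀ U φ n ω) ≤
        ENNReal.ofReal (Real.exp (η + l ^ 2 * Gam γ n * (ρ * (v / 2 + η)) +
          l ^ 4 * Gam γ n * (ρ ^ 3 / (ρ - 1) * (s / 8 + η)))) := by
  have hs0 : 0 ≤ s := by rw [hs]; positivity
  obtain ⟨t, ht0, ht1, ht2, ht3⟩ : ∃ t : ℝ, 0 < t ∧ 2 * t ≤ η ∧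
      (1 + t) ^ 2 * v / 2 + t ≤ v / 2 + η ∧
      (1 + t) ^ 3 * ((1 + t) ^ 3 / 4 * (s / 2 + t) + t) ≤ s / 8 + η := by
    have c1 : Tendsto (fun t : ℝ => 2 * t) (𝓝[>] 0) (𝓝 (2 * 0)) :=
      (by fun_prop : Continuous fun t : ℝ => 2 * t).continuousAt.mono_left nhdsWithin_le_nhds
    have c2 : Tendsto (fun t : ℝ => (1 + t) ^ 2 * v / 2 + t) (𝓝[>] 0)
        (𝓝 ((1 + 0) ^ 2 * v / 2 + 0)) :=
      (by fun_prop : Continuous fun t : ℝ => (1 + t) ^ 2 * v / 2 + t).continuousAt.mono_left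
        nhdsWithin_le_nhds
    have c3 : Tendsto (fun t : ℝ => (1 + t) ^ 3 * ((1 + t) ^ 3 / 4 * (s / 2 + t) + t)) (𝓝[>] 0)
        (𝓝 ((1 + 0) ^ 3 * ((1 + 0) ^ 3 / 4 * (s / 2 + 0) + 0))) :=
      (by fun_prop : Continuous fun t : ℝ =>
        (1 + t) ^ 3 * ((1 + t) ^ 3 / 4 * (s / 2 + t) + t)).continuousAt.mono_left
        nhdsWithin_le_nhds
    obtain ⟨t, ⟨⟨h1, h2⟩, h3⟩, h4⟩ := (((c1.eventually_le_const (u := η) (by linarith)).and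
      (c2.eventually_le_const (u := v / 2 + η) (by linarith))).and
      (c3.eventually_le_const (u := s / 8 + η) (by linarith))).and
      (self_mem_nhdsWithin : Ioi (0 : ℝ) ∈ 𝓝[>] (0 : ℝ)) |>.exists
    exact ⟨t, h4, h1, h2, h3⟩
  set p := 1 + t with hp
  have hp1 : 1 < p := by linarith
  filter_upwards [h.eventually_expInt_martSum_sharp_le hφ hϑ hs hPoisson hp1 ht0,
    h.eventually_expInt_genSum_le hφ hp1 ht0] with n hn₁ hn₂
  have hG := h.Gam_nonneg n
  -- small values of `ρ`
  have hsmall : ∀ l ρ : ℝ, 1 < ρ → ρ ≤ 3 / 2 →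
      expInt P (fun ω => l * genSum b σ γ X₀ U φ n ω) ≤
        ENNReal.ofReal (Real.exp (η + l ^ 2 * Gam γ n * (ρ * (v / 2 + η)) +
          l ^ 4 * Gam γ n * (ρ ^ 3 / (ρ - 1) * (s / 8 + η)))) := by
    intro l ρ hρ1 hρ2
    have hρp : 0 < ρ - 1 := by linarith
    have h1 := hn₁ (p * -l) ρ hρ1 hρ2
    simp_rw [mul_assoc p] at h1
    refine (hn₂ l _ h1).trans (ENNReal.ofReal_le_ofReal (Real.exp_le_exp.2 ?_))
    set R := ρ ^ 3 / (ρ - 1) with hR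
    have hR0 : 0 ≤ R := by positivity
    have e : (t + ρ * (p * (p * -l) ^ 2 / 2) * Gam γ n * v +
        R * (p * -l) ^ 4 * Gam γ n * (p ^ 3 / 4 * (s / 2 + t) + t)) / p =
        t / p + l ^ 2 * Gam γ n * (ρ * (p ^ 2 * v / 2)) +
          l ^ 4 * Gam γ n * (R * (p ^ 3 * (p ^ 3 / 4 * (s / 2 + t) + t))) := by
      have : p ≠ 0 := by positivity
      clear_value p R
      field_simp
    have e' : t + ρ * (p * (l ^ 2 * p ^ 2) / 2) * Gam γ n * v = t + ρ * (p * (p * -l) ^ 2 / 2) *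
        Gam γ n * v := by ring
    have i1 : t / p ≤ t := div_le_self ht0.le hp1.le
    have i2 : l ^ 2 * Gam γ n * (ρ * (p ^ 2 * v / 2)) + t * l ^ 2 * Gam γ n ≤
        l ^ 2 * Gam γ n * (ρ * (v / 2 + η)) := by
      have h3 : ρ * (p ^ 2 * v / 2) + t ≤ ρ * (v / 2 + η) := by
        have h4 : t * 1 ≤ t * ρ := mul_le_mul_of_nonneg_left hρ1.le ht0.le
        have h5 := mul_le_mul_of_nonneg_left ht2 (by linarith : 0 ≤ ρ)
        linarith
      have := mul_le_mul_of_nonneg_left h3 (mul_nonneg (sq_nonneg l) hG)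
      linarith
    have i3 : l ^ 4 * Gam γ n * (R * (p ^ 3 * (p ^ 3 / 4 * (s / 2 + t) + t))) ≤
        l ^ 4 * Gam γ n * (R * (s / 8 + η)) := by gcongr
    rw [e]
    linarith
  intro l ρ hρ
  rcases le_total ρ (3 / 2) with h1 | h1
  · exact hsmall l ρ hρ h1
  · refine (hsmall l (3 / 2) (by norm_num) le_rfl).trans
      (ENNReal.ofReal_le_ofReal (Real.exp_le_exp.2 ?_))
    have h2 : (3 / 2 : ℝ) ^ 3 / (3 / 2 - 1) ≤ ρ ^ 3 / (ρ - 1) := by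
      have := cube_div_sub_one_ge hρ
      norm_num
      linarith
    gcongr

/-- The deviation bound for every value of the parameter of the exponential Chebyshev
inequality. -/
lemma measureReal_deviation_le (hφ : ContDiff ℝ 2 φ) {n : ℕ} (hG : 0 < Gam γ n) {ρ η A B : ℝ}
    (hL : ∀ l, expInt P (fun ω => l * genSum b σ γ X₀ U φ n ω) ≤
        ENNReal.ofReal (Real.exp (η + l ^ 2 * Gam γ n * (ρ * A) +
          l ^ 4 * Gam γ n * (ρ ^ 3 / (ρ - 1) * B)))) (a : ℝ) {l : ℝ} (hl : 0 < l) :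
    P.real {ω | a ≤ |√(Gam γ n) * empirical γ (scheme b σ γ X₀ U) n (gen b σ φ) ω|} ≤
      2 * Real.exp η * Real.exp (quartic a (Gam γ n) A B ρ l) := by
  have := h.prob
  set G := Gam γ n with hGdef
  set D := genSum b σ γ X₀ U φ n with hD
  have hDm : Measurable D := h.measurable_genSum hφ n
  have hsG : 0 < √G := Real.sqrt_pos.2 hG
  have hsq : √G * √G = G := Real.mul_self_sqrt hG.le
  have hemp : ∀ ω, √G * empirical γ (scheme b σ γ X₀ U) n (gen b σ φ) ω = D ω / √G := by
    intro ω
    have e : ∑ k ∈ Finset.Icc 1 n, γ k * gen b σ φ (scheme b σ γ X₀ U (k - 1) ω) = D ω := by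
      have := Finset.sum_Ico_add' (fun k => γ k * gen b σ φ (scheme b σ γ X₀ U (k - 1) ω)) 0 n 1
      rw [hD, genSum, Finset.range_eq_Ico]
      simp only [add_tsub_cancel_right] at this
      rw [this]
      rfl
    rw [empirical, e, ← hGdef]
    nth_rewrite 2 [← hsq]
    field_simp
  have hbound : ∀ ς : ℝ, ς ^ 2 = 1 → P {ω | a * √G ≤ ς * D ω} ≤
      ENNReal.ofReal (Real.exp η * Real.exp (quartic a G A B ρ l)) := by
    intro ς hς
    have h1 := hL (ς * (l / G))
    have h2 : P {ω | a * √G ≤ ς * D ω} ≤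
        expInt P (fun ω => ς * (l / G) * D ω + -(a * l / √G)) := by
      refine meas_le_lintegral₀ (by fun_prop) fun ω hω => ?_
      rw [← ENNReal.ofReal_one]
      refine ENNReal.ofReal_le_ofReal (Real.one_le_exp ?_)
      have h3 := mul_le_mul_of_nonneg_left (show a * √G ≤ ς * D ω from hω)
        (by positivity : 0 ≤ l / G)
      have h4 : l / G * (a * √G) = a * l / √G := by
        nth_rewrite 1 [← hsq]
        field_simp
      linarith
    refine h2.trans ((expInt_add_const_le _ h1).trans_eq ?_)
    rw [← Real.exp_add]
    congr 2
    have e2 : (ς * (l / G)) ^ 2 = l ^ 2 / G ^ 2 := by rw [mul_pow, hς]; ring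
    have e4 : (ς * (l / G)) ^ 4 = l ^ 4 / G ^ 4 := by
      rw [mul_pow, show ς ^ 4 = (ς ^ 2) ^ 2 by ring, hς]; ring
    rw [e2, e4, quartic]
    have hR : l ^ 4 / G ^ 4 * G = l ^ 4 / G ^ 3 := by field_simp
    have hR2 : l ^ 2 / G ^ 2 * G = l ^ 2 / G := by field_simp
    rw [hR, hR2]
    ring
  have hsub : {ω | a ≤ |√G * empirical γ (scheme b σ γ X₀ U) n (gen b σ φ) ω|} ⊆
      {ω | a * √G ≤ 1 * D ω} ∪ {ω | a * √G ≤ -1 * D ω} := by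
    intro ω hω
    simp only [mem_ofPred_eq, hemp, mem_union] at hω ⊢
    rw [abs_div, abs_of_pos hsG, le_div_iff₀ hsG] at hω
    rcases le_abs.1 hω with h1 | h1
    · left; linarith
    · right; linarith
  have hmeas : P {ω | a ≤ |√G * empirical γ (scheme b σ γ X₀ U) n (gen b σ φ) ω|} ≤
      ENNReal.ofReal (2 * Real.exp η * Real.exp (quartic a G A B ρ l)) := by
    refine (measure_mono hsub).trans ((measure_union_le _ _).trans
      ((add_le_add (hbound 1 (by norm_num)) (hbound (-1) (by norm_num))).trans_eq ?_))
    rw [← ENNReal.ofReal_add (by positivity) (by positivity)]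
    congr 1; ring
  exact ENNReal.toReal_le_of_le_ofReal (by positivity) hmeas

end ControlledScheme

/-! ### The minimum of the quartic -/

lemma cbrt_pow_three (x : ℝ) : cbrt x ^ 3 = x := by
  have h : ∀ y : ℝ, 0 ≤ y → (y ^ (1 / 3 : ℝ)) ^ 3 = y := fun y hy => by
    rw [← Real.rpow_natCast, ← Real.rpow_mul hy]
    norm_num
  unfold cbrt
  split_ifs with hx
  · exact h x hx
  · rw [Odd.neg_pow (by decide), h (-x) (by linarith), neg_neg]

lemma pow_three_injective : Function.Injective fun x : ℝ => x ^ 3 :=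
  (Odd.strictMono_pow (by decide : Odd 3)).injective

lemma cbrt_pos {x : ℝ} (hx : 0 < x) : 0 < cbrt x := by
  rw [cbrt, if_pos hx.le]
  positivity

/-- Cardano's formula. -/
lemma cardano {P Q : ℝ} (hD : 0 ≤ Q ^ 2 + P ^ 3) :
    (cbrt (Q + √(Q ^ 2 + P ^ 3)) + cbrt (Q - √(Q ^ 2 + P ^ 3))) ^ 3 +
      3 * P * (cbrt (Q + √(Q ^ 2 + P ^ 3)) + cbrt (Q - √(Q ^ 2 + P ^ 3))) = 2 * Q := by
  set w := √(Q ^ 2 + P ^ 3) with hw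
  have hw2 : w ^ 2 = Q ^ 2 + P ^ 3 := Real.sq_sqrt hD
  have h1 := cbrt_pow_three (Q + w)
  have h2 := cbrt_pow_three (Q - w)
  set x := cbrt (Q + w)
  set y := cbrt (Q - w)
  have h3 : x * y = -P := by
    apply pow_three_injective
    simp only
    rw [mul_pow, h1, h2, Odd.neg_pow (by decide)]
    linarith
  linear_combination h1 + h2 + 3 * (x + y) * h3

/-- `Φ(a, ρ)` solves the critical point equation of the quartic, in normalized form, and is
positive. -/
lemma cardanoPhi_spec {a G A B ρ : ℝ} (ha : 0 < a) (hG : 0 < G) (hA : 0 < A) (hB : 0 < B)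
    (hρ : 1 < ρ) : 0 < cardanoPhi a G A B ρ ∧
      cardanoPhi a G A B ρ ^ 3 + 2 * cbrt (ρ - 1) * A / B * cardanoPhi a G A B ρ =
        2 * (a / (√G * B)) := by
  have hsG : 0 < √G := Real.sqrt_pos.2 hG
  have hc : cbrt (ρ - 1) ^ 3 = ρ - 1 := cbrt_pow_three _
  have hcpos : 0 < cbrt (ρ - 1) := cbrt_pos (by linarith)
  have e : a ^ 2 / (B ^ 2 * G) + (ρ - 1) * (2 * A / (3 * B)) ^ 3 =
      (a / (√G * B)) ^ 2 + (cbrt (ρ - 1) * (2 * A / (3 * B))) ^ 3 := by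
    have e1 : (a / (√G * B)) ^ 2 = a ^ 2 / (B ^ 2 * G) := by
      rw [div_pow, mul_pow, Real.sq_sqrt hG.le, mul_comm G]
    have e2 : (cbrt (ρ - 1) * (2 * A / (3 * B))) ^ 3 = (ρ - 1) * (2 * A / (3 * B)) ^ 3 := by
      rw [mul_pow, hc]
    rw [e1, e2]
  have hφ : cardanoPhi a G A B ρ ^ 3 + 2 * cbrt (ρ - 1) * A / B * cardanoPhi a G A B ρ =
      2 * (a / (√G * B)) := by
    have h1 := cardano (P := cbrt (ρ - 1) * (2 * A / (3 * B))) (Q := a / (√G * B)) (by positivity)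
    rw [← e] at h1
    rw [← h1, cardanoPhi]
    field_simp
  refine ⟨?_, hφ⟩
  by_contra hneg
  push Not at hneg
  have h1 : cardanoPhi a G A B ρ ^ 3 ≤ 0 := Odd.pow_nonpos (by decide) hneg
  have h2 : 2 * cbrt (ρ - 1) * A / B * cardanoPhi a G A B ρ ≤ 0 :=
    mul_nonpos_of_nonneg_of_nonpos (by positivity) hneg
  have h3 : 0 < 2 * (a / (√G * B)) := by positivity
  linarith

/-- A convex quartic is minimal at its critical point. -/
lemma quartic_min {α β δ x : ℝ} (hβ : 0 ≤ β) (hδ : 0 ≤ δ)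
    (hx : -α + 2 * β * x + 4 * δ * x ^ 3 = 0) (y : ℝ) :
    -(α * x) + β * x ^ 2 + δ * x ^ 4 ≤ -(α * y) + β * y ^ 2 + δ * y ^ 4 := by
  have e : -(α * y) + β * y ^ 2 + δ * y ^ 4 - (-(α * x) + β * x ^ 2 + δ * x ^ 4) =
      β * (y - x) ^ 2 + δ * ((y - x) ^ 2 * ((y + x) ^ 2 + 2 * x ^ 2)) := by
    linear_combination (y - x) * hx
  have : 0 ≤ β * (y - x) ^ 2 + δ * ((y - x) ^ 2 * ((y + x) ^ 2 + 2 * x ^ 2)) := by positivity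
  linarith

lemma isLeast_quartic {a G A B ρ : ℝ} (ha : 0 < a) (hG : 0 < G) (hA : 0 < A) (hB : 0 < B)
    (hρ : 1 < ρ) : IsLeast (quartic a G A B ρ '' Ioi 0) (Pmin a G A B ρ) := by
  have hsG : 0 < √G := Real.sqrt_pos.2 hG
  obtain ⟨hpos, hcrit⟩ := cardanoPhi_spec ha hG hA hB hρ
  have hc : cbrt (ρ - 1) ^ 3 = ρ - 1 := cbrt_pow_three _
  have hcpos : 0 < cbrt (ρ - 1) := cbrt_pos (by linarith)
  have hρp : 0 < ρ - 1 := by linarith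
  have hρ0 : 0 < ρ := by linarith
  set Φ := cardanoPhi a G A B ρ with hΦ
  set c := cbrt (ρ - 1) with hcdef
  -- the critical point
  set x := c * G * Φ / (2 * ρ) with hx
  have hxpos : 0 < x := by positivity
  have hq : ∀ l, quartic a G A B ρ l = -(a / √G * l) + ρ * A / G * l ^ 2 +
      ρ ^ 3 / (ρ - 1) * B / G ^ 3 * l ^ 4 := fun l => by
    rw [quartic]; ring
  have hx0 : -(a / √G) + 2 * (ρ * A / G) * x + 4 * (ρ ^ 3 / (ρ - 1) * B / G ^ 3) * x ^ 3 = 0 := by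
    have e1 : 2 * (ρ * A / G) * x = c * A * Φ := by rw [hx]; field_simp
    have e2 : 4 * (ρ ^ 3 / (ρ - 1) * B / G ^ 3) * x ^ 3 = B / 2 * Φ ^ 3 := by
      rw [hx, div_pow, mul_pow, mul_pow, hc]; field_simp; ring
    have e3 : a / √G = B / 2 * (2 * (a / (√G * B))) := by field_simp
    rw [e1, e2, e3, ← hcrit]
    field_simp
    ring
  have hval : quartic a G A B ρ x = Pmin a G A B ρ := by
    have e1 : quartic a G A B ρ x = -(3 / 4 * (a / √G * x)) + ρ * A / G * x ^ 2 / 2 := by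
      rw [hq]
      linear_combination x / 4 * hx0
    rw [e1, Pmin, ← hΦ, ← hcdef, hx]
    have hG2 : G = √G * √G := (Real.mul_self_sqrt hG.le).symm
    clear_value Φ c
    set g := √G
    rw [hG2]
    field_simp
    ring
  refine ⟨⟨x, hxpos, hval⟩, ?_⟩
  rintro _ ⟨l, -, rfl⟩
  rw [← hval, hq, hq]
  exact quartic_min (by positivity) (by positivity) hx0 l

/-- The quartic vanishes at the endpoint `0` of the half-line on which it is minimized. -/
lemma Pmin_nonpos {a G A B ρ : ℝ} (ha : 0 < a) (hG : 0 < G) (hA : 0 < A) (hB : 0 < B)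
    (hρ : 1 < ρ) : Pmin a G A B ρ ≤ 0 := by
  have hcont : ContinuousWithinAt (quartic a G A B ρ) (Ioi 0) 0 := by
    unfold quartic
    fun_prop
  have h0 : quartic a G A B ρ 0 = 0 := by simp [quartic]
  rw [← h0]
  refine ge_of_tendsto hcont ?_
  filter_upwards [self_mem_nhdsWithin] with l hl
  exact (isLeast_quartic ha hG hA hB hρ).2 ⟨l, hl, rfl⟩

/-! ### Gaussian and super-Gaussian regimes -/

/-- Lower bound of the quartic by its quadratic part. -/
lemma le_quartic_gaussian {a G A B ρ l : ℝ} (hG : 0 < G) (hA : 0 < A) (hB : 0 < B)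
    (hρ : 1 < ρ) : -(a ^ 2 / (4 * A * ρ)) ≤ quartic a G A B ρ l := by
  have hsG : 0 < √G := Real.sqrt_pos.2 hG
  have hρp : 0 < ρ - 1 := by linarith
  have hρ0 : 0 < ρ := by linarith
  have e : quartic a G A B ρ l + a ^ 2 / (4 * A * ρ) =
      ρ * A * (l / √G - a / (2 * A * ρ)) ^ 2 + l ^ 4 / G ^ 3 * (ρ ^ 3 / (ρ - 1) * B) := by
    have hG2 : l ^ 2 / G = (l / √G) ^ 2 := by rw [div_pow, Real.sq_sqrt hG.le]
    rw [quartic, hG2]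
    field_simp
    ring
  have : 0 ≤ ρ * A * (l / √G - a / (2 * A * ρ)) ^ 2 +
      l ^ 4 / G ^ 3 * (ρ ^ 3 / (ρ - 1) * B) := by positivity
  linarith

/-- The value of the quartic at the minimizer of its quadratic part. -/
lemma quartic_gaussian {a G A B ρ : ℝ} (hG : 0 < G) (hA : 0 < A) (hρ : 1 < ρ) :
    quartic a G A B ρ (√G * a / (2 * ρ * A)) =
      -(a ^ 2 / (4 * A * ρ)) * (1 - (a / √G) ^ 2 * B / (4 * A ^ 3 * (ρ - 1))) := by
  have hsG : 0 < √G := Real.sqrt_pos.2 hG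
  have hρp : ρ - 1 ≠ 0 := by linarith
  have hρ0 : 0 < ρ := by linarith
  rw [quartic]
  have hG2 : G = √G * √G := (Real.mul_self_sqrt hG.le).symm
  set g := √G
  rw [hG2]
  field_simp
  ring

/-- Lower bound of the quartic at `ρ = 3 / 2` by its terms of order one and four; here
`k = B ^ (1 / 3)` and `τ = (a / √G) ^ (1 / 3)`, entered through their cubes. -/
lemma le_quartic_superGaussian {a G A k τ l : ℝ} (hG : 0 < G) (hA : 0 < A) (hk : 0 < k)
    (hτ : τ ^ 3 = a / √G) :
    -(τ ^ 4 * G / (4 * k)) ≤ quartic a G A (k ^ 3) (1 + 1 / 2) l := by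
  have h := quartic_min (α := τ ^ 3) (β := 0) (δ := 27 / 4 * k ^ 3 / G ^ 3) (x := τ * G / (3 * k))
    le_rfl (by positivity) (by field_simp; ring) l
  have e1 : -(τ ^ 3 * (τ * G / (3 * k))) + 0 * (τ * G / (3 * k)) ^ 2 +
      27 / 4 * k ^ 3 / G ^ 3 * (τ * G / (3 * k)) ^ 4 = -(τ ^ 4 * G / (4 * k)) := by
    field_simp
    ring
  have e2 : quartic a G A (k ^ 3) (1 + 1 / 2) l = -(τ ^ 3 * l) + 0 * l ^ 2 +
      27 / 4 * k ^ 3 / G ^ 3 * l ^ 4 + 3 / 2 * A * l ^ 2 / G := by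
    rw [quartic, hτ]
    ring
  have : 0 ≤ 3 / 2 * A * l ^ 2 / G := by positivity
  linarith

/-- The value of the quartic at `ρ = 3 / 2` at the minimizer of its terms of order one and
four. -/
lemma quartic_superGaussian {a G A k τ : ℝ} (hG : 0 < G) (hk : 0 < k) (hτ0 : 0 < τ)
    (hτ : τ ^ 3 = a / √G) :
    quartic a G A (k ^ 3) (1 + 1 / 2) (τ * G / (3 * k)) =
      -(τ ^ 4 * G / (4 * k)) * (1 - 2 * A / (3 * k * τ ^ 2)) := by
  have e : quartic a G A (k ^ 3) (1 + 1 / 2) (τ * G / (3 * k)) =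
      -(τ ^ 3 * (τ * G / (3 * k))) + 27 / 4 * k ^ 3 / G ^ 3 * (τ * G / (3 * k)) ^ 4 +
        3 / 2 * A * (τ * G / (3 * k)) ^ 2 / G := by
    rw [quartic, hτ]
    ring
  rw [e]
  field_simp
  ring

/-- In the Gaussian regime, with `w = √B / (2 A^{3/2})`, the choice `ρ = 1 + w a / √G` gives
`-P_min = a² / (4 A)` up to a factor between `(1 - w a / √G) / (1 + w a / √G)` and `1`. -/
lemma Pmin_gaussian_bounds {a G A B : ℝ} (ha : 0 < a) (hG : 0 < G) (hA : 0 < A) (hB : 0 < B) :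
    -(a ^ 2 / (4 * A)) ≤
        Pmin a G A B (1 + 1 / 2 * (√B * a / (A ^ (3 / 2 : ℝ) * √G))) ∧
      Pmin a G A B (1 + 1 / 2 * (√B * a / (A ^ (3 / 2 : ℝ) * √G))) ≤
        -(a ^ 2 / (4 * A)) * ((1 - √B / (2 * A ^ (3 / 2 : ℝ)) * (a / √G)) /
          (1 + √B / (2 * A ^ (3 / 2 : ℝ)) * (a / √G))) := by
  have hsG : 0 < √G := Real.sqrt_pos.2 hG
  have hsB : 0 < √B := Real.sqrt_pos.2 hB
  have hA3 : (A ^ (3 / 2 : ℝ)) ^ 2 = A ^ 3 := by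
    rw [← Real.rpow_natCast, ← Real.rpow_mul hA.le, ← Real.rpow_natCast]
    norm_num
  have hAp : 0 < A ^ (3 / 2 : ℝ) := by positivity
  set D := A ^ (3 / 2 : ℝ)
  set w := √B / (2 * D) with hw
  have hwpos : 0 < w := by positivity
  have hw2 : B / (4 * A ^ 3) = w ^ 2 := by
    rw [hw, div_pow, mul_pow, hA3, Real.sq_sqrt hB.le]
    norm_num
  have e : 1 + 1 / 2 * (√B * a / (D * √G)) = 1 + w * (a / √G) := by
    rw [hw]
    field_simp
  rw [e]
  set x := a / √G with hx
  have hxpos : 0 < x := by positivity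
  have hρ : 1 < 1 + w * x := by
    have : 0 < w * x := by positivity
    linarith
  have hρ0 : 0 < 1 + w * x := by linarith
  have hleast := isLeast_quartic ha hG hA hB hρ
  constructor
  · obtain ⟨l, -, hl⟩ := hleast.1
    rw [← hl]
    refine le_trans ?_ (le_quartic_gaussian hG hA hB hρ)
    rw [neg_le_neg_iff]
    exact div_le_div_of_nonneg_left (by positivity) (by positivity)
      (le_mul_of_one_le_right (by positivity) hρ.le)
  · refine (hleast.2 ⟨_, (by positivity : 0 < √G * a / (2 * (1 + w * x) * A)), rfl⟩).trans ?_
    rw [quartic_gaussian hG hA hρ, ← hx]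
    have e1 : x ^ 2 * B / (4 * A ^ 3 * (1 + w * x - 1)) = w * x := by
      have : x ^ 2 * B / (4 * A ^ 3 * (1 + w * x - 1)) = x ^ 2 * (B / (4 * A ^ 3)) / (w * x) := by
        rw [add_sub_cancel_left]
        field_simp
      rw [this, hw2]
      field_simp
    rw [e1]
    apply le_of_eq
    field_simp

/-- In the super-Gaussian regime the choice `ρ = 3 / 2` gives
`-P_min = a^{4/3} G^{1/3} / (4 B^{1/3})` up to a factor that tends to `1` as `a / √G → ∞`. -/
lemma Pmin_superGaussian_bounds {a G A B : ℝ} (ha : 0 < a) (hG : 0 < G) (hA : 0 < A)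
    (hB : 0 < B) :
    -(a ^ (4 / 3 : ℝ) * G ^ (1 / 3 : ℝ) / (4 * B ^ (1 / 3 : ℝ))) ≤ Pmin a G A B (1 + 1 / 2) ∧
      Pmin a G A B (1 + 1 / 2) ≤
        -(a ^ (4 / 3 : ℝ) * G ^ (1 / 3 : ℝ) / (4 * B ^ (1 / 3 : ℝ))) *
          (1 - 2 * A / (3 * B ^ (1 / 3 : ℝ) * (a / √G) ^ (2 / 3 : ℝ))) := by
  have hsG : 0 < √G := Real.sqrt_pos.2 hG
  have hx : 0 < a / √G := by positivity
  have hk : 0 < B ^ (1 / 3 : ℝ) := by positivity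
  have hkB : (B ^ (1 / 3 : ℝ)) ^ 3 = B := by
    rw [← Real.rpow_natCast, ← Real.rpow_mul hB.le]
    norm_num
  have hτ0 : 0 < (a / √G) ^ (1 / 3 : ℝ) := by positivity
  have hτ : ((a / √G) ^ (1 / 3 : ℝ)) ^ 3 = a / √G := by
    rw [← Real.rpow_natCast, ← Real.rpow_mul hx.le]
    norm_num
  have hτ2 : (a / √G) ^ (2 / 3 : ℝ) = ((a / √G) ^ (1 / 3 : ℝ)) ^ 2 := by
    rw [← Real.rpow_natCast, ← Real.rpow_mul hx.le]
    norm_num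
  have hy : a ^ (4 / 3 : ℝ) * G ^ (1 / 3 : ℝ) = ((a / √G) ^ (1 / 3 : ℝ)) ^ 4 * G := by
    rw [← Real.rpow_natCast, ← Real.rpow_mul hx.le, Real.div_rpow ha.le hsG.le, Real.sqrt_eq_rpow,
      ← Real.rpow_mul hG.le, div_mul_eq_mul_div, mul_div_assoc]
    congr 1
    · norm_num
    · nth_rewrite 2 [← Real.rpow_one G]
      rw [← Real.rpow_sub hG]
      norm_num
  rw [hτ2, hy]
  set τ := (a / √G) ^ (1 / 3 : ℝ)
  set k := B ^ (1 / 3 : ℝ)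
  rw [← hkB]
  have hleast := isLeast_quartic ha hG hA (by positivity : 0 < k ^ 3)
    (by norm_num : (1 : ℝ) < 1 + 1 / 2)
  constructor
  · obtain ⟨l, -, hl⟩ := hleast.1
    rw [← hl]
    exact le_quartic_superGaussian hG hA hk hτ
  · refine (hleast.2 ⟨_, (by positivity : 0 < τ * G / (3 * k)), rfl⟩).trans ?_
    rw [quartic_superGaussian hG hk hτ0 hτ]

/-! ### Sequences of constants -/

/-- Diagonal extraction: a property that holds eventually for every fixed `δ > 0` holds eventually
along some sequence `δ n` decreasing to zero. -/
lemma exists_antitone_tendsto_zero {p : ℝ → ℕ → Prop} (hp : ∀ δ > 0, ∀ᶠ n in atTop, p δ n) :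
    ∃ δ : ℕ → ℝ, Antitone δ ∧ (∀ n, 0 < δ n) ∧ Tendsto δ atTop (𝓝 0) ∧
      ∀ᶠ n in atTop, p (δ n) n := by
  classical
  have h0 : ∀ k : ℕ, ∃ N : ℕ, ∀ n ≥ N, p (1 / ((k : ℝ) + 1)) n := fun k =>
    eventually_atTop.1 (hp _ (by positivity))
  choose N hN using h0
  -- `K n` is the largest rank up to which all thresholds are below `n`
  set Q : ℕ → ℕ → Prop := fun n k => ∀ j ≤ k, N j ≤ n
  set K : ℕ → ℕ := fun n => Nat.findGreatest (Q n) n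
  have hK : Monotone K := fun m n hmn =>
    Nat.findGreatest_mono (fun k hk j hj => (hk j hj).trans hmn) hmn
  have hKlim : Tendsto K atTop atTop := by
    refine tendsto_atTop.2 fun k => ?_
    filter_upwards [eventually_ge_atTop k,
      eventually_ge_atTop ((Finset.range (k + 1)).sup N)] with n hk hn
    exact Nat.le_findGreatest hk fun j hj =>
      (Finset.le_sup (f := N) (Finset.mem_range.2 (Nat.lt_succ_of_le hj))).trans hn
  refine ⟨fun n => 1 / ((K n : ℝ) + 1), fun m n hmn => ?_, fun n => by positivity,
    tendsto_one_div_add_atTop_nhds_zero_nat.comp hKlim, ?_⟩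
  · have : (K m : ℝ) ≤ K n := by exact_mod_cast hK hmn
    simp only
    gcongr
  · filter_upwards [eventually_ge_atTop (N 0)] with n hn
    have h := Nat.findGreatest_spec (P := Q n) (Nat.zero_le n) fun j hj => by
      rw [Nat.le_zero.1 hj]
      exact hn
    exact hN _ n (h _ le_rfl)

/-- A sequence that tends to `1` has an eventually monotone minorant that tends to `1`. The
minorization is asked only where an eventually true property `p` holds: the sequence vanishes at the
other ranks. -/
lemma exists_deviationConstants {C u : ℕ → ℝ} (hC0 : ∀ n, 0 ≤ C n) (hC : Antitone C)
    (hClim : Tendsto C atTop (𝓝 1)) (hu : Tendsto u atTop (𝓝 1)) {p : ℕ → Prop}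
    (hp : ∀ᶠ n in atTop, p n) :
    ∃ c, DeviationConstants c C ∧ ∀ n, c n = 0 ∨ p n ∧ c n ≤ u n := by
  obtain ⟨δ, hδ, hδ0, hδlim, hδu⟩ := exists_antitone_tendsto_zero
    (p := fun δ n => 1 - δ ≤ u n) fun δ hδ =>
      hu.eventually (eventually_ge_nhds (show 1 - δ < 1 by linarith))
  obtain ⟨N, hN⟩ := eventually_atTop.1 (hδu.and hp)
  have hev : ∀ n ≥ N, (if N ≤ n then max 0 (1 - δ n) else 0) = max 0 (1 - δ n) :=
    fun n hn => if_pos hn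
  refine ⟨fun n => if N ≤ n then max 0 (1 - δ n) else 0, ⟨fun n => ?_, hC0, ⟨N, ?_,
    hC.antitoneOn _⟩, ?_, hClim⟩, fun n => ?_⟩
  · split_ifs
    · exact le_max_left _ _
    · exact le_rfl
  · intro m hm n hn hmn
    simp only
    rw [hev m hm, hev n hn]
    exact max_le_max le_rfl (by linarith [hδ hmn])
  · have h : Tendsto (fun n => max 0 (1 - δ n)) atTop (𝓝 (max 0 (1 - 0))) :=
      tendsto_const_nhds.max (tendsto_const_nhds.sub hδlim)
    rw [sub_zero, max_eq_right zero_le_one] at h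
    refine h.congr' ?_
    filter_upwards [eventually_ge_atTop N] with n hn using (hev n hn).symm
  · simp only
    split_ifs with hn
    · rcases le_total (1 - δ n) 0 with h | h
      · left
        exact max_eq_left h
      · right
        rw [max_eq_right h]
        exact ⟨(hN n hn).2, (hN n hn).1⟩
    · left
      rfl

/-- An eventual exponential bound for probabilities becomes a bound for all ranks, at the price of
lowering the constant in the exponent. -/
lemma exists_deviationConstants_le {C u : ℕ → ℝ} (hC1 : ∀ n, 1 ≤ C n) (hC : Antitone C)
    (hClim : Tendsto C atTop (𝓝 1)) (hu : Tendsto u atTop (𝓝 1)) {prob F : ℕ → ℝ → ℝ}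
    (hprob : ∀ n a, prob n a ≤ 1) (hF : ∀ n, ∀ a > 0, 0 ≤ F n a) {S : ℕ → ℝ → Prop}
    (h : ∀ᶠ n in atTop, ∀ a > 0, S n a → prob n a ≤ 2 * C n * Real.exp (-(u n * F n a))) :
    ∃ c C' : ℕ → ℝ, DeviationConstants c C' ∧ ∀ n ≥ 1, ∀ a > 0, S n a →
      prob n a ≤ 2 * C' n * Real.exp (-(c n * F n a)) := by
  obtain ⟨c, hc, hcu⟩ := exists_deviationConstants (fun n => zero_le_one.trans (hC1 n)) hC hClim
    hu h
  refine ⟨c, C, hc, fun n _ a ha hS => ?_⟩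
  rcases hcu n with h0 | ⟨h1, h2⟩
  · rw [h0, zero_mul, neg_zero, Real.exp_zero]
    linarith [hprob n a, hC1 n]
  · refine (h1 a ha hS).trans ?_
    have := hC1 n
    have := mul_le_mul_of_nonneg_right h2 (hF n a ha)
    gcongr

/-! ### Asymptotics of the minimum -/

section Asymptotics

variable {A B G : ℕ → ℝ} {v s : ℝ}

/-- The factors in the Gaussian regime, `v / (2 A)` being the ratio of `a² / (4 A)` to the limiting
rate `a² / (2 v)`. -/
lemma tendsto_gaussian_factor (hv : 0 < v) (hA : Tendsto A atTop (𝓝 (v / 2)))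
    (hB : Tendsto B atTop (𝓝 (s / 8))) {x : ℕ → ℝ} (hx : Tendsto x atTop (𝓝 0)) :
    Tendsto (fun n => v / (2 * A n) * ((1 - √(B n) / (2 * A n ^ (3 / 2 : ℝ)) * x n) /
      (1 + √(B n) / (2 * A n ^ (3 / 2 : ℝ)) * x n))) atTop (𝓝 1) ∧
    Tendsto (fun n => √(B n) / (2 * A n ^ (3 / 2 : ℝ)) * x n) atTop (𝓝 0) ∧
    Tendsto (fun n => v / (2 * A n)) atTop (𝓝 1) := by
  have hv2 : 0 < v / 2 := by positivity
  have h1 : Tendsto (fun n => v / (2 * A n)) atTop (𝓝 1) := by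
    have := (tendsto_const_nhds (x := v)).div (hA.const_mul 2) (by positivity)
    rwa [mul_div_cancel₀ _ (two_ne_zero' ℝ), div_self hv.ne'] at this
  have h2 : Tendsto (fun n => √(B n) / (2 * A n ^ (3 / 2 : ℝ)) * x n) atTop (𝓝 0) := by
    have := ((hB.sqrt).div ((hA.rpow_const (p := 3 / 2) (Or.inl hv2.ne')).const_mul 2)
      (by positivity)).mul hx
    rwa [mul_zero] at this
  refine ⟨?_, h2, h1⟩
  have := h1.mul (((tendsto_const_nhds (x := (1 : ℝ))).sub h2).div
    ((tendsto_const_nhds (x := (1 : ℝ))).add h2) (by norm_num))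
  simpa using this

lemma tendsto_Pmin_gaussian (hG : ∀ n ≥ 1, 0 < G n) (hA0 : ∀ n, 0 < A n) (hB0 : ∀ n, 0 < B n)
    (hv : 0 < v) (hA : Tendsto A atTop (𝓝 (v / 2))) (hB : Tendsto B atTop (𝓝 (s / 8)))
    {a : ℕ → ℝ} (ha : ∀ n ≥ 1, 0 < a n) (hx : Tendsto (fun n => a n / √(G n)) atTop (𝓝 0)) :
    Tendsto (fun n => Pmin (a n) (G n) (A n) (B n)
        (1 + 1 / 2 * (√(B n) * a n / (A n ^ (3 / 2 : ℝ) * √(G n)))) / (-(a n ^ 2 / (2 * v))))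
      atTop (𝓝 1) := by
  obtain ⟨h1, -, h3⟩ := tendsto_gaussian_factor hv hA hB hx
  refine tendsto_of_tendsto_of_tendsto_of_le_of_le' h1 h3 ?_ ?_
  all_goals
    filter_upwards [eventually_ge_atTop 1] with n hn
    have hA' := hA0 n
    have ha' := ha n hn
    have hm : -(a n ^ 2 / (2 * v)) < 0 := neg_neg_of_pos (by positivity)
    obtain ⟨hl, hr⟩ := Pmin_gaussian_bounds (ha n hn) (hG n hn) (hA0 n) (hB0 n)
    have e : -(a n ^ 2 / (4 * A n)) = v / (2 * A n) * -(a n ^ 2 / (2 * v)) := by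
      field_simp
      ring
    rw [e] at hl hr
  · rw [le_div_iff_of_neg hm]
    linarith
  · rwa [div_le_iff_of_neg hm]

/-- The upper bound for `P_min`, uniform over `a / √G ≤ ε`. -/
lemma Pmin_gaussian_le {a G A B v ε : ℝ} (hv : 0 < v) (ha : 0 < a) (hG : 0 < G) (hA : 0 < A)
    (hB : 0 < B) (hε : a / √G ≤ ε) :
    Pmin a G A B (1 + 1 / 2 * (√B * a / (A ^ (3 / 2 : ℝ) * √G))) ≤
      -(v / (2 * A) * ((1 - √B / (2 * A ^ (3 / 2 : ℝ)) * ε) /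
        (1 + √B / (2 * A ^ (3 / 2 : ℝ)) * ε)) * (a ^ 2 / (2 * v))) := by
  refine (Pmin_gaussian_bounds ha hG hA hB).2.trans ?_
  set w := √B / (2 * A ^ (3 / 2 : ℝ))
  have hw : 0 ≤ w := by positivity
  have hx : 0 < a / √G := div_pos ha (Real.sqrt_pos.2 hG)
  set x := a / √G
  have hwx : w * x ≤ w * ε := mul_le_mul_of_nonneg_left hε hw
  have hwx0 : 0 ≤ w * x := by positivity
  have h : (1 - w * ε) / (1 + w * ε) ≤ (1 - w * x) / (1 + w * x) := by
    rw [div_le_div_iff₀ (by linarith) (by linarith)]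
    linarith
  have e : -(v / (2 * A) * ((1 - w * ε) / (1 + w * ε)) * (a ^ 2 / (2 * v))) =
      -(a ^ 2 / (4 * A)) * ((1 - w * ε) / (1 + w * ε)) := by
    field_simp
    ring
  rw [e]
  exact mul_le_mul_of_nonpos_left h (neg_nonpos.2 (by positivity))

/-- The factors in the super-Gaussian regime. As `B → s / 8`, the rate constant `4 B^{1/3}` tends
to `2 s^{1/3}`. -/
lemma tendsto_superGaussian_factor (hs : 0 < s) (hA : Tendsto A atTop (𝓝 (v / 2)))
    (hB : Tendsto B atTop (𝓝 (s / 8))) {x : ℕ → ℝ} (hx : Tendsto x atTop atTop) :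
    Tendsto (fun n => 2 * s ^ (1 / 3 : ℝ) / (4 * B n ^ (1 / 3 : ℝ)) *
      (1 - 2 * A n / (3 * B n ^ (1 / 3 : ℝ) * x n ^ (2 / 3 : ℝ)))) atTop (𝓝 1) ∧
    Tendsto (fun n => 2 * s ^ (1 / 3 : ℝ) / (4 * B n ^ (1 / 3 : ℝ))) atTop (𝓝 1) := by
  have hs8 : 0 < s / 8 := by positivity
  have hk : Tendsto (fun n => B n ^ (1 / 3 : ℝ)) atTop (𝓝 ((s / 8) ^ (1 / 3 : ℝ))) :=
    hB.rpow_const (Or.inl hs8.ne')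
  have hk0 : 0 < (s / 8) ^ (1 / 3 : ℝ) := by positivity
  have h1 : Tendsto (fun n => 2 * s ^ (1 / 3 : ℝ) / (4 * B n ^ (1 / 3 : ℝ))) atTop (𝓝 1) := by
    have := (tendsto_const_nhds (x := 2 * s ^ (1 / 3 : ℝ))).div (hk.const_mul 4) (by positivity)
    have e : 4 * (s / 8) ^ (1 / 3 : ℝ) = 2 * s ^ (1 / 3 : ℝ) := by
      have e8 : (8 : ℝ) ^ (1 / 3 : ℝ) = 2 := by
        rw [show (8 : ℝ) = 2 ^ (3 : ℝ) by norm_num, ← Real.rpow_mul (by norm_num)]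
        norm_num
      rw [Real.div_rpow hs.le (by norm_num), e8]
      ring
    rwa [e, div_self (by positivity)] at this
  have h2 : Tendsto (fun n => 2 * A n / (3 * B n ^ (1 / 3 : ℝ) * x n ^ (2 / 3 : ℝ))) atTop
      (𝓝 0) := by
    have hx' : Tendsto (fun n => x n ^ (2 / 3 : ℝ)) atTop atTop :=
      (tendsto_rpow_atTop (by norm_num)).comp hx
    refine (hA.const_mul 2).div_atTop ?_
    exact (hk.const_mul 3).pos_mul_atTop (by positivity) hx'
  refine ⟨?_, h1⟩
  have := h1.mul ((tendsto_const_nhds (x := (1 : ℝ))).sub h2)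
  simpa using this

lemma tendsto_Pmin_superGaussian (hG : ∀ n ≥ 1, 0 < G n) (hA0 : ∀ n, 0 < A n)
    (hB0 : ∀ n, 0 < B n) (hs : 0 < s) (hA : Tendsto A atTop (𝓝 (v / 2)))
    (hB : Tendsto B atTop (𝓝 (s / 8))) {a : ℕ → ℝ} (ha : ∀ n ≥ 1, 0 < a n)
    (hx : Tendsto (fun n => a n / √(G n)) atTop atTop) :
    Tendsto (fun n => Pmin (a n) (G n) (A n) (B n) (1 + 1 / 2) /
        (-(a n ^ (4 / 3 : ℝ) * G n ^ (1 / 3 : ℝ) / (2 * s ^ (1 / 3 : ℝ))))) atTop (𝓝 1) := by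
  obtain ⟨h1, h3⟩ := tendsto_superGaussian_factor hs hA hB hx
  refine tendsto_of_tendsto_of_tendsto_of_le_of_le' h1 h3 ?_ ?_
  all_goals
    filter_upwards [eventually_ge_atTop 1] with n hn
    have hB' := hB0 n
    have ha' := ha n hn
    have hG' := hG n hn
    have hm : -(a n ^ (4 / 3 : ℝ) * G n ^ (1 / 3 : ℝ) / (2 * s ^ (1 / 3 : ℝ))) < 0 :=
      neg_neg_of_pos (by positivity)
    obtain ⟨hl, hr⟩ := Pmin_superGaussian_bounds (ha n hn) (hG n hn) (hA0 n) (hB0 n)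
    have e : -(a n ^ (4 / 3 : ℝ) * G n ^ (1 / 3 : ℝ) / (4 * B n ^ (1 / 3 : ℝ))) =
        2 * s ^ (1 / 3 : ℝ) / (4 * B n ^ (1 / 3 : ℝ)) *
          -(a n ^ (4 / 3 : ℝ) * G n ^ (1 / 3 : ℝ) / (2 * s ^ (1 / 3 : ℝ))) := by
      field_simp
    rw [e] at hl hr
  · rw [le_div_iff_of_neg hm]
    linarith
  · rwa [div_le_iff_of_neg hm]

/-- The upper bound for `P_min`, uniform over `R ≤ a / √G`. -/
lemma Pmin_superGaussian_le {a G A B s R : ℝ} (hs : 0 < s) (ha : 0 < a) (hG : 0 < G)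
    (hA : 0 < A) (hB : 0 < B) (hR0 : 0 < R) (hR : R ≤ a / √G) :
    Pmin a G A B (1 + 1 / 2) ≤
      -(2 * s ^ (1 / 3 : ℝ) / (4 * B ^ (1 / 3 : ℝ)) *
        (1 - 2 * A / (3 * B ^ (1 / 3 : ℝ) * R ^ (2 / 3 : ℝ))) *
          (a ^ (4 / 3 : ℝ) * G ^ (1 / 3 : ℝ) / (2 * s ^ (1 / 3 : ℝ)))) := by
  refine (Pmin_superGaussian_bounds ha hG hA hB).2.trans ?_
  have h : 1 - 2 * A / (3 * B ^ (1 / 3 : ℝ) * R ^ (2 / 3 : ℝ)) ≤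
      1 - 2 * A / (3 * B ^ (1 / 3 : ℝ) * (a / √G) ^ (2 / 3 : ℝ)) := by
    gcongr
  have e : 2 * s ^ (1 / 3 : ℝ) / (4 * B ^ (1 / 3 : ℝ)) *
        (1 - 2 * A / (3 * B ^ (1 / 3 : ℝ) * R ^ (2 / 3 : ℝ))) *
          (a ^ (4 / 3 : ℝ) * G ^ (1 / 3 : ℝ) / (2 * s ^ (1 / 3 : ℝ))) =
      a ^ (4 / 3 : ℝ) * G ^ (1 / 3 : ℝ) / (4 * B ^ (1 / 3 : ℝ)) *
        (1 - 2 * A / (3 * B ^ (1 / 3 : ℝ) * R ^ (2 / 3 : ℝ))) := by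
    rw [mul_right_comm]
    congr 1
    field_simp
  rw [e, ← neg_mul]
  exact mul_le_mul_of_nonpos_left h (neg_nonpos.2 (by positivity))

end Asymptotics

/-! ### The deviation bounds -/

lemma supFrob_mul_supGrad_rpow {d r : ℕ} (σ : Vec d → Vec r →L[ℝ] Vec d) (ϑ : Vec d → ℝ) :
    (supFrob σ ^ 2 * supGrad ϑ ^ 2) ^ (1 / 3 : ℝ) =
      supFrob σ ^ (2 / 3 : ℝ) * supGrad ϑ ^ (2 / 3 : ℝ) := by
  have h1 : 0 ≤ supFrob σ := Real.iSup_nonneg fun x => Real.sqrt_nonneg _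
  have h2 : 0 ≤ supGrad ϑ := Real.iSup_nonneg fun x => norm_nonneg _
  have e : ∀ y : ℝ, 0 ≤ y → (y ^ 2) ^ (1 / 3 : ℝ) = y ^ (2 / 3 : ℝ) := fun y hy => by
    rw [← Real.rpow_natCast, ← Real.rpow_mul hy]
    norm_num
  rw [Real.mul_rpow (sq_nonneg _) (sq_nonneg _), e _ h1, e _ h2]

theorem theorem6p2 {d r : ℕ} (b : Vec d → Vec d) (σ : Vec d → Vec r →L[ℝ] Vec d)
    (hb : ∃ K : ℝ≥0, LipschitzWith K b) (hσ : ∃ K : ℝ≥0, LipschitzWith K σ)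
    (hσ_bdd : ∃ κ > 0, ∀ x, frobSq (σ x) ≤ κ)
    (V : Vec d → ℝ) (CV αV βV : ℝ) (hV : IsLyapunov b σ V CV αV βV)
    (ν : Measure (Vec d)) (hν : IsInvariantMeasure b σ ν)
    (hν_unique : ∀ ν' : Measure (Vec d), IsInvariantMeasure b σ ν' → ν' = ν)
    (β θ : ℝ) (hβ : β ∈ Ioc (0 : ℝ) 1) (hθ : θ ∈ Ioc (1 / (2 + β)) 1)
    (γ : ℕ → ℝ) (hγ : StepSequence γ θ) (hγ_small : SmallSteps γ V CV αV)
    (φ ϑ : Vec d → ℝ) (hφ : TestRegularity b V β φ) (hϑ : TestRegularity b V β ϑ)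
    (hPoisson : ∀ x, gen b σ ϑ x = carre σ φ x - ∫ y, carre σ φ y ∂ν)
    {Ω : Type*} [MeasurableSpace Ω] (P : Measure Ω) [IsProbabilityMeasure P]
    (X₀ : Ω → Vec d) (hX₀ : Measurable X₀) (hX₀_sub : SubGaussianStart P X₀)
    (U : ℕ → Ω → Vec r) (hU : GaussianConcentration P X₀ U)
    -- abbreviations: the variance, the constant of the quartic term, the deviation probabilities
    (v s : ℝ) (hv : v = ∫ y, carre σ φ y ∂ν) (hs : s = supFrob σ ^ 2 * supGrad ϑ ^ 2)
    (prob : ℕ → ℝ → ℝ)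
    (hprob : ∀ n a, prob n a = P.real {ω | a ≤
      |√(Gam γ n) * empirical γ (scheme b σ γ X₀ U) n (gen b σ φ) ω|}) :
    ∃ c C q qhat qbar e A B : ℕ → ℝ,
      DeviationConstants c C ∧
      (∀ n, 1 < q n ∧ 1 < qhat n ∧ 1 < qbar n ∧ 0 < e n) ∧
      Tendsto q atTop (𝓝 1) ∧ Tendsto qhat atTop (𝓝 1) ∧ Tendsto qbar atTop (𝓝 1) ∧
      Tendsto e atTop (𝓝 0) ∧
      (∀ n, A n = ATilde v (q n) (e n)) ∧
      (∀ n, B n = BTilde s (q n) (qhat n) (qbar n) (e n)) ∧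
      -- the deviation bound
      (∀ n ≥ 1, ∀ a > 0, ∀ ρ > 1,
        prob n a ≤ 2 * C n * Real.exp (c n * Pmin a (Gam γ n) (A n) (B n) ρ)) ∧
      -- `P_min` is the minimum of the quartic
      (∀ n ≥ 1, ∀ a > 0, ∀ ρ > 1,
        IsLeast (quartic a (Gam γ n) (A n) (B n) ρ '' Ioi 0)
          (Pmin a (Gam γ n) (A n) (B n) ρ)) ∧
      -- Gaussian deviations
      (0 < v →
        (∀ a : ℕ → ℝ, (∀ n ≥ 1, 0 < a n) →
          Tendsto (fun n => a n / √(Gam γ n)) atTop (𝓝 0) →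
          Tendsto (fun n => Pmin (a n) (Gam γ n) (A n) (B n)
              (1 + 1 / 2 * (√(B n) * a n / (A n ^ (3 / 2 : ℝ) * √(Gam γ n))))
            / (-(a n ^ 2 / (2 * v)))) atTop (𝓝 1)) ∧
        (∀ ε : ℕ → ℝ, Tendsto ε atTop (𝓝 0) → ∃ c' C' : ℕ → ℝ, DeviationConstants c' C' ∧
          ∀ n ≥ 1, ∀ a > 0, a / √(Gam γ n) ≤ ε n →
            prob n a ≤ 2 * C' n * Real.exp (-(c' n * (a ^ 2 / (2 * v)))))) ∧
      -- super-Gaussian deviations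
      (0 < s →
        (∀ a : ℕ → ℝ, (∀ n ≥ 1, 0 < a n) →
          Tendsto (fun n => a n / √(Gam γ n)) atTop atTop →
          Tendsto (fun n => Pmin (a n) (Gam γ n) (A n) (B n) (1 + 1 / 2)
            / (-(a n ^ (4 / 3 : ℝ) * Gam γ n ^ (1 / 3 : ℝ)
              / (2 * supFrob σ ^ (2 / 3 : ℝ) * supGrad ϑ ^ (2 / 3 : ℝ))))) atTop (𝓝 1)) ∧
        (∀ R : ℕ → ℝ, Tendsto R atTop atTop → ∃ c' C' : ℕ → ℝ, DeviationConstants c' C' ∧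
          ∀ n ≥ 1, ∀ a > 0, R n ≤ a / √(Gam γ n) →
            prob n a ≤ 2 * C' n * Real.exp (-(c' n *
              (a ^ (4 / 3 : ℝ) * Gam γ n ^ (1 / 3 : ℝ)
                / (2 * supFrob σ ^ (2 / 3 : ℝ) * supGrad ϑ ^ (2 / 3 : ℝ))))))) := by
  -- the assumptions on the scheme
  have hv0 : 0 ≤ v := hv ▸ integral_nonneg fun y => sq_nonneg _
  have hs0 : 0 ≤ s := by rw [hs]; positivity
  have hbc : Continuous b := hb.choose_spec.continuous
  have hσc : Continuous σ := hσ.choose_spec.continuous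
  have hγ1 : ∀ k ≥ 1, γ k ≤ γ 1 := fun k hk => hγ.anti 1 k le_rfl hk
  have hctrl : ControlledScheme b σ V γ β P X₀ U :=
    { prob := inferInstance
      drift_cont := hbc
      diffusion_cont := hσc
      lyapunov_cont := hV.contDiff.continuous
      lyapunov_nonneg := fun x => by
        obtain ⟨w, hw, hwV⟩ := hV.lower
        exact hw.le.trans (hwV x)
      order := hβ
      step_pos := fun k => hγ.pos _ (Nat.le_add_left 1 k)
      step_le := fun k => hγ1 _ (Nat.le_add_left 1 k)
      start_meas := hX₀
      innov := hU
      moment := exists_expInt_lyapunov_le hbc hσc hV hσ_bdd hγ.pos hγ1 hγ_small hX₀ hX₀_sub hU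
      bias := fun A B ε hε => hγ.eventually_sq_le hβ.1 hθ A B hε }
  obtain ⟨K, hKφ⟩ := exists_stepBounds hb hσ_bdd hV hφ
  obtain ⟨K', hKϑ⟩ := exists_stepBounds hb hσ_bdd hV hϑ
  have hφ2 : ContDiff ℝ 2 φ := hφ.smooth.contDiff.of_le (by norm_num)
  have hG : ∀ n ≥ 1, 0 < Gam γ n := fun n hn => hγ.Gam_pos hn
  have hprob1 : ∀ n a, prob n a ≤ 1 := fun n a => by
    rw [hprob]
    exact measureReal_le_one
  -- the vanishing error, and the sequences of constants
  obtain ⟨η, hη, hη0, hηlim, hdev⟩ := exists_antitone_tendsto_zero fun δ hδ =>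
    hctrl.eventually_expInt_genSum_sharp_le hKφ hKϑ hv0 hs
      (fun x => by rw [hPoisson x, hv]) hδ
  set q : ℕ → ℝ := fun n => 1 + η n with hq
  set e : ℕ → ℝ := fun n => 4 * η n with he
  set A : ℕ → ℝ := fun n => ATilde v (q n) (e n) with hAdef
  set B : ℕ → ℝ := fun n => BTilde s (q n) (q n) (q n) (e n) with hBdef
  set C : ℕ → ℝ := fun n => Real.exp (η n) with hC
  have hq1 : ∀ n, 1 < q n := fun n => by linarith [hη0 n]
  have hqlim : Tendsto q atTop (𝓝 1) := by simpa [hq] using hηlim.const_add 1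
  have helim : Tendsto e atTop (𝓝 0) := by simpa [he] using hηlim.const_mul 4
  -- the factor `4` in `e` compensates the denominator in `BTilde`
  have hAle : ∀ n, v / 2 + η n ≤ A n := fun n => by
    have := mul_le_mul_of_nonneg_right (hq1 n).le hv0
    simp only [hAdef, he, ATilde]
    linarith [hη0 n]
  have hBle : ∀ n, s / 8 + η n ≤ B n := fun n => by
    have h1 : 1 ≤ q n ^ 3 * q n := one_le_mul_of_one_le_of_one_le (one_le_pow₀ (hq1 n).le) (hq1 n).le
    have h2 := mul_le_mul_of_nonneg_right (hq1 n).le hs0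
    have h3 : 0 ≤ q n * s / 2 + 4 * η n := by
      have := hη0 n
      have := hq1 n
      positivity
    have h4 := mul_le_mul_of_nonneg_right h1 h3
    simp only [hBdef, he, BTilde]
    linarith
  have hA0 : ∀ n, 0 < A n := fun n => lt_of_lt_of_le (by linarith [hη0 n]) (hAle n)
  have hB0 : ∀ n, 0 < B n := fun n => lt_of_lt_of_le (by linarith [hη0 n]) (hBle n)
  have hAlim : Tendsto A atTop (𝓝 (v / 2)) := by
    have := ((hqlim.mul_const v).div_const 2).add helim
    simpa [hAdef, ATilde] using this
  have hBlim : Tendsto B atTop (𝓝 (s / 8)) := by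
    have := (((hqlim.pow 3).mul hqlim).div_const 4).mul
      (((hqlim.mul_const s).div_const 2).add helim)
    have e8 : (1 : ℝ) ^ 3 * 1 / 4 * (1 * s / 2 + 0) = s / 8 := by ring
    rw [e8] at this
    exact this
  have hC1 : ∀ n, 1 ≤ C n := fun n => Real.one_le_exp (hη0 n).le
  have hCanti : Antitone C := fun m n hmn => Real.exp_le_exp.2 (hη hmn)
  have hClim : Tendsto C atTop (𝓝 1) := by
    have := (Real.continuous_exp.tendsto 0).comp hηlim
    rwa [Real.exp_zero] at this
  -- the deviation bound for large ranks
  have hmain : ∀ᶠ n in atTop, ∀ a > 0, ∀ ρ > 1,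
      prob n a ≤ 2 * C n * Real.exp (Pmin a (Gam γ n) (A n) (B n) ρ) := by
    filter_upwards [hdev, eventually_ge_atTop 1] with n hn hn1 a ha ρ hρ
    have hGn := hG n hn1
    have hρ0 : 0 < ρ - 1 := by linarith
    obtain ⟨l, hl, hlP⟩ := (isLeast_quartic ha hGn (hA0 n) (hB0 n) hρ).1
    rw [hprob, ← hlP]
    refine hctrl.measureReal_deviation_le hφ2 hGn (fun l => (hn l ρ hρ).trans
      (ENNReal.ofReal_le_ofReal (Real.exp_le_exp.2 ?_))) a hl
    have h1 := hAle n
    have h2 := hBle n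
    gcongr
  -- `c n = 0` at the finitely many other ranks, where the bound is trivial because `C n ≥ 1`
  obtain ⟨c, hc, hcu⟩ := exists_deviationConstants (fun n => zero_le_one.trans (hC1 n)) hCanti
    hClim (tendsto_const_nhds (x := (1 : ℝ))) hmain
  refine ⟨c, C, q, q, q, e, A, B, hc, fun n => ⟨hq1 n, hq1 n, hq1 n, mul_pos four_pos (hη0 n)⟩,
    hqlim, hqlim, hqlim, helim, fun n => rfl, fun n => rfl, fun n hn a ha ρ hρ => ?_,
    fun n hn a ha ρ hρ => isLeast_quartic ha (hG n hn) (hA0 n) (hB0 n) hρ,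
    fun hvpos => ⟨fun a ha hx => tendsto_Pmin_gaussian hG hA0 hB0 hvpos hAlim hBlim ha hx,
      fun ε hε => ?_⟩, fun hspos => ⟨fun a ha hx => ?_, fun R hR => ?_⟩⟩
  · rcases hcu n with h0 | ⟨h1, h2⟩
    · rw [h0, zero_mul, Real.exp_zero]
      linarith [hprob1 n a, hC1 n]
    · refine (h1 a ha ρ hρ).trans ?_
      have hneg := Pmin_nonpos ha (hG n hn) (hA0 n) (hB0 n) hρ
      have := hC1 n
      have := mul_le_mul_of_nonpos_right h2 hneg
      rw [one_mul] at this
      gcongr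
  · refine exists_deviationConstants_le hC1 hCanti hClim
      (tendsto_gaussian_factor hvpos hAlim hBlim hε).1 hprob1
      (F := fun _ a => a ^ 2 / (2 * v)) (fun n a ha => by positivity)
      (S := fun n a => a / √(Gam γ n) ≤ ε n) ?_
    filter_upwards [hmain, eventually_ge_atTop 1] with n hn hn1 a ha haε
    have hA' := hA0 n
    have hB' := hB0 n
    have hG' := hG n hn1
    refine (hn a ha _ (lt_add_of_pos_right 1
      (by positivity : 0 < 1 / 2 * (√(B n) * a / (A n ^ (3 / 2 : ℝ) * √(Gam γ n)))))).trans ?_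
    have := hC1 n
    have := Pmin_gaussian_le hvpos ha hG' hA' hB' haε
    gcongr
  · have := tendsto_Pmin_superGaussian hG hA0 hB0 hspos hAlim hBlim ha hx
    simpa only [hs, supFrob_mul_supGrad_rpow, mul_assoc] using this
  · have := exists_deviationConstants_le hC1 hCanti hClim
      (tendsto_superGaussian_factor hspos hAlim hBlim hR).1 hprob1
      (F := fun n a => a ^ (4 / 3 : ℝ) * Gam γ n ^ (1 / 3 : ℝ) / (2 * s ^ (1 / 3 : ℝ)))
      (fun n a ha => by
        have := hγ.Gam_nonneg n
        positivity)
      (S := fun n a => R n ≤ a / √(Gam γ n)) (by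
        filter_upwards [hmain, eventually_ge_atTop 1, hR.eventually_gt_atTop 0]
          with n hn hn1 hR0 a ha haR
        refine (hn a ha (1 + 1 / 2) (by norm_num)).trans ?_
        have := hC1 n
        have := Pmin_superGaussian_le hspos ha (hG n hn1) (hA0 n) (hB0 n) hR0 haR
        gcongr)
    simpa only [hs, supFrob_mul_supGrad_rpow, mul_assoc] using this
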